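/- **Theorem 5.2.** Let $\mathbb H=\{x+iy: y>0\}$ be the upper half plane with the hyperbolic measure $dw=\frac{dx\,dy}{y^2}$, let $\Delta=y^2\left(\frac{\partial^2}{\partial x^2}+\frac{\partial^2}{\partial y^2}\right)$, and for $z,w\in\mathbb H$ put $$u(z,w)=\frac{|z-w|^2}{4\,\mathrm{Im}(z)\,\mathrm{Im}(w)},\qquad\text{so that } \cosh d(z,w)=1+2u(z,w).$$ For $s\in\mathbb C$ with $\mathrm{Re}(s)>0$ and $u>0$ let $$G_s(u)=\frac1{4\pi}\int_0^1(\xi(1-\xi))^{s-1}(\xi+u)^{-s}\,d\xi ,$$ and for a function $f$ on $\mathbb H$ with values in a finite-dimensional complex inner product space $V$ let $$R_sf(z)=-\int_{\mathbb H}G_s(u(z,w))\,f(w)\,dw .$$ An element $X$ of the Lie algebra $\mathfrak{sl}_2(\mathbb R)$ acts on functions $F$ on $\mathrm{SL}_2(\mathbb R)$ by $(XF)(g)=\frac{d}{dt}\big|_{t=0}F(g\exp(tX))$. Let $\sigma>0$ and let $f:\mathbb H\to V$ be a ($C^\infty$-)smooth function such that, for $F(g)=f(g\cdot i)$, each of the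 functions $F$, $XF$ and $XYF$ with $X,Y\in\mathfrak{sl}_2(\mathbb R)$ is bounded in norm by a constant (possibly depending on $X,Y$) times $y^\sigma+y^{-\sigma}$, where $y=\mathrm{Im}(g\cdot i)$. If $\mathrm{Re}(s)>1+\sigma$, then the integrals defining $R_sf(z)$ and $R_s(\Delta+s(1-s))f(z)$ converge absolutely for every $z\in\mathbb H$, the function $R_sf$ is smooth, and $$(\Delta+s(1-s))R_sf=f=R_s(\Delta+s(1-s))f .$$ -/

import Mathlib

open scoped UpperHalfPlane MatrixGroups Manifold ContDiff

noncomputable section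

namespace HypResolvent

/-- The exponential of a real traceless `2 × 2` matrix has determinant one. -/
theorem det_exp_eq_one (X : LieAlgebra.SpecialLinear.sl (Fin 2) ℝ) :
    (NormedSpace.exp (X : Matrix (Fin 2) (Fin 2) ℝ)).det = 1 := by
  obtain ⟨A, hA⟩ := X
  have htr : A 0 0 + A 1 1 = 0 := by
    have h : A.trace = 0 := hA
    simpa [Matrix.trace_fin_two] using h
  let J : Matrix (Fin 2) (Fin 2) ℝ := !![0, 1; -1, 0]
  have hJdet : J.det = 1 := by simp [J, Matrix.det_fin_two_of]
  have hJ : IsUnit J := (Matrix.isUnit_iff_isUnit_det J).2 (by simp [hJdet])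
  have hinv : J⁻¹ = !![0, -1; 1, 0] := by
    refine Matrix.inv_eq_right_inv ?_
    ext i j
    fin_cases i <;> fin_cases j <;> simp [J, Matrix.mul_apply, Fin.sum_univ_two, Matrix.vecMul, dotProduct]
  have key : ∀ B : Matrix (Fin 2) (Fin 2) ℝ,
      J * B.transpose * J⁻¹ = !![B 1 1, -B 0 1; -B 1 0, B 0 0] := by
    intro B
    rw [hinv]
    ext i j
    fin_cases i <;> fin_cases j <;> simp [J, Matrix.mul_apply, Fin.sum_univ_two, Matrix.vecMul, dotProduct]
  have hneg : J * A.transpose * J⁻¹ = -A := by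
    rw [key]
    ext i j
    fin_cases i <;> fin_cases j <;> simp <;> linarith
  have h1 : NormedSpace.exp (-A) = J * (NormedSpace.exp A).transpose * J⁻¹ := by
    rw [← hneg, Matrix.exp_conj J _ hJ, Matrix.exp_transpose]
  have h2 : NormedSpace.exp A * NormedSpace.exp (-A) = 1 := by
    rw [← Matrix.exp_add_of_commute _ _ (Commute.neg_right (Commute.refl A)), add_neg_cancel,
      NormedSpace.exp_zero]
  rw [h1, key] at h2
  have h3 := congrFun (congrFun h2 0) 0
  simp [Matrix.mul_apply, Fin.sum_univ_two] at h3
  rw [Matrix.det_fin_two]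
  show NormedSpace.exp A 0 0 * NormedSpace.exp A 1 1
    - NormedSpace.exp A 0 1 * NormedSpace.exp A 1 0 = 1
  linarith

/-- The exponential map `𝔰𝔩₂(ℝ) → SL₂(ℝ)`. -/
def expSL (X : LieAlgebra.SpecialLinear.sl (Fin 2) ℝ) : SL(2, ℝ) :=
  ⟨NormedSpace.exp (X : Matrix (Fin 2) (Fin 2) ℝ), det_exp_eq_one X⟩

/-- The function `g ↦ f (g i)` on `SL₂(ℝ)` attached to a function `f` on `ℍ`. -/
def lift {V : Type*} (f : ℍ → V) (g : SL(2, ℝ)) : V :=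
  f (g • UpperHalfPlane.I)

/-- The derivative of `F` by the Lie algebra element `X`, acting as a left-invariant vector field:
`(X F)(g) = d/dt F (g exp (t X))` at `t = 0`. -/
def lieDeriv {V : Type*} [NormedAddCommGroup V] [NormedSpace ℝ V]
    (X : LieAlgebra.SpecialLinear.sl (Fin 2) ℝ) (F : SL(2, ℝ) → V) (g : SL(2, ℝ)) : V :=
  deriv (fun t : ℝ => F (g * expSL (t • X))) 0

/-- `‖F‖ ≪ y^σ + y^{-σ}` on `SL₂(ℝ)`, where `y = Im (g i)`. -/
def GrowthBound {V : Type*} [NormedAddCommGroup V] (σ : ℝ) (F : SL(2, ℝ) → V) : Prop :=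
  ∃ C : ℝ, ∀ g : SL(2, ℝ),
    ‖F g‖ ≤ C * ((g • UpperHalfPlane.I : ℍ).im ^ σ + (g • UpperHalfPlane.I : ℍ).im ^ (-σ))

/-- The point-pair invariant `u(z,w) = |z - w|² / (4 Im z Im w)`, so that
`cosh d(z,w) = 1 + 2 u(z,w)`. -/
def pointPair (z w : ℍ) : ℝ :=
  ‖(z : ℂ) - (w : ℂ)‖ ^ 2 / (4 * z.im * w.im)

/-- `G_s(u) = (4π)⁻¹ ∫₀¹ (ξ (1 - ξ))^{s-1} (ξ + u)^{-s} dξ`. -/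
def green (s : ℂ) (u : ℝ) : ℂ :=
  (1 / (4 * (Real.pi : ℂ))) *
    ∫ ξ in (0 : ℝ)..1, ((ξ * (1 - ξ) : ℝ) : ℂ) ^ (s - 1) * ((ξ + u : ℝ) : ℂ) ^ (-s)

/-- The integral operator with kernel `-G_s(u(z,w))`, with respect to the hyperbolic measure
`dx dy / y²`. -/
def resolvent {V : Type*} [NormedAddCommGroup V] [NormedSpace ℂ V]
    (s : ℂ) (f : ℍ → V) (z : ℍ) : V :=
  -∫ w : ℍ, green s (pointPair z w) • f w

/-- The hyperbolic Laplacian `y² (∂²/∂x² + ∂²/∂y²)`. -/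
def hypLaplacian {V : Type*} [NormedAddCommGroup V] [NormedSpace ℝ V]
    (f : ℍ → V) (z : ℍ) : V :=
  (z.im ^ 2) • Laplacian.laplacian (fun ζ : ℂ => f (UpperHalfPlane.ofComplex ζ)) (z : ℂ)

/-- The differential operator `Δ + s (1 - s)`. -/
def helmholtz {V : Type*} [NormedAddCommGroup V] [NormedSpace ℂ V]
    (s : ℂ) (f : ℍ → V) (z : ℍ) : V :=
  hypLaplacian f z + (s * (1 - s)) • f z

end HypResolvent

end

noncomputable section

namespace HypResolvent

open MeasureTheory UpperHalfPlane Filter Topology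

/-! ### Real smoothness on the upper half plane in Euclidean coordinates. -/

section Smoothness

variable {V : Type*} [NormedAddCommGroup V] [NormedSpace ℝ V]

/-! Write L for Δ + s(1-s). The kernel -G_s(u(z,w)) is a fundamental solution of L. Indeed G_s
solves the radial form of the equation for u > 0 (`radialHelmholtz_green`), and at u = 0 it has a
logarithmic singularity, captured by u G_s'(u) → -1/(4π) (`tendsto_mul_deriv_green`). Size is
controlled by the majorant u^{-1/2} (1+u)^{1/2 - Re s}, whose product with y^σ + y^{-σ} is
integrable because Re s > 1 + σ (`integrable_greenMajorant`).

For R_s L f = f the singularity is removed by a shift instead of by excising a disc. The kernel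
G_s(u + ε) is smooth up to u = 0, so Green's second identity holds for it without boundary terms,
after a cutoff at infinity (`integral_decay_smul_helmholtz`). Applying L to the shifted kernel
leaves `shiftKernel`, which concentrates on the diagonal as ε → 0. In the scale √ε it tends to
-(1/4π)(1 + |p|²/4)^{-2}, of total mass -1 on the plane, and what remains in the limit is -f(z)
(`integral_green_smul_helmholtz`). The growth of L f needed here comes from writing Δ as E² + H² - H
with left-invariant vector fields (`hypLaplacian_eq_lieDeriv`).

For L R_s f = f, Green's identity, Fubini and the symmetry of the kernel move L and R_s onto a test
function φ, where the first identity applies; so the equation holds weakly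
(`integral_smul_helmholtz_resolvent`). It holds pointwise once R_s f is known to be smooth, which is
proved with a parametrix. A cutoff splits G_s into a near part N and a smooth far part F, and T = -L
F is smooth and supported in 1 ≤ u ≤ 2. The first identity, applied to F, says that G_s composed
with T is F, so that R_s f = T(R_s f) - N f as integral operators (`resolvent_eq_parametrix`). The
first term is smooth because its kernel is smooth and of compact support in w, whatever the
regularity of R_s f; the second because a change of variables by the group moves the dependence on z
from the singular kernel to f. -/

theorem contMDiffAt_ofComplex_real {n : WithTop ℕ∞} {ζ : ℂ} (hζ : 0 < ζ.im) :
    ContMDiffAt 𝓘(ℝ, ℂ) 𝓘(ℝ, ℂ) n ofComplex ζ := by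
  rw [_root_.contMDiffAt_iff]
  constructor
  · rw [ContinuousAt, nhds_induced, tendsto_comap_iff]
    refine Tendsto.congr' (eventuallyEq_coe_comp_ofComplex hζ).symm ?_
    simpa [ofComplex_apply_of_im_pos hζ] using! tendsto_id
  · simpa using! contDiffAt_id.congr_of_eventuallyEq (eventuallyEq_coe_comp_ofComplex hζ)

theorem contMDiff_coe_real {n : WithTop ℕ∞} : ContMDiff 𝓘(ℝ, ℂ) 𝓘(ℝ, ℂ) n ((↑) : ℍ → ℂ) :=
  fun _ => contMDiffAt_extChartAt

theorem contMDiffAt_real_iff {n : WithTop ℕ∞} {h : ℍ → V} {z : ℍ} :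
    ContMDiffAt 𝓘(ℝ, ℂ) 𝓘(ℝ, V) n h z ↔
      ContDiffAt ℝ n (fun ζ : ℂ => h (ofComplex ζ)) (z : ℂ) := by
  rw [← contMDiffAt_iff_contDiffAt]
  refine ⟨fun hf ↦ ?_, fun hf ↦ ?_⟩
  · exact (ofComplex_apply z ▸ hf).comp _ (contMDiffAt_ofComplex_real z.im_pos)
  · simpa only [Function.comp_def, ofComplex_apply] using hf.comp z (contMDiff_coe_real z)

/-- The dictionary through which all calculus is done on `ℂ`. Only points of the open half plane
occur, so the values of `ofComplex` elsewhere never matter. -/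
theorem contMDiff_real_iff {n : WithTop ℕ∞} {h : ℍ → V} :
    ContMDiff 𝓘(ℝ, ℂ) 𝓘(ℝ, V) n h ↔
      ∀ ζ : ℂ, 0 < ζ.im → ContDiffAt ℝ n (fun ζ : ℂ => h (ofComplex ζ)) ζ := by
  constructor
  · intro H ζ hζ
    exact contMDiffAt_real_iff.1 (H ⟨ζ, hζ⟩)
  · intro H z
    exact contMDiffAt_real_iff.2 (H z z.im_pos)

/-- Required for testing against smooth compactly supported functions in `helmholtz_resolvent`. -/
instance isManifold_real : IsManifold 𝓘(ℝ, ℂ) ∞ ℍ :=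
  isOpenEmbedding_coe.isManifold_singleton

theorem isOpen_im_pos : IsOpen {ζ : ℂ | 0 < ζ.im} := isOpen_lt continuous_const Complex.continuous_im

end Smoothness

/-! ### Hyperbolic measure: Euclidean coordinates and invariance. -/

section Integral

variable {V : Type*} [NormedAddCommGroup V] [NormedSpace ℝ V]

theorem map_coe_comap_volume :
    MeasurePreserving UpperHalfPlane.coe ((volume : Measure ℂ).comap UpperHalfPlane.coe)
      ((volume : Measure ℂ).restrict {ζ : ℂ | 0 < ζ.im}) := by
  refine ⟨measurable_coe, ?_⟩
  rw [measurableEmbedding_coe.map_comap]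
  congr 1
  ext ζ
  exact ⟨fun ⟨z, hz⟩ => hz ▸ z.im_pos, fun h => ⟨⟨ζ, h⟩, rfl⟩⟩

theorem measurable_weight : Measurable
    (fun z : ℍ ↦ (1 / NNReal.mk z.im z.im_pos.le : NNReal) ^ 2) := by
  have : Measurable (fun z : ℍ => NNReal.mk z.im z.im_pos.le) :=
    (UpperHalfPlane.continuous_im.measurable).subtype_mk
  simpa using (this.const_div 1).pow_const 2

/-- Integration over `ℍ` in Euclidean coordinates. -/
theorem integral_uhp (F : ℍ → V) :
    ∫ w : ℍ, F w = ∫ ζ : ℂ in {ζ : ℂ | 0 < ζ.im}, (1 / ζ.im ^ 2) • F (ofComplex ζ) := by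
  rw [volume_def, integral_withDensity_eq_integral_smul measurable_weight,
    ← map_coe_comap_volume.integral_comp measurableEmbedding_coe]
  refine integral_congr_ae (Eventually.of_forall fun z => ?_)
  simp only [ofComplex_apply, coe_im, one_div, inv_pow]
  rfl

theorem integrable_uhp (F : ℍ → V) :
    Integrable F ↔
      IntegrableOn (fun ζ : ℂ => (1 / ζ.im ^ 2) • F (ofComplex ζ)) {ζ : ℂ | 0 < ζ.im} := by
  rw [volume_def, integrable_withDensity_iff_integrable_smul measurable_weight,
    IntegrableOn, ← map_coe_comap_volume.integrable_comp_emb measurableEmbedding_coe]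
  refine integrable_congr (Eventually.of_forall fun z => ?_)
  simp only [ofComplex_apply, coe_im, one_div, inv_pow, Function.comp_apply]
  rfl

/-- Inherited from the action of `GL(2, ℝ)`, through which `SL(2, ℝ)` acts. -/
instance smulInvariant_SL : SMulInvariantMeasure SL(2, ℝ) ℍ volume :=
  ⟨fun c _ hs => SMulInvariantMeasure.measure_preimage_smul
    (Matrix.SpecialLinearGroup.mapGL ℝ c : GL (Fin 2) ℝ) hs⟩

instance continuousConstSMul_SL : ContinuousConstSMul SL(2, ℝ) ℍ :=
  ⟨fun c => continuous_const_smul (T := ℍ) (Matrix.SpecialLinearGroup.mapGL ℝ c : GL (Fin 2) ℝ)⟩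

theorem integral_toSL2R_smul (z : ℍ) (F : ℍ → V) :
    ∫ w : ℍ, F (z.toSL2R • w) = ∫ w : ℍ, F w :=
  integral_smul_eq_self F

theorem integrable_toSL2R_smul {E : Type*} [NormedAddCommGroup E] (z : ℍ) {F : ℍ → E} :
    Integrable (fun w : ℍ => F (z.toSL2R • w)) ↔ Integrable F :=
  (measurePreserving_smul z.toSL2R (volume : Measure ℍ)).integrable_comp_emb
    (Homeomorph.smul z.toSL2R).measurableEmbedding

end Integral

/-! ### Translation to the base point and the point-pair invariant. -/

section Translation

/-- The matrix is upper triangular, so it acts by the affine map w ↦ x + y w, which takes `I` to z.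
This is the device that reduces estimates at an arbitrary point z to the point `I`. -/
theorem coe_toSL2R_smul (z w : ℍ) :
    ((z.toSL2R • w : ℍ) : ℂ) = (z.re : ℂ) + (z.im : ℂ) * (w : ℂ) := by
  have h0 : (√z.im : ℂ) ≠ 0 := by simpa [Real.sqrt_ne_zero'] using z.im_pos
  have h1 : (z.im : ℂ) = (√z.im : ℂ) * √z.im := by
    rw [← Complex.ofReal_mul, Real.mul_self_sqrt z.im_pos.le]
  rw [coe_specialLinearGroup_apply]
  simp only [coe_toSL2R, Algebra.algebraMap_self, RingHom.id_apply, Matrix.of_apply,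
    Matrix.cons_val_zero, Matrix.cons_val_one, Matrix.cons_val', Matrix.cons_val_fin_one,
    Complex.ofReal_zero, zero_mul, zero_add, Complex.ofReal_div, Complex.ofReal_one]
  rw [h1]
  field_simp
  ring

theorem im_toSL2R_smul (z w : ℍ) : (z.toSL2R • w : ℍ).im = z.im * w.im := by
  rw [← coe_im, coe_toSL2R_smul]
  simp

theorem pointPair_eq_cosh (z w : ℍ) : pointPair z w = (Real.cosh (dist z w) - 1) / 2 := by
  rw [cosh_dist, pointPair, dist_eq_norm]
  ring

theorem pointPair_smul (g : SL(2, ℝ)) (z w : ℍ) : pointPair (g • z) (g • w) = pointPair z w := by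
  simp only [pointPair_eq_cosh, dist_smul]

theorem pointPair_comm (z w : ℍ) : pointPair z w = pointPair w z := by
  simp only [pointPair_eq_cosh, dist_comm]

theorem pointPair_toSL2R (z w : ℍ) : pointPair z (z.toSL2R • w) = pointPair I w := by
  conv_lhs => rw [← toSL2R_smul_I z]
  rw [toSL2R_smul_I, ← pointPair_smul z.toSL2R I w, toSL2R_smul_I]

theorem pointPair_nonneg (z w : ℍ) : 0 ≤ pointPair z w :=
  div_nonneg (sq_nonneg _) (mul_nonneg (mul_nonneg (by norm_num) z.im_pos.le) w.im_pos.le)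

theorem pointPair_pos {z w : ℍ} (h : w ≠ z) : 0 < pointPair z w := by
  have : (z : ℂ) - w ≠ 0 := sub_ne_zero.2 fun e => h (UpperHalfPlane.ext e.symm)
  have hz := z.im_pos
  have hw := w.im_pos
  unfold pointPair
  positivity

theorem continuous_pointPair : Continuous (fun p : ℍ × ℍ => pointPair p.1 p.2) := by
  simp only [pointPair_eq_cosh]
  fun_prop

theorem isCompact_pointPair_le (z : ℍ) (R : ℝ) : IsCompact {w : ℍ | pointPair z w ≤ R} := by
  -- Since cosh d = 1 + 2u, the set is closed inside a hyperbolic ball, and the space is proper. The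
  -- `max 1` keeps the argument in the domain of `arcosh` when R is negative.
  refine (isCompact_closedBall z (Real.arcosh (max 1 (2 * R + 1)))).of_isClosed_subset ?_ ?_
  · exact isClosed_le (continuous_pointPair.comp (by fun_prop : Continuous fun w => (z, w)))
      continuous_const
  · intro w hw
    rw [Set.mem_ofPred_eq, pointPair_eq_cosh] at hw
    rw [Metric.mem_closedBall, dist_comm]
    have h1 : Real.cosh (dist z w) ≤ max 1 (2 * R + 1) := le_max_of_le_right (by linarith)
    rw [← Real.arcosh_cosh (dist_nonneg (x := z) (y := w))]
    exact (Real.arcosh_le_arcosh (by positivity) (by positivity)).2 h1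

theorem volume_singleton_uhp (z : ℍ) : (volume : Measure ℍ) {z} = 0 := by
  rw [volume_eq_lintegral]
  simp

theorem ae_pointPair_pos (z : ℍ) : ∀ᵐ w : ℍ, 0 < pointPair z w := by
  filter_upwards [compl_mem_ae_iff.2 (volume_singleton_uhp z)] with w hw
  exact pointPair_pos hw

end Translation

/-! ### The Euclidean Laplacian and Green's identity in the plane. -/

section Euclidean

variable {W : Type*} [NormedAddCommGroup W] [NormedSpace ℝ W]

theorem fderiv_fderiv_apply {g : ℂ → W} {ζ : ℂ} (hg : ContDiffAt ℝ 2 g ζ) (v : ℂ) :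
    fderiv ℝ (fun x => fderiv ℝ g x v) ζ v = iteratedFDeriv ℝ 2 g ζ ![v, v] := by
  have h1 : DifferentiableAt ℝ (fderiv ℝ g) ζ :=
    (hg.fderiv_right (m := 1) (by norm_num)).differentiableAt one_ne_zero
  rw [iteratedFDeriv_two_apply, fderiv_clm_apply h1 (differentiableAt_const v)]
  simp

theorem laplacian_eq_fderiv {g : ℂ → W} {ζ : ℂ} (hg : ContDiffAt ℝ 2 g ζ) :
    Laplacian.laplacian g ζ = fderiv ℝ (fun x => fderiv ℝ g x 1) ζ 1
      + fderiv ℝ (fun x => fderiv ℝ g x Complex.I) ζ Complex.I := by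
  rw [InnerProductSpace.laplacian_eq_iteratedFDeriv_complexPlane, fderiv_fderiv_apply hg,
    fderiv_fderiv_apply hg]

/-- Turns second directional derivatives into one-variable derivatives along lines, so that the
Laplacian of a radial function can be computed by hand. -/
theorem fderiv_fderiv_eq_deriv_deriv {g : ℂ → W} {ζ : ℂ} (hg : ContDiffAt ℝ 2 g ζ) (v : ℂ) :
    fderiv ℝ (fun x => fderiv ℝ g x v) ζ v = deriv (deriv fun t : ℝ => g (ζ + t • v)) 0 := by
  have hc : Tendsto (fun t : ℝ => ζ + t • v) (𝓝 0) (𝓝 ζ) := by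
    have : ContinuousAt (fun t : ℝ => ζ + t • v) 0 := by fun_prop
    simpa [ContinuousAt] using this
  have hl : ∀ t : ℝ, HasDerivAt (fun t : ℝ => ζ + t • v) v t := fun t => by
    simpa using ((hasDerivAt_id t).smul_const v).const_add ζ
  have h1 : (deriv fun t : ℝ => g (ζ + t • v)) =ᶠ[𝓝 0] fun t => fderiv ℝ g (ζ + t • v) v := by
    filter_upwards [hc.eventually (hg.eventually (by simp))] with t ht
    exact ((ht.differentiableAt two_ne_zero).hasFDerivAt.comp_hasDerivAt t (hl t)).deriv
  rw [h1.deriv_eq]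
  have h2 : DifferentiableAt ℝ (fun x => fderiv ℝ g x v) (ζ + (0 : ℝ) • v) := by
    have : DifferentiableAt ℝ (fderiv ℝ g) ζ :=
      (hg.fderiv_right (m := 1) (by norm_num)).differentiableAt one_ne_zero
    simpa using this.clm_apply (differentiableAt_const v)
  have h3 := (h2.hasFDerivAt.comp_hasDerivAt (0 : ℝ) (hl 0)).deriv
  simp only [zero_smul, add_zero] at h3
  exact h3.symm

theorem laplacian_eq_deriv {g : ℂ → W} {ζ : ℂ} (hg : ContDiffAt ℝ 2 g ζ) :
    Laplacian.laplacian g ζ = deriv (deriv fun t : ℝ => g (ζ + t)) 0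
      + deriv (deriv fun t : ℝ => g (ζ + t * Complex.I)) 0 := by
  rw [laplacian_eq_fderiv hg, fderiv_fderiv_eq_deriv_deriv hg, fderiv_fderiv_eq_deriv_deriv hg]
  simp

theorem continuousAt_laplacian {g : ℂ → W} {ζ : ℂ} (hg : ContDiffAt ℝ 2 g ζ) :
    ContinuousAt (Laplacian.laplacian g) ζ := by
  rw [InnerProductSpace.laplacian_eq_iteratedFDeriv_complexPlane]
  have h := (hg.iteratedFDeriv_right (m := 0) (i := 2) (by norm_num)).continuousAt
  have h' : ∀ m : Fin 2 → ℂ, ContinuousAt (fun x => iteratedFDeriv ℝ 2 g x m) ζ := fun m =>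
    (ContinuousMultilinearMap.apply ℝ (fun _ : Fin 2 => ℂ) W m).continuous.continuousAt.comp h
  exact (h' _).add (h' _)

theorem laplacian_eq_zero_of_notMem_tsupport {g : ℂ → W} {ζ : ℂ} (h : ζ ∉ tsupport g) :
    Laplacian.laplacian g ζ = 0 := by
  have h0 : g =ᶠ[𝓝 ζ] fun _ => 0 := notMem_tsupport_iff_eventuallyEq.1 h
  rw [(InnerProductSpace.laplacian_congr_nhds h0).eq_of_nhds]
  simp

theorem integrable_smul_of_hasCompactSupport {V : Type*} [NormedAddCommGroup V] [NormedSpace ℂ V]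
    {φ : ℂ → ℂ} {g : ℂ → V} {K : Set ℂ} (hK : IsCompact K) (hφ : ContinuousOn φ K)
    (hsupp : ∀ x ∉ K, φ x = 0) (hg : ContinuousOn g K) : Integrable (fun x => φ x • g x) := by
  rw [← integrableOn_iff_integrable_of_support_subset (s := K)]
  · exact (hφ.smul hg).integrableOn_compact hK
  · intro x hx
    by_contra h
    exact hx (by simp [hsupp x h])

variable {V : Type*} [NormedAddCommGroup V] [NormedSpace ℂ V]

/-- Two integrations by parts. Regularity of g is asked only on the support of φ, because g will be
a function on the half plane composed with `ofComplex`, which is uncontrolled on the real axis. -/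
theorem integral_smul_fderiv_fderiv {φ : ℂ → ℂ} {g : ℂ → V} (hφ : ContDiff ℝ 2 φ)
    (hc : HasCompactSupport φ) (hg : ∀ x ∈ tsupport φ, ContDiffAt ℝ 2 g x) (v : ℂ) :
    ∫ x, φ x • fderiv ℝ (fun x => fderiv ℝ g x v) x v =
      ∫ x, fderiv ℝ (fun x => fderiv ℝ φ x v) x v • g x := by
  have hφ1 : ContDiff ℝ 1 (fun x => fderiv ℝ φ x v) :=
    (hφ.fderiv_right (m := 1) (by norm_num)).clm_apply contDiff_const
  have hφ2 : ContDiff ℝ 0 (fun x => fderiv ℝ (fun x => fderiv ℝ φ x v) x v) :=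
    (hφ1.fderiv_right (m := 0) (by norm_num)).clm_apply contDiff_const
  have hg1 : ∀ x ∈ tsupport φ, ContDiffAt ℝ 1 (fun x => fderiv ℝ g x v) x := fun x hx =>
    ((hg x hx).fderiv_right (m := 1) (by norm_num)).clm_apply contDiffAt_const
  have hg2 : ∀ x ∈ tsupport φ, ContDiffAt ℝ 0 (fun x => fderiv ℝ (fun x => fderiv ℝ g x v) x v) x :=
    fun x hx => ((hg1 x hx).fderiv_right (m := 0) (by norm_num)).clm_apply contDiffAt_const
  have s0 : ∀ x ∉ tsupport φ, φ x = 0 := fun x hx => image_eq_zero_of_notMem_tsupport hx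
  have t1 : tsupport (fun x => fderiv ℝ φ x v) ⊆ tsupport φ := by
    refine closure_minimal (fun x hx => ?_) (isClosed_tsupport φ)
    refine tsupport_fderiv_subset ℝ (subset_tsupport _ ?_)
    intro h
    exact hx (by simp [h])
  have t2 : tsupport (fun x => fderiv ℝ (fun x => fderiv ℝ φ x v) x v) ⊆ tsupport φ := by
    refine closure_minimal (fun x hx => ?_) (isClosed_tsupport φ)
    refine t1 (tsupport_fderiv_subset ℝ (subset_tsupport _ ?_))
    intro h
    exact hx (by simp [h])
  have s1 : ∀ x ∉ tsupport φ, fderiv ℝ φ x v = 0 := fun x hx =>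
    image_eq_zero_of_notMem_tsupport (f := fun x => fderiv ℝ φ x v) fun h => hx (t1 h)
  have s2 : ∀ x ∉ tsupport φ, fderiv ℝ (fun x => fderiv ℝ φ x v) x v = 0 := fun x hx =>
    image_eq_zero_of_notMem_tsupport (f := fun x => fderiv ℝ (fun x => fderiv ℝ φ x v) x v)
      fun h => hx (t2 h)
  have c0 : ContinuousOn g (tsupport φ) := fun x hx => (hg x hx).continuousAt.continuousWithinAt
  have c1 : ContinuousOn (fun x => fderiv ℝ g x v) (tsupport φ) := fun x hx =>
    (hg1 x hx).continuousAt.continuousWithinAt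
  have c2 : ContinuousOn (fun x => fderiv ℝ (fun x => fderiv ℝ g x v) x v) (tsupport φ) :=
    fun x hx => (hg2 x hx).continuousAt.continuousWithinAt
  have e1 : ∫ x, φ x • fderiv ℝ (fun x => fderiv ℝ g x v) x v =
      -∫ x, fderiv ℝ φ x v • fderiv ℝ g x v := by
    refine integral_smul_fderiv_eq_neg_fderiv_smul_of_integrable (f := φ)
      (g := fun x => fderiv ℝ g x v) ?_ ?_ ?_ ?_ ?_
    · exact integrable_smul_of_hasCompactSupport hc hφ1.continuous.continuousOn s1 c1
    · exact integrable_smul_of_hasCompactSupport hc hφ.continuous.continuousOn s0 c2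
    · exact integrable_smul_of_hasCompactSupport hc hφ.continuous.continuousOn s0 c1
    · exact fun x _ => hφ.contDiffAt.differentiableAt two_ne_zero
    · exact fun x hx => (hg1 x hx).differentiableAt one_ne_zero
  have e2 : ∫ x, fderiv ℝ φ x v • fderiv ℝ g x v =
      -∫ x, fderiv ℝ (fun x => fderiv ℝ φ x v) x v • g x := by
    refine integral_smul_fderiv_eq_neg_fderiv_smul_of_integrable (f := fun x => fderiv ℝ φ x v)
      (g := g) ?_ ?_ ?_ ?_ ?_
    · exact integrable_smul_of_hasCompactSupport hc hφ2.continuous.continuousOn s2 c0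
    · exact integrable_smul_of_hasCompactSupport hc hφ1.continuous.continuousOn s1 c1
    · exact integrable_smul_of_hasCompactSupport hc hφ1.continuous.continuousOn s1 c0
    · exact fun x _ => hφ1.contDiffAt.differentiableAt one_ne_zero
    · exact fun x hx => (hg x (t1 hx)).differentiableAt two_ne_zero
  rw [e1, e2, neg_neg]

/-- **Green's second identity** in the plane, against a compactly supported function. -/
theorem integral_smul_laplacian {φ : ℂ → ℂ} {g : ℂ → V} (hφ : ContDiff ℝ 2 φ)
    (hc : HasCompactSupport φ) (hg : ∀ x ∈ tsupport φ, ContDiffAt ℝ 2 g x) :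
    ∫ x, φ x • Laplacian.laplacian g x = ∫ x, Laplacian.laplacian φ x • g x := by
  have s0 : ∀ x ∉ tsupport φ, φ x = 0 := fun x hx => image_eq_zero_of_notMem_tsupport hx
  have c0 : ContinuousOn g (tsupport φ) := fun x hx => (hg x hx).continuousAt.continuousWithinAt
  have c2 : ∀ v : ℂ, ContinuousOn (fun x => iteratedFDeriv ℝ 2 g x ![v, v]) (tsupport φ) :=
    fun v x hx => by
      have h := ((hg x hx).iteratedFDeriv_right (m := 0) (i := 2) (by norm_num)).continuousAt
      exact ((ContinuousMultilinearMap.apply ℝ (fun _ : Fin 2 => ℂ) V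
        ![v, v]).continuous.continuousAt.comp h).continuousWithinAt
  have d2 : ∀ v : ℂ, Continuous (fun x => iteratedFDeriv ℝ 2 φ x ![v, v]) := fun v =>
    (ContinuousMultilinearMap.apply ℝ (fun _ : Fin 2 => ℂ) ℂ ![v, v]).continuous.comp
      (hφ.continuous_iteratedFDeriv le_rfl)
  have s2 : ∀ v : ℂ, ∀ x ∉ tsupport φ, iteratedFDeriv ℝ 2 φ x ![v, v] = 0 := fun v x hx => by
    have := image_eq_zero_of_notMem_tsupport fun h => hx (tsupport_iteratedFDeriv_subset (𝕜 := ℝ) 2 h)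
    rw [this]; rfl
  have key : ∀ v : ℂ, ∫ x, φ x • iteratedFDeriv ℝ 2 g x ![v, v] =
      ∫ x, iteratedFDeriv ℝ 2 φ x ![v, v] • g x := fun v => by
    rw [← integral_congr_ae (Eventually.of_forall fun x => ?_), integral_smul_fderiv_fderiv hφ hc hg v]
    · refine integral_congr_ae (Eventually.of_forall fun x => ?_)
      simp only [fderiv_fderiv_apply hφ.contDiffAt]
    · by_cases hx : x ∈ tsupport φ
      · simp only [fderiv_fderiv_apply (hg x hx)]
      · simp [s0 x hx]
  have i1 : ∀ v : ℂ, Integrable fun x => φ x • iteratedFDeriv ℝ 2 g x ![v, v] := fun v =>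
    integrable_smul_of_hasCompactSupport hc hφ.continuous.continuousOn s0 (c2 v)
  have i2 : ∀ v : ℂ, Integrable fun x => iteratedFDeriv ℝ 2 φ x ![v, v] • g x := fun v =>
    integrable_smul_of_hasCompactSupport hc (d2 v).continuousOn (s2 v) c0
  simp only [InnerProductSpace.laplacian_eq_iteratedFDeriv_complexPlane, smul_add, add_smul]
  rw [integral_add (i1 _) (i1 _), integral_add (i2 _) (i2 _), key, key]

end Euclidean

/-! ### Green's identity on the hyperbolic plane. -/

section Hyperbolic

variable {V : Type*} [NormedAddCommGroup V] [NormedSpace ℂ V]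

/-- The extension by zero of a compactly supported function on `ℍ` to `ℂ`. -/
def extendZero (φ : ℍ → ℂ) (ζ : ℂ) : ℂ := if 0 < ζ.im then φ (ofComplex ζ) else 0

theorem tsupport_extendZero {φ : ℍ → ℂ} (hc : HasCompactSupport φ) :
    tsupport (extendZero φ) ⊆ (↑) '' tsupport φ := by
  refine closure_minimal (fun ζ hζ => ?_) (hc.image continuous_coe).isClosed
  have h : 0 < ζ.im := by
    by_contra h
    exact hζ (by simp [extendZero, h])
  refine ⟨⟨ζ, h⟩, subset_tsupport _ ?_, rfl⟩
  intro h0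
  exact hζ (by simp [extendZero, h, ofComplex_apply_of_im_pos h, h0])

theorem hasCompactSupport_extendZero {φ : ℍ → ℂ} (hc : HasCompactSupport φ) :
    HasCompactSupport (extendZero φ) :=
  (hc.image continuous_coe).of_isClosed_subset (isClosed_tsupport _) (tsupport_extendZero hc)

theorem extendZero_eventuallyEq (φ : ℍ → ℂ) {ζ : ℂ} (hζ : 0 < ζ.im) :
    extendZero φ =ᶠ[𝓝 ζ] fun ζ => φ (ofComplex ζ) := by
  filter_upwards [isOpen_im_pos.mem_nhds hζ] with w hw
  exact if_pos hw

theorem contDiff_extendZero {n : WithTop ℕ∞} {φ : ℍ → ℂ} (hc : HasCompactSupport φ)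
    (hφ : ContMDiff 𝓘(ℝ, ℂ) 𝓘(ℝ, ℂ) n φ) : ContDiff ℝ n (extendZero φ) := by
  rw [contDiff_iff_contDiffAt]
  intro ζ
  by_cases hζ : 0 < ζ.im
  · exact (contMDiff_real_iff.1 hφ ζ hζ).congr_of_eventuallyEq (extendZero_eventuallyEq φ hζ)
  · have : ζ ∉ tsupport (extendZero φ) := by
      intro h
      obtain ⟨z, -, rfl⟩ := tsupport_extendZero hc h
      exact hζ z.im_pos
    exact contDiffAt_const.congr_of_eventuallyEq (notMem_tsupport_iff_eventuallyEq.1 this)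

/-- **Green's second identity** on the hyperbolic plane, against a compactly supported function. -/
theorem integral_smul_hypLaplacian {φ : ℍ → ℂ} {h : ℍ → V} (hφ : ContMDiff 𝓘(ℝ, ℂ) 𝓘(ℝ, ℂ) 2 φ)
    (hc : HasCompactSupport φ) (hh : ContMDiff 𝓘(ℝ, ℂ) 𝓘(ℝ, V) 2 h) :
    ∫ w, φ w • hypLaplacian h w = ∫ w, hypLaplacian φ w • h w := by
  have key := integral_smul_laplacian (φ := extendZero φ) (g := fun ζ => h (ofComplex ζ))
    (contDiff_extendZero hc hφ) (hasCompactSupport_extendZero hc) (fun ζ hζ => by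
      obtain ⟨z, -, rfl⟩ := tsupport_extendZero hc hζ
      exact contMDiff_real_iff.1 hh _ z.im_pos)
  have hout : ∀ ζ : ℂ, ζ ∉ {ζ : ℂ | 0 < ζ.im} → ζ ∉ tsupport (extendZero φ) := by
    intro ζ hζ h
    obtain ⟨z, -, rfl⟩ := tsupport_extendZero hc h
    exact hζ z.im_pos
  rw [integral_uhp, integral_uhp]
  have e1 := setIntegral_eq_integral_of_forall_compl_eq_zero (μ := volume)
    (s := {ζ : ℂ | 0 < ζ.im})
    (f := fun ζ => extendZero φ ζ • Laplacian.laplacian (fun ζ : ℂ => h (ofComplex ζ)) ζ)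
    (fun ζ hζ => by simp only [image_eq_zero_of_notMem_tsupport (hout ζ hζ), zero_smul])
  have e2 := setIntegral_eq_integral_of_forall_compl_eq_zero (μ := volume)
    (s := {ζ : ℂ | 0 < ζ.im})
    (f := fun ζ => Laplacian.laplacian (extendZero φ) ζ • h (ofComplex ζ))
    (fun ζ hζ => by simp only [laplacian_eq_zero_of_notMem_tsupport (hout ζ hζ), zero_smul])
  rw [← e1, ← e2] at key
  have hm : MeasurableSet {ζ : ℂ | 0 < ζ.im} := isOpen_im_pos.measurableSet
  refine Eq.trans ?_ (key.trans ?_)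
  · refine setIntegral_congr_fun hm fun ζ (hζ : 0 < ζ.im) => ?_
    have hne : ζ.im ^ 2 ≠ 0 := by positivity
    simp only [hypLaplacian, extendZero, if_pos hζ, ofComplex_apply_of_im_pos hζ]
    simp only [UpperHalfPlane.mk_im, one_div]
    -- The density y^{-2} of the measure cancels the factor y² of Δ, so the hyperbolic identity is
    -- the Euclidean one.
    rw [smul_comm, inv_smul_smul₀ hne]
  · refine setIntegral_congr_fun hm fun ζ (hζ : 0 < ζ.im) => ?_
    have hne : ζ.im ^ 2 ≠ 0 := by positivity
    simp only [hypLaplacian,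
      (InnerProductSpace.laplacian_congr_nhds (extendZero_eventuallyEq φ hζ)).eq_of_nhds,
      ofComplex_apply_of_im_pos hζ]
    simp only [UpperHalfPlane.mk_im, one_div]
    rw [smul_assoc, inv_smul_smul₀ hne]

theorem continuous_hypLaplacian {h : ℍ → V} (hh : ContMDiff 𝓘(ℝ, ℂ) 𝓘(ℝ, V) 2 h) :
    Continuous (hypLaplacian h) := by
  rw [continuous_iff_continuousAt]
  intro z
  have h1 := continuousAt_laplacian (contMDiff_real_iff.1 hh z z.im_pos)
  exact (UpperHalfPlane.continuous_im.pow 2).continuousAt.smul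
    (ContinuousAt.comp (f := ((↑) : ℍ → ℂ)) h1 continuous_coe.continuousAt)

theorem continuous_helmholtz (s : ℂ) {h : ℍ → V} (hh : ContMDiff 𝓘(ℝ, ℂ) 𝓘(ℝ, V) 2 h) :
    Continuous (helmholtz s h) :=
  (continuous_hypLaplacian hh).add (hh.continuous.const_smul _)

theorem hypLaplacian_eq_zero {φ : ℍ → V} {w : ℍ} (hw : w ∉ tsupport φ) :
    hypLaplacian φ w = 0 := by
  have h0 : (fun ζ : ℂ => φ (ofComplex ζ)) =ᶠ[𝓝 (w : ℂ)] fun _ => 0 := by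
    have := notMem_tsupport_iff_eventuallyEq.1 hw
    rw [← isOpenEmbedding_coe.map_nhds_eq]
    rw [EventuallyEq, eventually_map]
    filter_upwards [this] with z hz
    simpa using hz
  rw [hypLaplacian, (InnerProductSpace.laplacian_congr_nhds h0).eq_of_nhds]
  simp

theorem integrable_smul_uhp {φ : ℍ → ℂ} {h : ℍ → V} {K : Set ℍ} (hK : IsCompact K)
    (hφ : Continuous φ) (hsupp : ∀ x ∉ K, φ x = 0) (hh : Continuous h) :
    Integrable (fun w => φ w • h w) := by
  rw [← integrableOn_iff_integrable_of_support_subset (s := K)]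
  · exact (hφ.smul hh).continuousOn.integrableOn_compact hK
  · intro x hx
    by_contra h
    exact hx (by simp [hsupp x h])

theorem integral_smul_helmholtz (s : ℂ) {φ : ℍ → ℂ} {h : ℍ → V}
    (hφ : ContMDiff 𝓘(ℝ, ℂ) 𝓘(ℝ, ℂ) 2 φ)
    (hc : HasCompactSupport φ) (hh : ContMDiff 𝓘(ℝ, ℂ) 𝓘(ℝ, V) 2 h) :
    ∫ w, φ w • helmholtz s h w = ∫ w, helmholtz s φ w • h w := by
  have s0 : ∀ x ∉ tsupport φ, φ x = 0 := fun x hx => image_eq_zero_of_notMem_tsupport hx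
  simp only [helmholtz, smul_add, add_smul, smul_eq_mul]
  rw [integral_add, integral_add, integral_smul_hypLaplacian hφ hc hh]
  · congr 1
    refine integral_congr_ae (Eventually.of_forall fun w => ?_)
    simp only [smul_smul, mul_comm]
  · exact integrable_smul_uhp hc (continuous_hypLaplacian hφ)
      (fun x hx => hypLaplacian_eq_zero hx) hh.continuous
  · exact integrable_smul_uhp hc (hφ.continuous.const_smul (s * (1 - s)))
      (fun x hx => by simp only [s0 x hx, mul_zero]) hh.continuous
  · exact integrable_smul_uhp hc hφ.continuous s0 (continuous_hypLaplacian hh)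
  · exact integrable_smul_uhp hc hφ.continuous s0 (hh.continuous.const_smul _)

end Hyperbolic

/-! ### The operator on functions of the point-pair invariant. -/

/-- The radial part of `Δ + s (1 - s)` in the variable `u`. -/
def radialHelmholtz (s : ℂ) (k : ℝ → ℂ) (u : ℝ) : ℂ :=
  ((u * (u + 1) : ℝ) : ℂ) * deriv (deriv k) u + ((2 * u + 1 : ℝ) : ℂ) * deriv k u
    + s * (1 - s) * k u

/-- The chain rule of second order. The first derivative of q is given near 0, the second only at 0.
-/
theorem deriv_deriv_comp {W : Type*} [NormedAddCommGroup W] [NormedSpace ℝ W] {k : ℝ → W} {q q₁ : ℝ → ℝ} {q₂ : ℝ}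
    (h₁ : ∀ᶠ t in 𝓝 0, HasDerivAt q (q₁ t) t) (h₂ : HasDerivAt q₁ q₂ 0)
    (hk : ContDiffAt ℝ 2 k (q 0)) :
    deriv (deriv fun t => k (q t)) 0 = q₂ • deriv k (q 0) + (q₁ 0 ^ 2) • deriv (deriv k) (q 0) := by
  have hq : ContinuousAt q 0 := h₁.self_of_nhds.continuousAt
  have e : (deriv fun t => k (q t)) =ᶠ[𝓝 0] fun t => (q₁ t) • deriv k (q t) := by
    filter_upwards [h₁, hq.eventually (hk.eventually (by simp))] with t ht hkt
    exact ((hkt.differentiableAt two_ne_zero).hasDerivAt.scomp t ht).deriv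
  have hk1 : DifferentiableAt ℝ (deriv k) (q 0) :=
    ((hk.fderiv_right (m := 1) (by norm_num)).clm_apply
      (contDiffAt_const (c := (1 : ℝ)))).differentiableAt one_ne_zero
  have h₃ : deriv (fun t => q₁ t • deriv k (q t)) 0 = _ :=
    (h₂.smul (hk1.hasDerivAt.scomp 0 h₁.self_of_nhds)).deriv
  rw [e.deriv_eq, h₃, smul_smul, ← pow_two, add_comm, Function.comp_apply]

/-- `pointPair` in Euclidean coordinates. -/
def pointPairC (z : ℍ) (ζ : ℂ) : ℝ :=
  ((ζ.re - z.re) ^ 2 + (ζ.im - z.im) ^ 2) / (4 * z.im * ζ.im)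

theorem pointPair_eq (z w : ℍ) :
    pointPair z w = ((w.re - z.re) ^ 2 + (w.im - z.im) ^ 2) / (4 * z.im * w.im) := by
  rw [pointPair, ← Complex.normSq_eq_norm_sq, Complex.normSq_apply]
  simp only [Complex.sub_re, Complex.sub_im, coe_re, coe_im]
  ring

theorem pointPair_ofComplex (z : ℍ) {ζ : ℂ} (hζ : 0 < ζ.im) :
    pointPair z (ofComplex ζ) = pointPairC z ζ := by
  rw [pointPair_eq, ofComplex_apply_of_im_pos hζ]
  rfl

theorem contDiffAt_pointPairC {n : WithTop ℕ∞} (z : ℍ) {ζ : ℂ} (hζ : 0 < ζ.im) :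
    ContDiffAt ℝ n (pointPairC z) ζ := by
  have h1 : ContDiff ℝ n Complex.re := Complex.reCLM.contDiff
  have h2 : ContDiff ℝ n Complex.im := Complex.imCLM.contDiff
  have hz := z.im_pos
  refine ContDiffAt.div ?_ ?_ (by positivity)
  · exact (((h1.sub contDiff_const).pow 2).add ((h2.sub contDiff_const).pow 2)).contDiffAt
  · exact (contDiff_const.mul h2).contDiffAt

/-- The invariant u, unlike the distance, is smooth across the diagonal; hence no condition beyond
smoothness of k on [0, ∞). -/
theorem contMDiff_comp_pointPair {n : WithTop ℕ∞} {k : ℝ → ℂ}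
    (hk : ∀ u, 0 ≤ u → ContDiffAt ℝ n k u) (z : ℍ) :
    ContMDiff 𝓘(ℝ, ℂ) 𝓘(ℝ, ℂ) n (fun w => k (pointPair z w)) := by
  rw [contMDiff_real_iff]
  intro ζ hζ
  have e : (fun ζ : ℂ => k (pointPair z (ofComplex ζ))) =ᶠ[𝓝 ζ] fun ζ => k (pointPairC z ζ) := by
    filter_upwards [isOpen_im_pos.mem_nhds hζ] with w hw
    rw [pointPair_ofComplex z hw]
  refine ContDiffAt.congr_of_eventuallyEq ?_ e
  refine ContDiffAt.comp ζ (hk _ ?_) (contDiffAt_pointPairC z hζ)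
  rw [← pointPair_ofComplex z hζ]
  exact pointPair_nonneg _ _

/-- By the chain rule Δ(k ∘ u) = y²|∇u|² k''(u) + (Δu) k'(u), so only the two coefficients have to
be computed. In the proof `r1` and `r2` are the horizontal and the vertical second derivative. -/
theorem helmholtz_comp_pointPair (s : ℂ) {k : ℝ → ℂ} (hk : ∀ u, 0 ≤ u → ContDiffAt ℝ 2 k u)
    (z w : ℍ) :
    helmholtz s (fun w => k (pointPair z w)) w = radialHelmholtz s k (pointPair z w) := by
  have hw := w.im_pos
  have hz := z.im_pos
  have e : (fun ζ : ℂ => k (pointPair z (ofComplex ζ))) =ᶠ[𝓝 (w : ℂ)]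
      fun ζ => k (pointPairC z ζ) := by
    filter_upwards [isOpen_im_pos.mem_nhds hw] with v hv
    rw [pointPair_ofComplex z hv]
  have hu : pointPair z w = pointPairC z w := by
    rw [← pointPair_ofComplex z hw, ofComplex_apply]
  have hkz := hk _ (pointPair_nonneg z w)
  rw [hu] at hkz
  have hc : ContDiffAt ℝ 2 (fun ζ => k (pointPairC z ζ)) (w : ℂ) :=
    hkz.comp (w : ℂ) (contDiffAt_pointPairC z hw)
  rw [helmholtz, hypLaplacian, (InnerProductSpace.laplacian_congr_nhds e).eq_of_nhds,
    laplacian_eq_deriv hc]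
  set x := z.re
  set y := z.im
  set a := w.re
  set b := w.im
  have r1 : deriv (deriv fun t : ℝ => k (pointPairC z (w + t))) 0 =
      ((2 / (4 * y * b) : ℝ) : ℂ) * deriv k (pointPairC z w)
      + (((2 * (a - x) / (4 * y * b)) ^ 2 : ℝ) : ℂ) * deriv (deriv k) (pointPairC z w) := by
    have hq : (fun t : ℝ => pointPairC z (w + t)) =
        fun t => ((a + t - x) ^ 2 + (b - y) ^ 2) / (4 * y * b) := by
      ext t; simp [pointPairC, x, y, a, b]
    have := deriv_deriv_comp (k := k) (q := fun t : ℝ => pointPairC z (w + t))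
      (q₁ := fun t => 2 * (a + t - x) / (4 * y * b)) (q₂ := 2 / (4 * y * b)) ?_ ?_ (by simpa using hkz)
    · simpa using this
    · refine Eventually.of_forall fun t => ?_
      rw [hq]
      have := ((((((hasDerivAt_id t).const_add a).sub_const x).pow 2).add_const
        ((b - y) ^ 2)).div_const (4 * y * b))
      simpa using this
    · have := ((((hasDerivAt_id (0 : ℝ)).const_add a).sub_const x).const_mul 2).div_const (4 * y * b)
      simpa using this
  have r2 : deriv (deriv fun t : ℝ => k (pointPairC z (w + t * Complex.I))) 0 =
      ((2 * (y ^ 2 + (a - x) ^ 2) / (4 * y * b ^ 3) : ℝ) : ℂ) * deriv k (pointPairC z w)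
      + ((((b ^ 2 - (y ^ 2 + (a - x) ^ 2)) / (4 * y * b ^ 2)) ^ 2 : ℝ) : ℂ) *
        deriv (deriv k) (pointPairC z w) := by
    have hq : (fun t : ℝ => pointPairC z (w + t * Complex.I)) =
        fun t => ((a - x) ^ 2 + (b + t - y) ^ 2) / (4 * y * (b + t)) := by
      ext t; simp [pointPairC, x, y, a, b]
    have hpos : ∀ᶠ t : ℝ in 𝓝 0, 0 < b + t := by
      refine (continuous_const.add continuous_id).continuousAt.eventually (lt_mem_nhds ?_)
      simpa using hw
    have := deriv_deriv_comp (k := k) (q := fun t : ℝ => pointPairC z (w + t * Complex.I))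
      (q₁ := fun t => ((b + t) ^ 2 - (y ^ 2 + (a - x) ^ 2)) / (4 * y * (b + t) ^ 2))
      (q₂ := 2 * (y ^ 2 + (a - x) ^ 2) / (4 * y * b ^ 3)) ?_ ?_ (by simpa using hkz)
    · simpa using this
    · filter_upwards [hpos] with t ht
      rw [hq]
      have h1 : HasDerivAt (fun t : ℝ => b + t) 1 t := (hasDerivAt_id t).const_add b
      have := (((h1.sub_const y).pow 2).const_add ((a - x) ^ 2)).div (h1.const_mul (4 * y))
        (by positivity)
      convert! this using 1
      simp only [Pi.pow_apply]
      field_simp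
      push_cast
      ring
    · have h1 : HasDerivAt (fun t : ℝ => b + t) 1 0 := (hasDerivAt_id (0 : ℝ)).const_add b
      have := ((h1.pow 2).sub_const (y ^ 2 + (a - x) ^ 2)).div ((h1.pow 2).const_mul (4 * y))
        (by simp only [Pi.pow_apply, add_zero]; positivity)
      convert! this using 1
      simp only [Pi.pow_apply, add_zero]
      field_simp
      push_cast
      ring
  rw [r1, r2, ← hu]
  simp only [radialHelmholtz, smul_eq_mul, Complex.real_smul]
  -- The two identities behind the radial form: y²|∇u|² = u(u+1), and then Δu = 2u+1.
  have hA : b ^ 2 * ((2 * (a - x) / (4 * y * b)) ^ 2 +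
      ((b ^ 2 - (y ^ 2 + (a - x) ^ 2)) / (4 * y * b ^ 2)) ^ 2) =
      pointPair z w * (pointPair z w + 1) := by
    rw [pointPair_eq]
    simp only [← show z.im = y from rfl, ← show w.im = b from rfl] at *
    field_simp
    ring
  have hB : b ^ 2 * (2 / (4 * y * b) + 2 * (y ^ 2 + (a - x) ^ 2) / (4 * y * b ^ 3)) =
      2 * pointPair z w + 1 := by
    rw [pointPair_eq]
    simp only [← show z.im = y from rfl, ← show w.im = b from rfl] at *
    field_simp
    ring
  rw [← hA, ← hB]
  push_cast
  ring

section

variable {V : Type*} [NormedAddCommGroup V] [NormedSpace ℂ V]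

theorem hasCompactSupport_comp_pointPair {k : ℝ → ℂ} {R : ℝ} (hR : ∀ u, R ≤ u → k u = 0) (z : ℍ) :
    HasCompactSupport (fun w => k (pointPair z w)) := by
  refine HasCompactSupport.intro (isCompact_pointPair_le z R) fun w hw => hR _ ?_
  exact (not_le.1 hw).le

theorem integral_comp_pointPair_smul_helmholtz (s : ℂ) {k : ℝ → ℂ} {R : ℝ}
    (hk : ∀ u, 0 ≤ u → ContDiffAt ℝ 2 k u) (hR : ∀ u, R ≤ u → k u = 0) (z : ℍ) {h : ℍ → V}
    (hh : ContMDiff 𝓘(ℝ, ℂ) 𝓘(ℝ, V) 2 h) :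
    ∫ w, k (pointPair z w) • helmholtz s h w =
      ∫ w, radialHelmholtz s k (pointPair z w) • h w := by
  rw [integral_smul_helmholtz s (contMDiff_comp_pointPair hk z)
    (hasCompactSupport_comp_pointPair hR z) hh]
  simp only [helmholtz_comp_pointPair s hk]

end

/-! ### Derivatives of the Green function and its differential equation. -/

section GreenFunction

theorem hasDerivAt_cpow_real (c : ℂ) {x : ℝ} (hx : 0 < x) :
    HasDerivAt (fun y : ℝ => (y : ℂ) ^ c) (c * (x : ℂ) ^ (c - 1)) x := by
  have := (hasDerivAt_id (x : ℂ)).cpow_const (c := c) (Or.inl hx)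
  simpa using this.comp_ofReal

theorem hasDerivAt_cpow_add (c : ℂ) {x a : ℝ} (hx : 0 < a + x) :
    HasDerivAt (fun y : ℝ => ((a + y : ℝ) : ℂ) ^ c) (c * ((a + x : ℝ) : ℂ) ^ (c - 1)) x := by
  have := (hasDerivAt_cpow_real c hx).scomp x ((hasDerivAt_id x).const_add a)
  simpa [Function.comp_def] using this

theorem continuousOn_cpow_real {X : Type*} [TopologicalSpace X] {q : X → ℝ} {S : Set X} (c : ℂ)
    (hq : ContinuousOn q S) (hpos : ∀ x ∈ S, 0 < q x) :
    ContinuousOn (fun x => ((q x : ℝ) : ℂ) ^ c) S :=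
  (Complex.continuous_ofReal.comp_continuousOn hq).cpow_const fun x hx => Or.inl (hpos x hx)

theorem continuous_cpow_ofReal {c : ℂ} (hc : 0 < c.re) : Continuous fun x : ℝ => (x : ℂ) ^ c :=
  Complex.continuous_ofReal_cpow_const hc

theorem norm_cpow_real {x : ℝ} (hx : 0 < x) (c : ℂ) : ‖(x : ℂ) ^ c‖ = x ^ c.re :=
  Complex.norm_cpow_eq_rpow_re_of_pos hx c

/-- The integral `∫₀¹ (ξ (1 - ξ))^{s-1} (ξ + u)^{-c} dξ`. -/
def greenInt (s c : ℂ) (u : ℝ) : ℂ :=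
  ∫ ξ in (0 : ℝ)..1, ((ξ * (1 - ξ) : ℝ) : ℂ) ^ (s - 1) * ((ξ + u : ℝ) : ℂ) ^ (-c)

variable {s : ℂ}

theorem continuous_weight (hs : 1 < s.re) :
    Continuous fun ξ : ℝ => ((ξ * (1 - ξ) : ℝ) : ℂ) ^ (s - 1) :=
  (continuous_cpow_ofReal (c := s - 1) (by simpa using hs)).comp (by fun_prop)

theorem continuousOn_greenIntegrand (hs : 1 < s.re) (c : ℂ) {u : ℝ} (hu : 0 < u) :
    ContinuousOn (fun ξ : ℝ => ((ξ * (1 - ξ) : ℝ) : ℂ) ^ (s - 1) * ((ξ + u : ℝ) : ℂ) ^ (-c))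
      (Set.Icc 0 1) :=
  (continuous_weight hs).continuousOn.mul
    (continuousOn_cpow_real _ (by fun_prop) fun ξ hξ => by linarith [hξ.1])

theorem intervalIntegrable_greenIntegrand (hs : 1 < s.re) (c : ℂ) {u : ℝ} (hu : 0 < u) :
    IntervalIntegrable
      (fun ξ : ℝ => ((ξ * (1 - ξ) : ℝ) : ℂ) ^ (s - 1) * ((ξ + u : ℝ) : ℂ) ^ (-c)) volume 0 1 :=
  ContinuousOn.intervalIntegrable (by simpa using continuousOn_greenIntegrand hs c hu)

/-- Differentiating under the integral raises c by one and leaves the weight alone; this is why c is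
kept separate from s. Since Re s > 1 the weight is continuous, so the differentiated integrand is
bounded on [u/2, 2u] × [0, 1]. -/
theorem hasDerivAt_greenInt (hs : 1 < s.re) (c : ℂ) {u : ℝ} (hu : 0 < u) :
    HasDerivAt (greenInt s c) (-c * greenInt s (c + 1) u) u := by
  set F' : ℝ → ℝ → ℂ := fun u ξ =>
    ((ξ * (1 - ξ) : ℝ) : ℂ) ^ (s - 1) * (-c * ((ξ + u : ℝ) : ℂ) ^ (-c - 1))
  have hcont : ContinuousOn (fun p : ℝ × ℝ => F' p.1 p.2)
      (Set.Icc (u / 2) (2 * u) ×ˢ Set.Icc 0 1) := by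
    refine ContinuousOn.mul ?_ (continuousOn_const.mul ?_)
    · exact ((continuous_weight hs).comp continuous_snd).continuousOn
    · refine continuousOn_cpow_real _ (by fun_prop) fun p hp => ?_
      have h1 := hp.1.1
      have h2 := hp.2.1
      linarith
  obtain ⟨C, hC⟩ := (isCompact_Icc.prod isCompact_Icc).exists_bound_of_continuousOn hcont
  have h := intervalIntegral.hasDerivAt_integral_of_dominated_loc_of_deriv_le (μ := volume)
    (F := fun u ξ => ((ξ * (1 - ξ) : ℝ) : ℂ) ^ (s - 1) * ((ξ + u : ℝ) : ℂ) ^ (-c)) (F' := F')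
    (x₀ := u) (s := Set.Icc (u / 2) (2 * u)) (a := 0) (b := 1) (bound := fun _ => C)
    (Icc_mem_nhds (by linarith) (by linarith)) ?_ ?_ ?_ ?_ ?_ ?_
  · convert! h.2 using 1
    simp only [greenInt, F', ← intervalIntegral.integral_const_mul]
    refine intervalIntegral.integral_congr fun ξ _ => ?_
    simp only [neg_add, ← sub_eq_add_neg]
    ring
  · filter_upwards [lt_mem_nhds hu] with v hv
    exact (intervalIntegrable_greenIntegrand hs c hv).aestronglyMeasurable_restrict_uIoc
  · exact intervalIntegrable_greenIntegrand hs c hu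
  · have : IntervalIntegrable (F' u) volume 0 1 := by
      refine ContinuousOn.intervalIntegrable ?_
      rw [Set.uIcc_of_le zero_le_one]
      refine hcont.comp (f := fun ξ : ℝ => (u, ξ)) (by fun_prop) fun ξ hξ => ⟨⟨?_, ?_⟩, hξ⟩
      · simp only; linarith
      · simp only; linarith
    exact this.aestronglyMeasurable_restrict_uIoc
  · refine Eventually.of_forall fun ξ hξ v hv => ?_
    rw [Set.uIoc_of_le zero_le_one] at hξ
    exact hC (v, ξ) ⟨hv, Set.Ioc_subset_Icc_self hξ⟩
  · exact intervalIntegrable_const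
  · refine Eventually.of_forall fun ξ hξ v hv => ?_
    rw [Set.uIoc_of_le zero_le_one] at hξ
    exact (hasDerivAt_cpow_add (-c) (a := ξ) (by linarith [hξ.1, hv.1])).const_mul _

theorem contDiffOn_greenInt (hs : 1 < s.re) (n : ℕ) (c : ℂ) :
    ContDiffOn ℝ n (greenInt s c) (Set.Ioi 0) := by
  induction n generalizing c with
  | zero =>
    rw [Nat.cast_zero, contDiffOn_zero]
    exact fun u hu => (hasDerivAt_greenInt hs c hu).continuousAt.continuousWithinAt
  | succ n ih =>
    rw [Nat.cast_succ, contDiffOn_succ_iff_deriv_of_isOpen isOpen_Ioi]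
    refine ⟨fun u hu => (hasDerivAt_greenInt hs c hu).differentiableAt.differentiableWithinAt,
      by simp, ?_⟩
    exact (contDiffOn_const.mul (ih (c + 1))).congr fun u hu => (hasDerivAt_greenInt hs c hu).deriv

theorem green_eq (s : ℂ) : green s = fun u => 1 / (4 * (Real.pi : ℂ)) * greenInt s s u := rfl

theorem contDiffAt_green (hs : 1 < s.re) {n : WithTop ℕ∞} (hn : n ≤ ∞) {u : ℝ} (hu : 0 < u) :
    ContDiffAt ℝ n (green s) u := by
  have : ContDiffOn ℝ ∞ (greenInt s s) (Set.Ioi 0) :=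
    contDiffOn_infty.2 fun n => contDiffOn_greenInt hs n s
  exact contDiffAt_const.mul ((this.contDiffAt (Ioi_mem_nhds hu)).of_le hn)

theorem hasDerivAt_green (hs : 1 < s.re) {u : ℝ} (hu : 0 < u) :
    HasDerivAt (green s) (-(1 / (4 * (Real.pi : ℂ))) * (s * greenInt s (s + 1) u)) u := by
  convert! (hasDerivAt_greenInt hs s hu).const_mul (1 / (4 * (Real.pi : ℂ))) using 1
  ring

theorem deriv_green (hs : 1 < s.re) {u : ℝ} (hu : 0 < u) :
    deriv (green s) u = -(1 / (4 * (Real.pi : ℂ))) * (s * greenInt s (s + 1) u) :=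
  (hasDerivAt_green hs hu).deriv

theorem deriv_deriv_green (hs : 1 < s.re) {u : ℝ} (hu : 0 < u) :
    deriv (deriv (green s)) u =
      1 / (4 * (Real.pi : ℂ)) * (s * (s + 1) * greenInt s (s + 2) u) := by
  have e : deriv (green s) =ᶠ[𝓝 u]
      fun u => -(1 / (4 * (Real.pi : ℂ))) * (s * greenInt s (s + 1) u) := by
    filter_upwards [lt_mem_nhds hu] with v hv using deriv_green hs hv
  rw [e.deriv_eq, (((hasDerivAt_greenInt hs (s + 1) hu).const_mul s).const_mul _).deriv]
  rw [show s + 1 + 1 = s + 2 by ring]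
  ring

theorem cpow_real_sub_one {x : ℝ} (hx : 0 < x) (c : ℂ) :
    (x : ℂ) ^ (c - 1) = (x : ℂ) ^ c / x := by
  rw [Complex.cpow_sub _ _ (by exact_mod_cast hx.ne'), Complex.cpow_one]

theorem cpow_real_eq_mul {x : ℝ} (hx : 0 < x) (c : ℂ) :
    (x : ℂ) ^ c = x * (x : ℂ) ^ (c - 1) := by
  rw [cpow_real_sub_one hx, mul_div_cancel₀]
  exact_mod_cast hx.ne'

/-- The Green function solves the radial equation. -/
theorem radialHelmholtz_green (hs : 1 < s.re) {u : ℝ} (hu : 0 < u) :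
    radialHelmholtz s (green s) u = 0 := by
  have hne : s - 1 ≠ 0 := fun h => by
    rw [sub_eq_zero.1 h, Complex.one_re] at hs
    exact lt_irrefl _ hs
  have hs0 : s ≠ 0 := fun h => by
    rw [h, Complex.zero_re] at hs
    linarith
  have h0 := intervalIntegrable_greenIntegrand hs s hu
  have h1 := intervalIntegrable_greenIntegrand hs (s + 1) hu
  have h2 := intervalIntegrable_greenIntegrand hs (s + 2) hu
  set A : ℂ := ((u * (u + 1) : ℝ) : ℂ) * (s * (s + 1))
  set B : ℂ := ((2 * u + 1 : ℝ) : ℂ) * s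
  have key : A * greenInt s (s + 2) u - B * greenInt s (s + 1) u
      + s * (1 - s) * greenInt s s u = 0 := by
    simp only [greenInt, ← intervalIntegral.integral_const_mul]
    rw [← intervalIntegral.integral_sub (h2.const_mul A) (h1.const_mul B),
      ← intervalIntegral.integral_add ((h2.const_mul A).sub (h1.const_mul B)) (h0.const_mul _)]
    -- The combined integrand is the ξ-derivative of s (ξ(1-ξ))^s (ξ+u)^{-s-1}, which vanishes at
    -- both endpoints. The identity of integrands is checked after writing all powers of ξ + u as
    -- multiples of (ξ+u)^{-(s+2)}.
    have ftc := intervalIntegral.integral_eq_sub_of_hasDerivAt_of_le zero_le_one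
      (f := fun ξ : ℝ => s * (((ξ * (1 - ξ) : ℝ) : ℂ) ^ s * ((u + ξ : ℝ) : ℂ) ^ (-s - 1)))
      (f' := fun ξ : ℝ => A * (((ξ * (1 - ξ) : ℝ) : ℂ) ^ (s - 1) * ((ξ + u : ℝ) : ℂ) ^ (-(s + 2)))
        - B * (((ξ * (1 - ξ) : ℝ) : ℂ) ^ (s - 1) * ((ξ + u : ℝ) : ℂ) ^ (-(s + 1)))
        + s * (1 - s) * (((ξ * (1 - ξ) : ℝ) : ℂ) ^ (s - 1) * ((ξ + u : ℝ) : ℂ) ^ (-s)))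
      ?_ ?_ (((h2.const_mul A).sub (h1.const_mul B)).add (h0.const_mul _))
    · rw [ftc]
      simp [Complex.zero_cpow hs0]
    · refine continuousOn_const.mul (ContinuousOn.mul ?_ ?_)
      · exact ((continuous_cpow_ofReal (c := s) (by linarith)).comp
          (by fun_prop : Continuous fun ξ : ℝ => ξ * (1 - ξ))).continuousOn
      · exact continuousOn_cpow_real _ (by fun_prop) fun ξ hξ => by linarith [hξ.1]
    · intro ξ hξ
      have hp : 0 < ξ * (1 - ξ) := mul_pos hξ.1 (by linarith [hξ.2])
      have hq : 0 < u + ξ := by linarith [hξ.1]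
      have d1 : HasDerivAt (fun ξ : ℝ => ((ξ * (1 - ξ) : ℝ) : ℂ) ^ s)
          (((1 * (1 - ξ) + ξ * (-1) : ℝ)) • (s * ((ξ * (1 - ξ) : ℝ) : ℂ) ^ (s - 1))) ξ :=
        HasDerivAt.scomp (h := fun ξ : ℝ => ξ * (1 - ξ)) ξ (hasDerivAt_cpow_real s hp)
          ((hasDerivAt_id ξ).mul ((hasDerivAt_id ξ).const_sub 1))
      have d2 := hasDerivAt_cpow_add (-s - 1) (a := u) hq
      convert! (d1.mul d2).const_mul s using 1
      have e1 := cpow_real_eq_mul hp s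
      have e2 : ((u + ξ : ℝ) : ℂ) ^ (-s - 1) =
          ((u + ξ : ℝ) : ℂ) * ((u + ξ : ℝ) : ℂ) ^ (-(s + 2)) := by
        rw [show -(s + 2) = (-s - 1) - 1 by ring]
        exact cpow_real_eq_mul hq _
      have e3 : ((u + ξ : ℝ) : ℂ) ^ (-s) =
          ((u + ξ : ℝ) : ℂ) ^ 2 * ((u + ξ : ℝ) : ℂ) ^ (-(s + 2)) := by
        rw [pow_two, mul_assoc, ← e2]
        exact cpow_real_eq_mul hq _
      have e4 : -s - 1 - 1 = -(s + 2) := by ring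
      have e5 : -(s + 1) = -s - 1 := by ring
      rw [show ξ + u = u + ξ by ring, e4, e5, e3, e2, e1, Complex.real_smul]
      simp only [A, B]
      push_cast
      ring
  rw [radialHelmholtz, deriv_deriv_green hs hu, deriv_green hs hu, green_eq]
  simp only [A, B] at key
  linear_combination (1 / (4 * (Real.pi : ℂ))) * key

end GreenFunction

/-! ### Size of the Green function and its singularity at the diagonal. -/

section GreenBounds

variable {s : ℂ}

theorem div_add_le_one_div {ξ u : ℝ} (h0 : 0 ≤ ξ) (h1 : ξ ≤ 1) (hu : 0 < u) :
    ξ / (ξ + u) ≤ 1 / (1 + u) := by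
  rw [div_le_div_iff₀ (by linarith) (by linarith)]
  nlinarith

/-- With ρ = Re s, the integrand is at most (ξ/(ξ+u))^{ρ-1/2} (ξ+u)^{-1/2} ξ^{-1/2}. The first
factor is at most (1+u)^{1/2-ρ}, the second at most u^{-1/2}, and the third has integral 2. The
singularity is really logarithmic, but u^{-1/2} is locally integrable in the plane and is easier to
handle. -/
theorem norm_green_le (hs : 1 < s.re) {u : ℝ} (hu : 0 < u) :
    ‖green s u‖ ≤ u ^ (-(1 / 2) : ℝ) * (1 + u) ^ (1 / 2 - s.re) := by
  have hb : IntervalIntegrable (fun ξ : ℝ => (1 + u) ^ (1 / 2 - s.re) * u ^ (-(1 / 2) : ℝ) *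
      ξ ^ (-(1 / 2) : ℝ)) volume 0 1 :=
    (intervalIntegral.intervalIntegrable_rpow' (by norm_num)).const_mul _
  have h1 : ‖greenInt s s u‖ ≤ ∫ ξ in (0 : ℝ)..1,
      (1 + u) ^ (1 / 2 - s.re) * u ^ (-(1 / 2) : ℝ) * ξ ^ (-(1 / 2) : ℝ) := by
    refine intervalIntegral.norm_integral_le_of_norm_le zero_le_one ?_ hb
    have hne : ∀ᵐ ξ : ℝ, ξ ≠ 1 := by simp [ae_iff]
    filter_upwards [hne] with ξ hξ1 hξ
    have h0 : 0 < ξ := hξ.1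
    have h1' : 0 < 1 - ξ := by
      have := lt_of_le_of_ne hξ.2 hξ1
      linarith
    have hp : 0 < ξ * (1 - ξ) := mul_pos h0 h1'
    have hq : 0 < ξ + u := by linarith
    rw [norm_mul, norm_cpow_real hp, norm_cpow_real hq, Complex.sub_re, Complex.one_re,
      Complex.neg_re, Real.mul_rpow h0.le h1'.le]
    have e1 : (1 - ξ) ^ (s.re - 1) ≤ 1 := Real.rpow_le_one h1'.le (by linarith) (by linarith)
    have e2 : (ξ / (ξ + u)) ^ (s.re - 1 / 2) ≤ (1 / (1 + u)) ^ (s.re - 1 / 2) :=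
      Real.rpow_le_rpow (by positivity) (div_add_le_one_div h0.le hξ.2 hu) (by linarith)
    have e3 : (ξ + u) ^ (-(1 / 2) : ℝ) ≤ u ^ (-(1 / 2) : ℝ) :=
      Real.rpow_le_rpow_of_nonpos hu (by linarith) (by norm_num)
    have e4 : (1 / (1 + u)) ^ (s.re - 1 / 2) = (1 + u) ^ (-(s.re - 1 / 2)) := by
      rw [one_div (1 + u), Real.inv_rpow (by linarith), ← Real.rpow_neg (by linarith)]
    rw [Real.div_rpow h0.le hq.le, e4] at e2
    calc ξ ^ (s.re - 1) * (1 - ξ) ^ (s.re - 1) * (ξ + u) ^ (-s.re)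
        ≤ ξ ^ (s.re - 1) * 1 * (ξ + u) ^ (-s.re) := by gcongr
      _ = ξ ^ (s.re - 1 / 2) / (ξ + u) ^ (s.re - 1 / 2) * (ξ + u) ^ (-(1 / 2) : ℝ)
          * ξ ^ (-(1 / 2) : ℝ) := by
        rw [mul_one, div_eq_mul_inv, ← Real.rpow_neg hq.le, mul_assoc (ξ ^ _),
          ← Real.rpow_add hq, mul_right_comm, ← Real.rpow_add h0]
        ring_nf
      _ ≤ (1 + u) ^ (-(s.re - 1 / 2)) * u ^ (-(1 / 2) : ℝ) * ξ ^ (-(1 / 2) : ℝ) := by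
        gcongr
      _ = _ := by rw [neg_sub]
  have h2 : ∫ ξ in (0 : ℝ)..1,
      (1 + u) ^ (1 / 2 - s.re) * u ^ (-(1 / 2) : ℝ) * ξ ^ (-(1 / 2) : ℝ) =
      (1 + u) ^ (1 / 2 - s.re) * u ^ (-(1 / 2) : ℝ) * 2 := by
    rw [intervalIntegral.integral_const_mul, integral_rpow (Or.inl (by norm_num))]
    norm_num
  rw [h2] at h1
  -- The crude bound 1/(4π) ≤ 1/2 absorbs the 2 from the integral, so that the estimate has constant
  -- 1.
  have h3 : ‖(1 / (4 * (Real.pi : ℂ)))‖ ≤ 1 / 2 := by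
    rw [norm_div, norm_mul, Complex.norm_real, Real.norm_eq_abs, abs_of_pos Real.pi_pos]
    simp only [norm_one, Complex.norm_ofNat]
    rw [div_le_div_iff₀ (by positivity) (by norm_num)]
    linarith [Real.pi_gt_three]
  rw [green_eq, norm_mul]
  calc _ ≤ 1 / 2 * ((1 + u) ^ (1 / 2 - s.re) * u ^ (-(1 / 2) : ℝ) * 2) := by gcongr
    _ = _ := by ring

/-- The normalized derivative `(s - 1) ∫₀¹ (1 - ξ)^{s-2} (ξ / (ξ + u))^s dξ = -4π u G_s'(u)`. -/
def greenSlope (s : ℂ) (u : ℝ) : ℂ :=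
  ∫ ξ in (0 : ℝ)..1, ((1 - ξ : ℝ) : ℂ) ^ (s - 2) * ((ξ / (ξ + u) : ℝ) : ℂ) ^ s

theorem intervalIntegrable_one_sub_cpow (hs : 1 < s.re) :
    IntervalIntegrable (fun ξ : ℝ => ((1 - ξ : ℝ) : ℂ) ^ (s - 2)) volume 0 1 := by
  have h : IntervalIntegrable (fun ξ : ℝ => (ξ : ℂ) ^ (s - 2)) volume 1 0 :=
    intervalIntegral.intervalIntegrable_cpow' (by simp; linarith)
  simpa using h.comp_sub_left 1

theorem continuousOn_ratio_cpow (hs : 0 < s.re) {u : ℝ} (hu : 0 < u) :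
    ContinuousOn (fun ξ : ℝ => ((ξ / (ξ + u) : ℝ) : ℂ) ^ s) (Set.Icc 0 1) := by
  refine (continuous_cpow_ofReal hs).comp_continuousOn ?_
  exact continuousOn_id.div (by fun_prop) fun ξ hξ => by linarith [hξ.1]

theorem intervalIntegrable_greenSlope (hs : 1 < s.re) {u : ℝ} (hu : 0 < u) :
    IntervalIntegrable
      (fun ξ : ℝ => ((1 - ξ : ℝ) : ℂ) ^ (s - 2) * ((ξ / (ξ + u) : ℝ) : ℂ) ^ s) volume 0 1 :=
  (intervalIntegrable_one_sub_cpow hs).mul_continuousOn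
    (by simpa using continuousOn_ratio_cpow (by linarith) hu)

/-- Integration by parts with the primitive (1-ξ)^{s-1} (ξ/(ξ+u))^s, which is zero at both ends. The
integrand on the right is dominated by |(1-ξ)^{s-2}| uniformly in u, so the behaviour of u G_s'(u)
at 0 and at infinity can be read off. -/
theorem greenInt_succ_eq (hs : 1 < s.re) {u : ℝ} (hu : 0 < u) :
    u * (s * greenInt s (s + 1) u) = (s - 1) * greenSlope s u := by
  have hne : s - 1 ≠ 0 := fun h => by
    rw [sub_eq_zero.1 h, Complex.one_re] at hs
    exact lt_irrefl _ hs
  have hs0 : s ≠ 0 := fun h => by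
    rw [h, Complex.zero_re] at hs
    linarith
  have h1 := intervalIntegrable_greenIntegrand hs (s + 1) hu
  have h2 := intervalIntegrable_greenSlope hs hu
  have ftc := intervalIntegral.integral_eq_sub_of_hasDerivAt_of_le zero_le_one
    (f := fun ξ : ℝ => ((1 - ξ : ℝ) : ℂ) ^ (s - 1) * ((ξ / (ξ + u) : ℝ) : ℂ) ^ s)
    (f' := fun ξ : ℝ => (u * s) * (((ξ * (1 - ξ) : ℝ) : ℂ) ^ (s - 1) *
        ((ξ + u : ℝ) : ℂ) ^ (-(s + 1)))
      - (s - 1) * (((1 - ξ : ℝ) : ℂ) ^ (s - 2) * ((ξ / (ξ + u) : ℝ) : ℂ) ^ s))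
    ?_ ?_ ((h1.const_mul _).sub (h2.const_mul _))
  · rw [intervalIntegral.integral_sub (h1.const_mul _) (h2.const_mul _),
      intervalIntegral.integral_const_mul, intervalIntegral.integral_const_mul] at ftc
    simp only [sub_self, Complex.ofReal_zero, Complex.zero_cpow hne, zero_mul, zero_div,
      Complex.zero_cpow hs0, mul_zero] at ftc
    rw [greenInt, greenSlope, ← mul_assoc]
    exact sub_eq_zero.1 ftc
  · refine ContinuousOn.mul ?_ (continuousOn_ratio_cpow (by linarith) hu)
    exact ((continuous_cpow_ofReal (c := s - 1) (by simpa using hs)).comp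
      (by fun_prop : Continuous fun ξ : ℝ => 1 - ξ)).continuousOn
  · intro ξ hξ
    have hp : 0 < 1 - ξ := by linarith [hξ.2]
    have hq : 0 < ξ + u := by linarith [hξ.1]
    have hr : 0 < ξ / (ξ + u) := div_pos hξ.1 hq
    have hqc : ((ξ + u : ℝ) : ℂ) ≠ 0 := by exact_mod_cast hq.ne'
    have d1 : HasDerivAt (fun ξ : ℝ => ((1 - ξ : ℝ) : ℂ) ^ (s - 1))
        ((-1 : ℝ) • ((s - 1) * ((1 - ξ : ℝ) : ℂ) ^ (s - 1 - 1))) ξ :=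
      HasDerivAt.scomp (h := fun ξ : ℝ => 1 - ξ) ξ (hasDerivAt_cpow_real (s - 1) hp)
        ((hasDerivAt_id ξ).const_sub 1)
    have d2 : HasDerivAt (fun ξ : ℝ => ((ξ / (ξ + u) : ℝ) : ℂ) ^ s)
        (((1 * (ξ + u) - ξ * 1) / (ξ + u) ^ 2 : ℝ) •
          (s * ((ξ / (ξ + u) : ℝ) : ℂ) ^ (s - 1))) ξ :=
      HasDerivAt.scomp (h := fun ξ : ℝ => ξ / (ξ + u)) ξ (hasDerivAt_cpow_real s hr)
        ((hasDerivAt_id ξ).div ((hasDerivAt_id ξ).add_const u) hq.ne')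
    convert! d1.mul d2 using 1
    have e1 : ((ξ * (1 - ξ) : ℝ) : ℂ) ^ (s - 1) =
        (ξ : ℂ) ^ (s - 1) * ((1 - ξ : ℝ) : ℂ) ^ (s - 1) := by
      rw [Complex.ofReal_mul, Complex.mul_cpow_ofReal_nonneg hξ.1.le hp.le]
    have e2 : (ξ : ℂ) ^ (s - 1) =
        ((ξ / (ξ + u) : ℝ) : ℂ) ^ (s - 1) * ((ξ + u : ℝ) : ℂ) ^ (s - 1) := by
      rw [← Complex.mul_cpow_ofReal_nonneg hr.le hq.le, ← Complex.ofReal_mul,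
        div_mul_cancel₀ _ hq.ne']
    have e3 : ((ξ + u : ℝ) : ℂ) ^ (s - 1) * ((ξ + u : ℝ) : ℂ) ^ (-(s + 1)) =
        1 / ((ξ + u : ℝ) : ℂ) ^ 2 := by
      rw [← Complex.cpow_add _ _ hqc, show s - 1 + -(s + 1) = -((2 : ℕ) : ℂ) by push_cast; ring,
        Complex.cpow_neg, Complex.cpow_natCast, one_div]
    have e4 : s - 1 - 1 = s - 2 := by ring
    rw [e4, e1, e2]
    have : (u : ℂ) * s * (((ξ / (ξ + u) : ℝ) : ℂ) ^ (s - 1) * ((ξ + u : ℝ) : ℂ) ^ (s - 1) *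
        ((1 - ξ : ℝ) : ℂ) ^ (s - 1) * ((ξ + u : ℝ) : ℂ) ^ (-(s + 1))) =
        u * s * ((ξ / (ξ + u) : ℝ) : ℂ) ^ (s - 1) * ((1 - ξ : ℝ) : ℂ) ^ (s - 1) *
        (((ξ + u : ℝ) : ℂ) ^ (s - 1) * ((ξ + u : ℝ) : ℂ) ^ (-(s + 1))) := by ring
    rw [this, e3, Complex.real_smul, Complex.real_smul]
    push_cast
    ring

theorem mul_deriv_green (hs : 1 < s.re) {u : ℝ} (hu : 0 < u) :
    u * deriv (green s) u = -(1 / (4 * (Real.pi : ℂ))) * ((s - 1) * greenSlope s u) := by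
  rw [deriv_green hs hu, ← greenInt_succ_eq hs hu]
  ring

theorem integral_one_sub_cpow (hs : 1 < s.re) :
    ∫ ξ in (0 : ℝ)..1, ((1 - ξ : ℝ) : ℂ) ^ (s - 2) = 1 / (s - 1) := by
  have := intervalIntegral.integral_comp_sub_left (a := 0) (b := 1)
    (fun ξ : ℝ => (ξ : ℂ) ^ (s - 2)) 1
  rw [this, integral_cpow (Or.inl (by simp; linarith))]
  have hne : s - 1 ≠ 0 := fun h => by
    rw [sub_eq_zero.1 h, Complex.one_re] at hs
    exact lt_irrefl _ hs
  simp only [sub_self, sub_zero, Complex.ofReal_one, Complex.one_cpow, Complex.ofReal_zero]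
  rw [show s - 2 + 1 = s - 1 by ring, Complex.zero_cpow hne, sub_zero]

/-- The ratio ξ/(ξ+u) is at most 1/(1+u), which leaves the integral of |(1-ξ)^{s-2}| as the
constant. -/
theorem norm_greenSlope_le (hs : 1 < s.re) :
    ∃ C, 0 ≤ C ∧ ∀ u : ℝ, 0 < u → ‖greenSlope s u‖ ≤ C * (1 + u) ^ (-s.re) := by
  refine ⟨∫ ξ in (0 : ℝ)..1, ‖((1 - ξ : ℝ) : ℂ) ^ (s - 2)‖,
    intervalIntegral.integral_nonneg zero_le_one fun _ _ => norm_nonneg _, fun u hu => ?_⟩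
  rw [← intervalIntegral.integral_mul_const]
  refine intervalIntegral.norm_integral_le_of_norm_le zero_le_one (ae_of_all _ fun ξ hξ => ?_)
    ((intervalIntegrable_one_sub_cpow hs).norm.mul_const _)
  have hq : 0 < ξ + u := by linarith [hξ.1]
  rw [norm_mul, norm_cpow_real (div_pos hξ.1 hq), Real.rpow_neg (by linarith),
    ← Real.inv_rpow (by linarith), ← one_div]
  refine mul_le_mul_of_nonneg_left ?_ (norm_nonneg _)
  exact Real.rpow_le_rpow (div_pos hξ.1 hq).le (div_add_le_one_div hξ.1.le hξ.2 hu) (by linarith)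

theorem tendsto_greenSlope (hs : 1 < s.re) :
    Tendsto (greenSlope s) (𝓝[>] 0) (𝓝 (1 / (s - 1))) := by
  rw [← integral_one_sub_cpow hs]
  refine intervalIntegral.tendsto_integral_filter_of_dominated_convergence
    (fun ξ => ‖((1 - ξ : ℝ) : ℂ) ^ (s - 2)‖) ?_ ?_ (intervalIntegrable_one_sub_cpow hs).norm ?_
  · filter_upwards [self_mem_nhdsWithin] with u hu
    exact (intervalIntegrable_greenSlope hs hu).aestronglyMeasurable_restrict_uIoc
  · filter_upwards [self_mem_nhdsWithin] with u hu
    refine ae_of_all _ fun ξ hξ => ?_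
    rw [Set.uIoc_of_le zero_le_one] at hξ
    have hu' : 0 < u := hu
    have hq : 0 < ξ + u := by linarith [hξ.1]
    rw [norm_mul, norm_cpow_real (div_pos hξ.1 hq)]
    refine mul_le_of_le_one_right (norm_nonneg _) ?_
    refine Real.rpow_le_one (div_pos hξ.1 hq).le ?_ (by linarith)
    rw [div_le_one hq]
    linarith
  · refine ae_of_all _ fun ξ hξ => ?_
    rw [Set.uIoc_of_le zero_le_one] at hξ
    have h1 : Tendsto (fun u : ℝ => ξ / (ξ + u)) (𝓝[>] 0) (𝓝 1) := by
      have : ContinuousAt (fun u : ℝ => ξ / (ξ + u)) 0 :=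
        continuousAt_const.div (by fun_prop) (by simpa using hξ.1.ne')
      have h := this.tendsto
      rw [add_zero, div_self hξ.1.ne'] at h
      exact h.mono_left nhdsWithin_le_nhds
    have h2 := ((continuous_cpow_ofReal (c := s) (by linarith)).tendsto 1).comp h1
    simpa using h2.const_mul (((1 - ξ : ℝ) : ℂ) ^ (s - 2))

theorem norm_deriv_green_le (hs : 1 < s.re) :
    ∃ C, 0 ≤ C ∧ ∀ u : ℝ, 0 < u → ‖deriv (green s) u‖ ≤ C * u⁻¹ * (1 + u) ^ (-s.re) := by
  obtain ⟨C, hC0, hC⟩ := norm_greenSlope_le hs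
  refine ⟨‖(1 / (4 * (Real.pi : ℂ)))‖ * (‖s - 1‖ * C), by positivity, fun u hu => ?_⟩
  have hne : (u : ℂ) ≠ 0 := by exact_mod_cast hu.ne'
  have e : deriv (green s) u =
      (u : ℂ)⁻¹ * (-(1 / (4 * (Real.pi : ℂ))) * ((s - 1) * greenSlope s u)) := by
    rw [← mul_deriv_green hs hu, inv_mul_cancel_left₀ hne]
  rw [e, norm_mul, norm_mul, norm_mul, norm_neg, norm_inv, Complex.norm_real, Real.norm_eq_abs,
    abs_of_pos hu]
  calc _ ≤ u⁻¹ * (‖(1 / (4 * (Real.pi : ℂ)))‖ * (‖s - 1‖ * (C * (1 + u) ^ (-s.re)))) := by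
        gcongr; exact hC u hu
    _ = _ := by ring

/-- The radial equation solved for the second derivative. Bounds and limits of G_s'' then follow
from those of G_s and G_s' without a further integral. -/
theorem deriv_deriv_green_eq (hs : 1 < s.re) {u : ℝ} (hu : 0 < u) :
    deriv (deriv (green s)) u = -(((2 * u + 1) / (u * (u + 1)) : ℝ) : ℂ) * deriv (green s) u
      - ((1 / (u * (u + 1)) : ℝ) : ℂ) * (s * (1 - s) * green s u) := by
  have h := radialHelmholtz_green hs hu
  rw [radialHelmholtz] at h
  have h1 : (u : ℂ) ≠ 0 := by exact_mod_cast hu.ne'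
  have h2 : (u : ℂ) + 1 ≠ 0 := by exact_mod_cast (by linarith : u + 1 ≠ 0)
  push_cast at h ⊢
  field_simp
  linear_combination h

theorem norm_deriv_deriv_green_le (hs : 1 < s.re) :
    ∃ C, 0 ≤ C ∧ ∀ u : ℝ, 0 < u →
      ‖deriv (deriv (green s)) u‖ ≤ C * (u ^ 2)⁻¹ * (1 + u) ^ (-s.re) := by
  obtain ⟨C, hC0, hC⟩ := norm_deriv_green_le hs
  refine ⟨2 * C + ‖s * (1 - s)‖, by positivity, fun u hu => ?_⟩
  have hg := norm_green_le hs hu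
  have hd := hC u hu
  have hg' : ‖green s u‖ ≤ u⁻¹ * (1 + u) * (1 + u) ^ (-s.re) := by
    refine hg.trans ?_
    have e1 : u ^ (-(1 / 2) : ℝ) = u⁻¹ * u ^ (1 / 2 : ℝ) := by
      rw [← Real.rpow_neg_one, ← Real.rpow_add hu]
      norm_num
    have e2 : (1 + u) ^ (1 / 2 - s.re) = (1 + u) ^ (1 / 2 : ℝ) * (1 + u) ^ (-s.re) := by
      rw [← Real.rpow_add (by linarith), sub_eq_add_neg]
    have e3 : u ^ (1 / 2 : ℝ) ≤ (1 + u) ^ (1 / 2 : ℝ) :=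
      Real.rpow_le_rpow hu.le (by linarith) (by norm_num)
    have e4 : (1 + u) ^ (1 / 2 : ℝ) * (1 + u) ^ (1 / 2 : ℝ) = 1 + u := by
      rw [← Real.rpow_add (by linarith)]
      norm_num
    rw [e1, e2]
    calc u⁻¹ * u ^ (1 / 2 : ℝ) * ((1 + u) ^ (1 / 2 : ℝ) * (1 + u) ^ (-s.re))
        ≤ u⁻¹ * (1 + u) ^ (1 / 2 : ℝ) * ((1 + u) ^ (1 / 2 : ℝ) * (1 + u) ^ (-s.re)) := by gcongr
      _ = u⁻¹ * ((1 + u) ^ (1 / 2 : ℝ) * (1 + u) ^ (1 / 2 : ℝ)) * (1 + u) ^ (-s.re) := by ring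
      _ = _ := by rw [e4]
  rw [deriv_deriv_green_eq hs hu]
  refine (norm_sub_le _ _).trans ?_
  rw [norm_mul, norm_mul, norm_mul, norm_neg, Complex.norm_real, Complex.norm_real,
    Real.norm_eq_abs, Real.norm_eq_abs, abs_of_pos (by positivity), abs_of_pos (by positivity)]
  have f1 : (2 * u + 1) / (u * (u + 1)) ≤ 2 * u⁻¹ := by
    rw [div_le_iff₀ (by positivity)]
    field_simp
    linarith
  calc _ ≤ 2 * u⁻¹ * (C * u⁻¹ * (1 + u) ^ (-s.re)) +
        1 / (u * (u + 1)) * (‖s * (1 - s)‖ * (u⁻¹ * (1 + u) * (1 + u) ^ (-s.re))) := by gcongr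
    _ = _ := by field_simp; ring

/-- The strength of the logarithmic singularity. The factors s - 1 and 1/(s-1) cancel, so it does
not depend on s; this is what normalizes the fundamental solution. -/
theorem tendsto_mul_deriv_green (hs : 1 < s.re) :
    Tendsto (fun u : ℝ => u * deriv (green s) u) (𝓝[>] 0) (𝓝 (-(1 / (4 * (Real.pi : ℂ))))) := by
  have hne : s - 1 ≠ 0 := fun h => by
    rw [sub_eq_zero.1 h, Complex.one_re] at hs
    exact lt_irrefl _ hs
  have h := ((tendsto_greenSlope hs).const_mul (s - 1)).const_mul (-(1 / (4 * (Real.pi : ℂ))))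
  rw [mul_one_div_cancel hne, mul_one] at h
  refine h.congr' ?_
  filter_upwards [self_mem_nhdsWithin] with u hu
  exact (mul_deriv_green hs hu).symm

theorem tendsto_mul_green (hs : 1 < s.re) :
    Tendsto (fun u : ℝ => u * green s u) (𝓝[>] 0) (𝓝 0) := by
  have hb : Tendsto (fun u : ℝ => u ^ (1 / 2 : ℝ) * (1 + u) ^ (1 / 2 - s.re)) (𝓝[>] 0) (𝓝 0) := by
    have h1 : ContinuousAt (fun u : ℝ => u ^ (1 / 2 : ℝ)) 0 :=
      continuousAt_id.rpow_const (Or.inr (by norm_num))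
    have h2 : ContinuousAt (fun u : ℝ => (1 + u) ^ (1 / 2 - s.re)) 0 :=
      (continuousAt_const.add continuousAt_id).rpow_const (Or.inl (by simp))
    have h3 := (h1.mul h2).tendsto
    rw [Pi.mul_apply, Real.zero_rpow (by norm_num), zero_mul] at h3
    exact h3.mono_left nhdsWithin_le_nhds
  refine squeeze_zero_norm' ?_ hb
  filter_upwards [self_mem_nhdsWithin] with u hu
  have hu' : 0 < u := hu
  rw [norm_mul, Complex.norm_real, Real.norm_eq_abs, abs_of_pos hu']
  calc _ ≤ u * (u ^ (-(1 / 2) : ℝ) * (1 + u) ^ (1 / 2 - s.re)) := by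
        gcongr; exact norm_green_le hs hu'
    _ = u ^ (1 / 2 : ℝ) * (1 + u) ^ (1 / 2 - s.re) := by
        rw [← mul_assoc]
        congr 1
        nth_rewrite 1 [← Real.rpow_one u]
        rw [← Real.rpow_add hu']
        norm_num

theorem tendsto_sq_mul_deriv_deriv_green (hs : 1 < s.re) :
    Tendsto (fun u : ℝ => (u : ℂ) ^ 2 * deriv (deriv (green s)) u) (𝓝[>] 0)
      (𝓝 (1 / (4 * (Real.pi : ℂ)))) := by
  have c1 : Tendsto (fun u : ℝ => -(((2 * u + 1) / (u + 1) : ℝ) : ℂ)) (𝓝[>] 0) (𝓝 (-1)) := by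
    have : ContinuousAt (fun u : ℝ => -(((2 * u + 1) / (u + 1) : ℝ) : ℂ)) 0 := by
      refine (Complex.continuous_ofReal.continuousAt.comp ?_).neg
      exact ContinuousAt.div (by fun_prop) (by fun_prop) (by norm_num)
    have h := this.tendsto
    simp only [mul_zero, zero_add, div_one, Complex.ofReal_one] at h
    exact h.mono_left nhdsWithin_le_nhds
  have c2 : Tendsto (fun u : ℝ => ((1 / (u + 1) : ℝ) : ℂ) * (s * (1 - s))) (𝓝[>] 0)
      (𝓝 (s * (1 - s))) := by
    have : ContinuousAt (fun u : ℝ => ((1 / (u + 1) : ℝ) : ℂ) * (s * (1 - s))) 0 := by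
      refine (Complex.continuous_ofReal.continuousAt.comp ?_).mul continuousAt_const
      exact ContinuousAt.div (by fun_prop) (by fun_prop) (by norm_num)
    have h := this.tendsto
    simp only [zero_add, div_one, Complex.ofReal_one, one_mul] at h
    exact h.mono_left nhdsWithin_le_nhds
  have h := (c1.mul (tendsto_mul_deriv_green hs)).sub (c2.mul (tendsto_mul_green hs))
  simp only [mul_zero, sub_zero, mul_neg, neg_mul, one_mul, neg_neg] at h
  refine h.congr' ?_
  filter_upwards [self_mem_nhdsWithin] with u hu
  have hu' : 0 < u := hu
  rw [deriv_deriv_green_eq hs hu']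
  have h1 : (u : ℂ) ≠ 0 := by exact_mod_cast hu'.ne'
  have h2 : (u : ℂ) + 1 ≠ 0 := by exact_mod_cast (by linarith : u + 1 ≠ 0)
  push_cast
  field_simp

/-- Measurability as a parametric integral covers all real u, including u ≤ 0 where no estimate is
available. -/
theorem measurable_green (s : ℂ) : Measurable (green s) := by
  have h : Measurable (fun p : ℝ × ℝ =>
      ((p.2 * (1 - p.2) : ℝ) : ℂ) ^ (s - 1) * ((p.2 + p.1 : ℝ) : ℂ) ^ (-s)) := by
    refine Measurable.mul ?_ ?_ <;> refine Measurable.pow_const ?_ _ <;> fun_prop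
  have := h.stronglyMeasurable.integral_prod_right' (ν := volume.restrict (Set.Ioc (0 : ℝ) 1))
  have h2 : green s = fun u => 1 / (4 * (Real.pi : ℂ)) *
      ∫ ξ in Set.Ioc (0 : ℝ) 1, ((ξ * (1 - ξ) : ℝ) : ℂ) ^ (s - 1) * ((ξ + u : ℝ) : ℂ) ^ (-s) := by
    ext u
    rw [green, intervalIntegral.integral_of_le zero_le_one]
  rw [h2]
  exact this.measurable.const_mul _

end GreenBounds

/-! ### Integrability against functions of moderate growth. -/

section Growth

/-- The weight `y^σ + y^{-σ}` on `ℍ`. -/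
def growth (σ : ℝ) (w : ℍ) : ℝ := w.im ^ σ + w.im ^ (-σ)

theorem growth_pos (σ : ℝ) (w : ℍ) : 0 < growth σ w :=
  add_pos (Real.rpow_pos_of_pos w.im_pos _) (Real.rpow_pos_of_pos w.im_pos _)

theorem one_le_growth {σ : ℝ} (hσ : 0 ≤ σ) (w : ℍ) : 1 ≤ growth σ w := by
  have h1 := Real.rpow_pos_of_pos w.im_pos σ
  have h2 := Real.rpow_pos_of_pos w.im_pos (-σ)
  rcases le_total 1 w.im with h | h
  · have := Real.one_le_rpow h hσ
    unfold growth
    linarith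
  · have := Real.one_le_rpow_of_pos_of_le_one_of_nonpos w.im_pos h (by linarith : -σ ≤ 0)
    unfold growth
    linarith

/-- Heights multiply under the affine action, and (ab)^σ + (ab)^{-σ} consists of two of the four
terms of the product of the weights. -/
theorem growth_toSL2R_smul_le (σ : ℝ) (z w : ℍ) :
    growth σ (z.toSL2R • w) ≤ growth σ z * growth σ w := by
  have h1 := Real.rpow_pos_of_pos z.im_pos σ
  have h2 := Real.rpow_pos_of_pos z.im_pos (-σ)
  have h3 := Real.rpow_pos_of_pos w.im_pos σ
  have h4 := Real.rpow_pos_of_pos w.im_pos (-σ)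
  rw [growth, growth, growth, im_toSL2R_smul, Real.mul_rpow z.im_pos.le w.im_pos.le,
    Real.mul_rpow z.im_pos.le w.im_pos.le]
  nlinarith [mul_pos h1 h4, mul_pos h2 h3]

theorem continuous_growth (σ : ℝ) : Continuous (growth σ) :=
  (UpperHalfPlane.continuous_im.rpow_const fun w => Or.inl w.im_pos.ne').add
    (UpperHalfPlane.continuous_im.rpow_const fun w => Or.inl w.im_pos.ne')

theorem continuous_pointPair_left (z : ℍ) : Continuous (pointPair z) :=
  continuous_pointPair.comp (by fun_prop : Continuous fun w => (z, w))

theorem one_add_pointPair_I (w : ℍ) :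
    1 + pointPair I w = (w.re ^ 2 + (w.im + 1) ^ 2) / (4 * w.im) := by
  have := w.im_pos
  rw [pointPair_eq]
  simp only [I_re, I_im]
  field_simp
  ring

theorem integrableOn_upper_mul {p q : ℝ → ℝ} (hp : Integrable p)
    (hq : IntegrableOn q (Set.Ioi 0)) :
    IntegrableOn (fun ζ : ℂ => p ζ.re * q ζ.im) {ζ : ℂ | 0 < ζ.im} := by
  have h := (hp.integrableOn (s := Set.univ)).mul_prod hq
  rw [Measure.prod_restrict] at h
  have h2 := (Complex.volume_preserving_equiv_real_prod.integrableOn_comp_preimage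
    Complex.measurableEquivRealProd.measurableEmbedding).2 h
  have e : Complex.measurableEquivRealProd ⁻¹' (Set.univ ×ˢ Set.Ioi (0 : ℝ)) =
      {ζ : ℂ | 0 < ζ.im} := by
    ext ζ
    simp [Complex.measurableEquivRealProd]
  rw [e] at h2
  exact h2

/-- The integrand behaves like b^{ρ-2-σ} near 0 and like b^{σ-ρ} at infinity. Both are integrable
because ρ > 1 + σ; this is where that hypothesis enters. -/
theorem integrableOn_height {σ ρ : ℝ} (hσ : 0 ≤ σ) (hρ : 1 + σ < ρ) :
    IntegrableOn (fun b : ℝ => b ^ (ρ - 2) * (1 + b) ^ (2 - 2 * ρ) * (b ^ σ + b ^ (-σ)))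
      (Set.Ioi 0) := by
  have hmeas : Measurable
      (fun b : ℝ => b ^ (ρ - 2) * (1 + b) ^ (2 - 2 * ρ) * (b ^ σ + b ^ (-σ))) := by
    fun_prop
  rw [← Set.Ioc_union_Ioi_eq_Ioi (zero_le_one (α := ℝ))]
  refine IntegrableOn.union ?_ ?_
  · have h : IntegrableOn (fun b : ℝ => b ^ (ρ - 2 - σ) * 2) (Set.Ioc 0 1) :=
      ((intervalIntegrable_iff_integrableOn_Ioc_of_le zero_le_one).1
        (intervalIntegral.intervalIntegrable_rpow' (by linarith))).mul_const 2
    refine Integrable.mono' h hmeas.aestronglyMeasurable.restrict ?_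
    filter_upwards [ae_restrict_mem measurableSet_Ioc] with b hb
    have h0 : 0 < b := hb.1
    have e1 : (1 + b) ^ (2 - 2 * ρ) ≤ 1 :=
      Real.rpow_le_one_of_one_le_of_nonpos (by linarith) (by linarith)
    have e2 : b ^ σ ≤ b ^ (-σ) := Real.rpow_le_rpow_of_exponent_ge h0 hb.2 (by linarith)
    rw [Real.norm_of_nonneg (by positivity)]
    calc b ^ (ρ - 2) * (1 + b) ^ (2 - 2 * ρ) * (b ^ σ + b ^ (-σ))
        ≤ b ^ (ρ - 2) * 1 * (b ^ (-σ) + b ^ (-σ)) := by gcongr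
      _ = b ^ (ρ - 2) * b ^ (-σ) * 2 := by ring
      _ = _ := by rw [← Real.rpow_add h0, ← sub_eq_add_neg]
  · have h : IntegrableOn (fun b : ℝ => b ^ (σ - ρ) * 2) (Set.Ioi 1) :=
      (integrableOn_Ioi_rpow_of_lt (by linarith) zero_lt_one).mul_const 2
    refine Integrable.mono' h hmeas.aestronglyMeasurable.restrict ?_
    filter_upwards [ae_restrict_mem measurableSet_Ioi] with b hb
    have h1 : 1 < b := hb
    have h0 : 0 < b := by linarith
    have e1 : (1 + b) ^ (2 - 2 * ρ) ≤ b ^ (2 - 2 * ρ) :=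
      Real.rpow_le_rpow_of_nonpos h0 (by linarith) (by linarith)
    have e2 : b ^ (-σ) ≤ b ^ σ := Real.rpow_le_rpow_of_exponent_le h1.le (by linarith)
    rw [Real.norm_of_nonneg (by positivity)]
    calc b ^ (ρ - 2) * (1 + b) ^ (2 - 2 * ρ) * (b ^ σ + b ^ (-σ))
        ≤ b ^ (ρ - 2) * b ^ (2 - 2 * ρ) * (b ^ σ + b ^ σ) := by gcongr
      _ = b ^ (ρ - 2) * b ^ (2 - 2 * ρ) * b ^ σ * 2 := by ring
      _ = _ := by
        rw [← Real.rpow_add h0, ← Real.rpow_add h0]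
        ring_nf

/-- Here 1 + u = (a² + (b+1)²)/(4b) for w = a + ib. Splitting off one power, (a² + (b+1)²)^{-ρ} ≤
(1+a²)^{-1} (1+b)^{2-2ρ}, which separates the variables. -/
theorem integrable_decay_I {σ ρ : ℝ} (hσ : 0 ≤ σ) (hρ : 1 + σ < ρ) :
    Integrable (fun w : ℍ => (1 + pointPair I w) ^ (-ρ) * growth σ w) := by
  rw [integrable_uhp]
  refine Integrable.mono' ((integrableOn_upper_mul integrable_inv_one_add_sq
    (integrableOn_height hσ hρ)).const_mul (4 ^ ρ)) ?_ ?_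
  · have hc : ContinuousOn (fun ζ : ℂ => (1 / ζ.im ^ 2) • ((1 + pointPair I (ofComplex ζ)) ^ (-ρ) *
        growth σ (ofComplex ζ))) {ζ : ℂ | 0 < ζ.im} := by
      intro ζ hζ
      have h0 : ContinuousAt (fun ζ : ℂ => (ofComplex ζ : ℍ)) ζ :=
        (contMDiffAt_ofComplex_real (n := 0) hζ).continuousAt
      have c1 : ContinuousAt (fun ζ : ℂ => 1 / ζ.im ^ 2) ζ :=
        continuousAt_const.div (Complex.continuous_im.pow 2).continuousAt
          (pow_ne_zero 2 (ne_of_gt hζ))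
      have c2 : ContinuousAt (fun ζ : ℂ => (1 + pointPair I (ofComplex ζ)) ^ (-ρ)) ζ := by
        refine ContinuousAt.rpow_const (continuousAt_const.add
          ((continuous_pointPair_left I).continuousAt.comp h0)) (Or.inl ?_)
        linarith [pointPair_nonneg I (ofComplex ζ)]
      have c3 : ContinuousAt (fun ζ : ℂ => growth σ (ofComplex ζ)) ζ :=
        (continuous_growth σ).continuousAt.comp h0
      exact (c1.smul (c2.mul c3)).continuousWithinAt
    exact hc.aestronglyMeasurable isOpen_im_pos.measurableSet
  · filter_upwards [ae_restrict_mem isOpen_im_pos.measurableSet] with ζ hζ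
    have hb : 0 < ζ.im := hζ
    set b := ζ.im
    set a := ζ.re
    have hρ0 : 0 ≤ ρ := by linarith
    rw [ofComplex_apply_of_im_pos hζ, one_add_pointPair_I, growth]
    simp only [UpperHalfPlane.mk_im, UpperHalfPlane.mk_re]
    have hX : 0 < a ^ 2 + (b + 1) ^ 2 := by positivity
    rw [Real.norm_of_nonneg (by positivity), smul_eq_mul]
    have e1 : ((a ^ 2 + (b + 1) ^ 2) / (4 * b)) ^ (-ρ) =
        4 ^ ρ * b ^ ρ * (a ^ 2 + (b + 1) ^ 2) ^ (-ρ) := by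
      rw [Real.div_rpow hX.le (by positivity), Real.rpow_neg (by positivity : 0 ≤ 4 * b),
        Real.mul_rpow (by norm_num) hb.le, div_inv_eq_mul]
      ring
    have e2 : (a ^ 2 + (b + 1) ^ 2) ^ (-ρ) ≤ (1 + a ^ 2)⁻¹ * (1 + b) ^ (2 - 2 * ρ) := by
      have f1 : (a ^ 2 + (b + 1) ^ 2) ^ (-ρ) =
          (a ^ 2 + (b + 1) ^ 2)⁻¹ * (a ^ 2 + (b + 1) ^ 2) ^ (1 - ρ) := by
        rw [← Real.rpow_neg_one, ← Real.rpow_add hX]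
        ring_nf
      have f2 : (a ^ 2 + (b + 1) ^ 2) ^ (1 - ρ) ≤ ((b + 1) ^ 2) ^ (1 - ρ) :=
        Real.rpow_le_rpow_of_nonpos (by positivity) (by nlinarith [sq_nonneg a]) (by linarith)
      have f3 : ((b + 1) ^ 2) ^ (1 - ρ) = (1 + b) ^ (2 - 2 * ρ) := by
        rw [← Real.rpow_natCast, ← Real.rpow_mul (by positivity), add_comm b 1]
        congr 1
        push_cast
        ring
      have f4 : (a ^ 2 + (b + 1) ^ 2)⁻¹ ≤ (1 + a ^ 2)⁻¹ := by
        apply inv_anti₀ (by positivity)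
        nlinarith
      rw [f1, ← f3]
      gcongr
    have e3 : 1 / b ^ 2 * b ^ ρ = b ^ (ρ - 2) := by
      rw [Real.rpow_sub hb, Real.rpow_two]
      ring
    rw [e1]
    calc 1 / b ^ 2 * (4 ^ ρ * b ^ ρ * (a ^ 2 + (b + 1) ^ 2) ^ (-ρ) * (b ^ σ + b ^ (-σ)))
        ≤ 1 / b ^ 2 * (4 ^ ρ * b ^ ρ * ((1 + a ^ 2)⁻¹ * (1 + b) ^ (2 - 2 * ρ)) *
          (b ^ σ + b ^ (-σ))) := by gcongr
      _ = 4 ^ ρ * ((1 + a ^ 2)⁻¹ * ((1 / b ^ 2 * b ^ ρ) * (1 + b) ^ (2 - 2 * ρ) *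
          (b ^ σ + b ^ (-σ)))) := by ring
      _ = _ := by rw [e3]

/-- A majorant of the Green function: `u^{-1/2} (1 + u)^{1/2 - ρ}`. -/
def greenMajorant (ρ u : ℝ) : ℝ := u ^ (-(1 / 2) : ℝ) * (1 + u) ^ (1 / 2 - ρ)

theorem greenMajorant_nonneg (ρ : ℝ) {u : ℝ} (hu : 0 ≤ u) : 0 ≤ greenMajorant ρ u := by
  unfold greenMajorant
  positivity

theorem measurable_greenMajorant (ρ : ℝ) : Measurable (greenMajorant ρ) := by
  unfold greenMajorant
  fun_prop

theorem rpow_neg_le_greenMajorant (ρ : ℝ) {u : ℝ} (hu : 0 < u) :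
    (1 + u) ^ (-ρ) ≤ greenMajorant ρ u := by
  have h : (1 + u) ^ (-ρ) = (1 + u) ^ (-(1 / 2) : ℝ) * (1 + u) ^ (1 / 2 - ρ) := by
    rw [← Real.rpow_add (by linarith)]
    ring_nf
  have h2 : (1 + u) ^ (-(1 / 2) : ℝ) ≤ u ^ (-(1 / 2) : ℝ) :=
    Real.rpow_le_rpow_of_nonpos hu (by linarith) (by norm_num)
  rw [h, greenMajorant]
  gcongr

/-- Separates the decay at infinity from the singularity, which then only matters on u < 1. For u ≥
1 one has u ≥ (1+u)/2, at the cost of a factor √2 ≤ 2. -/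
theorem greenMajorant_le {ρ : ℝ} (hρ : 1 < ρ) {u : ℝ} (hu : 0 ≤ u) :
    greenMajorant ρ u ≤ 2 * (1 + u) ^ (-ρ) + if u < 1 then u ^ (-(1 / 2) : ℝ) else 0 := by
  split_ifs with h
  · have h1 : (1 + u) ^ (1 / 2 - ρ) ≤ 1 :=
      Real.rpow_le_one_of_one_le_of_nonpos (by linarith) (by linarith)
    have h2 : greenMajorant ρ u ≤ u ^ (-(1 / 2) : ℝ) :=
      mul_le_of_le_one_right (by positivity) h1
    have : 0 ≤ (1 + u) ^ (-ρ) := by positivity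
    linarith
  · have hu1 : 1 ≤ u := not_lt.1 h
    have h1 : u ^ (-(1 / 2) : ℝ) ≤ ((1 + u) / 2) ^ (-(1 / 2) : ℝ) :=
      Real.rpow_le_rpow_of_nonpos (by positivity) (by linarith) (by norm_num)
    have h2 : ((1 + u) / 2) ^ (-(1 / 2) : ℝ) ≤ 2 * (1 + u) ^ (-(1 / 2) : ℝ) := by
      rw [Real.div_rpow (by linarith) (by norm_num), div_eq_mul_inv, ← Real.rpow_neg (by norm_num),
        neg_neg, mul_comm]
      gcongr
      calc (2 : ℝ) ^ (1 / 2 : ℝ) ≤ 2 ^ (1 : ℝ) :=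
            Real.rpow_le_rpow_of_exponent_le (by norm_num) (by norm_num)
        _ = 2 := Real.rpow_one 2
    rw [add_zero, greenMajorant]
    calc u ^ (-(1 / 2) : ℝ) * (1 + u) ^ (1 / 2 - ρ)
        ≤ 2 * (1 + u) ^ (-(1 / 2) : ℝ) * (1 + u) ^ (1 / 2 - ρ) := by
          gcongr
          exact h1.trans h2
      _ = 2 * (1 + u) ^ (-ρ) := by
        rw [mul_assoc, ← Real.rpow_add (by linarith)]
        ring_nf

theorem integrableOn_ball_norm_inv (c : ℂ) (r : ℝ) :
    IntegrableOn (fun ζ : ℂ => ‖ζ - c‖⁻¹) (Metric.ball c r) := by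
  have h : IntegrableOn (fun ζ : ℂ => ‖ζ‖⁻¹) (Metric.ball 0 r) := by
    refine integrableOn_ball_of_norm_le_rpow (C := 1) (α := 1) (by simp) (by simp)
      (ae_of_all _ fun ζ => ?_) (by fun_prop)
    rw [one_mul, Real.rpow_neg_one, norm_inv, norm_norm]
  have e : Metric.ball c r = (fun ζ : ℂ => ζ - c) ⁻¹' Metric.ball 0 r := by
    ext ζ
    simp [dist_eq_norm]
  rw [e]
  exact ((measurePreserving_sub_right volume c).integrableOn_comp_preimage
    (Homeomorph.subRight c).measurableEmbedding).2 h

theorem integrable_singular_I (σ : ℝ) (hσ : 0 ≤ σ) :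
    Integrable (fun w : ℍ =>
      (if pointPair I w < 1 then pointPair I w ^ (-(1 / 2) : ℝ) else 0) * growth σ w) := by
  have hmeas : Measurable (fun w : ℍ =>
      (if pointPair I w < 1 then pointPair I w ^ (-(1 / 2) : ℝ) else 0) * growth σ w) := by
    have h1 := (continuous_pointPair_left I).measurable
    exact (Measurable.ite (measurableSet_lt h1 measurable_const) (h1.pow_const _)
      measurable_const).mul (continuous_growth σ).measurable
  have hS : MeasurableSet {ζ : ℂ | 0 < ζ.im} := isOpen_im_pos.measurableSet
  rw [integrable_uhp]
  -- On u < 1 one has |ζ - i|² < 4 Im ζ, which forces 1/6 < Im ζ < 6 and |ζ - i| < 5. The constants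
  -- bound y^{-2} by 36, √(4y) by 5 and the growth weight by 2·6^σ.
  have hdom : IntegrableOn (fun ζ : ℂ => 36 * 5 * (2 * 6 ^ σ) *
      (Metric.ball Complex.I 5).indicator (fun ζ : ℂ => ‖ζ - Complex.I‖⁻¹) ζ)
      {ζ : ℂ | 0 < ζ.im} :=
    (((integrable_indicator_iff measurableSet_ball).2
      (integrableOn_ball_norm_inv Complex.I 5)).const_mul _).integrableOn
  refine Integrable.mono' hdom ?_ ?_
  · have hm : AEMeasurable (fun ζ : ℂ => (ofComplex ζ : ℍ)) (volume.restrict {ζ : ℂ | 0 < ζ.im}) := by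
      refine ContinuousOn.aemeasurable (fun ζ hζ => ?_) hS
      exact (contMDiffAt_ofComplex_real (n := 0) hζ).continuousAt.continuousWithinAt
    refine AEMeasurable.aestronglyMeasurable ?_
    have hq : Measurable fun ζ : ℂ => 1 / ζ.im ^ 2 := by fun_prop
    exact hq.aemeasurable.smul (hmeas.comp_aemeasurable hm)
  · filter_upwards [ae_restrict_mem hS] with ζ hζ
    have hb : 0 < ζ.im := hζ
    have hw : ((ofComplex ζ : ℍ) : ℂ) = ζ := by rw [ofComplex_apply_of_im_pos hζ]
    set w : ℍ := ofComplex ζ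
    have him : w.im = ζ.im := by rw [← coe_im, hw]
    have hnn : 0 ≤ growth σ w := (growth_pos σ w).le
    have hu : pointPair I w = ‖ζ - Complex.I‖ ^ 2 / (4 * ζ.im) := by
      rw [pointPair, hw, him, norm_sub_rev, I_im, coe_I, mul_one]
    split_ifs with h
    · have h2 : ‖ζ - Complex.I‖ ^ 2 < 4 * ζ.im := by
        rwa [hu, div_lt_one (by positivity)] at h
      have h3 : (ζ.im - 1) ^ 2 ≤ ‖ζ - Complex.I‖ ^ 2 := by
        rw [← Complex.normSq_eq_norm_sq, Complex.normSq_apply]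
        simp only [Complex.sub_im, Complex.I_im, Complex.sub_re, Complex.I_re]
        nlinarith [sq_nonneg ζ.re]
      have hb6 : ζ.im < 6 := by nlinarith
      have hb6' : 1 / 6 < ζ.im := by nlinarith
      have hmem : ζ ∈ Metric.ball Complex.I 5 := by
        rw [Metric.mem_ball, dist_eq_norm]
        nlinarith [norm_nonneg (ζ - Complex.I)]
      rw [Set.indicator_of_mem hmem]
      have g1 : growth σ w ≤ 2 * 6 ^ σ := by
        rw [growth, him]
        have k1 : ζ.im ^ σ ≤ 6 ^ σ := Real.rpow_le_rpow hb.le hb6.le hσ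
        have k2 : ζ.im ^ (-σ) ≤ 6 ^ σ := by
          rw [Real.rpow_neg hb.le, ← Real.inv_rpow hb.le]
          refine Real.rpow_le_rpow (by positivity) ?_ hσ
          rw [inv_le_comm₀ hb (by norm_num)]
          linarith
        linarith
      have g2 : pointPair I w ^ (-(1 / 2) : ℝ) ≤ 5 * ‖ζ - Complex.I‖⁻¹ := by
        rw [hu, Real.rpow_neg (by positivity), ← Real.sqrt_eq_rpow,
          Real.sqrt_div (by positivity), Real.sqrt_sq (norm_nonneg _), inv_div, div_eq_mul_inv]
        gcongr
        rw [Real.sqrt_le_left (by norm_num)]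
        linarith
      have g3 : 1 / ζ.im ^ 2 ≤ 36 := by
        rw [div_le_iff₀ (by positivity)]
        nlinarith
      rw [smul_eq_mul, Real.norm_of_nonneg (by rw [hu]; positivity)]
      calc 1 / ζ.im ^ 2 * (pointPair I w ^ (-(1 / 2) : ℝ) * growth σ w)
          ≤ 36 * ((5 * ‖ζ - Complex.I‖⁻¹) * (2 * 6 ^ σ)) := by
            have : 0 ≤ pointPair I w ^ (-(1 / 2) : ℝ) :=
              Real.rpow_nonneg (pointPair_nonneg I w) _
            gcongr
        _ = _ := by ring
    · rw [zero_mul, smul_zero, norm_zero]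
      refine mul_nonneg (by positivity) (Set.indicator_nonneg (fun _ _ => by positivity) _)

theorem integrable_greenMajorant_I {σ ρ : ℝ} (hσ : 0 ≤ σ) (hρ : 1 + σ < ρ) :
    Integrable (fun w : ℍ => greenMajorant ρ (pointPair I w) * growth σ w) := by
  refine Integrable.mono' (((integrable_decay_I hσ hρ).const_mul 2).add
    (integrable_singular_I σ hσ)) ?_ (ae_of_all _ fun w => ?_)
  · exact (((measurable_greenMajorant ρ).comp (continuous_pointPair_left I).measurable).mul
      (continuous_growth σ).measurable).aestronglyMeasurable
  · have h0 := greenMajorant_nonneg ρ (pointPair_nonneg I w)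
    have h1 := (growth_pos σ w).le
    have h2 := greenMajorant_le (ρ := ρ) (by linarith) (pointPair_nonneg I w)
    rw [Real.norm_of_nonneg (mul_nonneg h0 h1)]
    calc _ ≤ _ := mul_le_mul_of_nonneg_right h2 h1
      _ = _ := by simp only [Pi.add_apply]; ring

theorem integrable_greenMajorant {σ ρ : ℝ} (hσ : 0 ≤ σ) (hρ : 1 + σ < ρ) (z : ℍ) :
    Integrable (fun w : ℍ => greenMajorant ρ (pointPair z w) * growth σ w) := by
  rw [← integrable_toSL2R_smul z]
  simp only [pointPair_toSL2R]
  refine Integrable.mono' ((integrable_greenMajorant_I hσ hρ).const_mul (growth σ z)) ?_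
    (ae_of_all _ fun w => ?_)
  · exact (((measurable_greenMajorant ρ).comp (continuous_pointPair_left I).measurable).mul
      ((continuous_growth σ).comp (continuous_const_smul _)).measurable).aestronglyMeasurable
  · have h0 := greenMajorant_nonneg ρ (pointPair_nonneg I w)
    rw [Real.norm_of_nonneg (mul_nonneg h0 (growth_pos σ _).le)]
    calc _ ≤ greenMajorant ρ (pointPair I w) * (growth σ z * growth σ w) :=
          mul_le_mul_of_nonneg_left (growth_toSL2R_smul_le σ z w) h0
      _ = _ := by ring

/-- After translation to `I` the integral depends on z only through the growth weight. This controls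
the growth of R_s f and the integrability in Fubini's theorem. -/
theorem integral_greenMajorant_le {σ ρ : ℝ} (hσ : 0 ≤ σ) (hρ : 1 + σ < ρ) (z : ℍ) :
    ∫ w : ℍ, greenMajorant ρ (pointPair z w) * growth σ w ≤
      (∫ w : ℍ, greenMajorant ρ (pointPair I w) * growth σ w) * growth σ z := by
  have hle : ∀ w : ℍ, greenMajorant ρ (pointPair z (z.toSL2R • w)) * growth σ (z.toSL2R • w) ≤
      (greenMajorant ρ (pointPair I w) * growth σ w) * growth σ z := fun w => by
    rw [pointPair_toSL2R]
    calc _ ≤ greenMajorant ρ (pointPair I w) * (growth σ z * growth σ w) :=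
          mul_le_mul_of_nonneg_left (growth_toSL2R_smul_le σ z w)
            (greenMajorant_nonneg ρ (pointPair_nonneg I w))
      _ = _ := by ring
  have h1 : Integrable fun w : ℍ =>
      greenMajorant ρ (pointPair z (z.toSL2R • w)) * growth σ (z.toSL2R • w) :=
    (integrable_toSL2R_smul z
      (F := fun w : ℍ => greenMajorant ρ (pointPair z w) * growth σ w)).2
      (integrable_greenMajorant hσ hρ z)
  have h2 : ∫ w : ℍ, greenMajorant ρ (pointPair z (z.toSL2R • w)) * growth σ (z.toSL2R • w) =
      ∫ w : ℍ, greenMajorant ρ (pointPair z w) * growth σ w :=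
    integral_toSL2R_smul z (fun w : ℍ => greenMajorant ρ (pointPair z w) * growth σ w)
  rw [← h2, ← integral_mul_const]
  exact integral_mono h1 ((integrable_greenMajorant_I hσ hρ).mul_const (growth σ z)) hle

variable {V : Type*} [NormedAddCommGroup V] [NormedSpace ℂ V]

/-- A radial kernel bounded by the Green majorant is integrable against a function of moderate
growth. -/
theorem integrable_kernel_smul {σ ρ C D : ℝ} (hσ : 0 ≤ σ) (hρ : 1 + σ < ρ) (z : ℍ) {k : ℝ → ℂ}
    (hkm : Measurable k) (hk : ∀ u, 0 < u → ‖k u‖ ≤ D * greenMajorant ρ u) {h : ℍ → V}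
    (hh : Continuous h) (hC : ∀ w, ‖h w‖ ≤ C * growth σ w) :
    Integrable (fun w => k (pointPair z w) • h w) := by
  refine Integrable.mono' ((integrable_greenMajorant hσ hρ z).const_mul (D * C)) ?_ ?_
  · exact (hkm.comp (continuous_pointPair_left z).measurable).aestronglyMeasurable.smul
      hh.aestronglyMeasurable
  · filter_upwards [ae_pointPair_pos z] with w hw
    rw [norm_smul]
    calc _ ≤ (D * greenMajorant ρ (pointPair z w)) * (C * growth σ w) :=
          mul_le_mul (hk _ hw) (hC w) (norm_nonneg _) ((norm_nonneg _).trans (hk _ hw))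
      _ = _ := by ring

theorem integrable_green_smul {σ C : ℝ} (hσ : 0 ≤ σ) {s : ℂ} (hs : 1 + σ < s.re) (z : ℍ) {h : ℍ → V}
    (hh : Continuous h) (hC : ∀ w, ‖h w‖ ≤ C * growth σ w) :
    Integrable (fun w => green s (pointPair z w) • h w) :=
  integrable_kernel_smul (D := 1) hσ hs z (measurable_green s)
    (fun u hu => by rw [one_mul]; exact norm_green_le (by linarith) hu) hh hC

end Growth

/-! ### Cutoffs, and Green's identity for decaying radial kernels. -/

section Decay

/-- A smooth cutoff on `ℝ`, equal to `1` for `t ≤ 1` and to `0` for `t ≥ 2`. -/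
def cutoff (t : ℝ) : ℝ := Real.smoothTransition (2 - t)

theorem contDiff_cutoff {n : ℕ∞} : ContDiff ℝ n cutoff :=
  Real.smoothTransition.contDiff.comp (contDiff_const.sub contDiff_id)

theorem cutoff_of_le {t : ℝ} (h : t ≤ 1) : cutoff t = 1 :=
  Real.smoothTransition.one_of_one_le (by linarith)

theorem cutoff_of_ge {t : ℝ} (h : 2 ≤ t) : cutoff t = 0 :=
  Real.smoothTransition.zero_of_nonpos (by linarith)

theorem abs_cutoff_le (t : ℝ) : |cutoff t| ≤ 1 := by
  rw [cutoff, abs_of_nonneg (Real.smoothTransition.nonneg _)]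
  exact Real.smoothTransition.le_one _

theorem deriv_cutoff_of_gt {t : ℝ} (h : 2 < t) : deriv cutoff t = 0 := by
  have : cutoff =ᶠ[𝓝 t] fun _ => 0 := by
    filter_upwards [lt_mem_nhds h] with x hx using cutoff_of_ge hx.le
  rw [this.deriv_eq, deriv_const]

theorem deriv_deriv_cutoff_of_gt {t : ℝ} (h : 2 < t) : deriv (deriv cutoff) t = 0 := by
  have : deriv cutoff =ᶠ[𝓝 t] fun _ => 0 := by
    filter_upwards [lt_mem_nhds h] with x hx using deriv_cutoff_of_gt hx
  rw [this.deriv_eq, deriv_const]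

theorem contDiff_deriv_cutoff : ContDiff ℝ 1 (deriv cutoff) :=
  ((contDiff_succ_iff_deriv (n := 1)).1 (contDiff_cutoff (n := 2))).2.2

theorem hasDerivAt_cutoff (t : ℝ) : HasDerivAt cutoff (deriv cutoff t) t :=
  ((contDiff_cutoff (n := 1)).differentiable one_ne_zero t).hasDerivAt

theorem hasDerivAt_deriv_cutoff (t : ℝ) :
    HasDerivAt (deriv cutoff) (deriv (deriv cutoff) t) t :=
  (contDiff_deriv_cutoff.differentiable one_ne_zero t).hasDerivAt

theorem exists_deriv_cutoff_bound : ∃ B : ℝ, 0 ≤ B ∧ ∀ t : ℝ, 0 ≤ t →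
    |deriv cutoff t| ≤ B ∧ |deriv (deriv cutoff) t| ≤ B := by
  have c1 : Continuous (deriv cutoff) := contDiff_deriv_cutoff.continuous
  have c2 : Continuous (deriv (deriv cutoff)) := contDiff_deriv_cutoff.continuous_deriv le_rfl
  obtain ⟨B1, h1⟩ := (isCompact_Icc (a := (0 : ℝ)) (b := 2)).exists_bound_of_continuousOn
    c1.continuousOn
  obtain ⟨B2, h2⟩ := (isCompact_Icc (a := (0 : ℝ)) (b := 2)).exists_bound_of_continuousOn
    c2.continuousOn
  refine ⟨max 0 (max B1 B2), le_max_left _ _, fun t ht => ?_⟩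
  rcases le_or_gt t 2 with h | h
  · exact ⟨(h1 t ⟨ht, h⟩).trans ((le_max_left _ _).trans (le_max_right _ _)),
      (h2 t ⟨ht, h⟩).trans ((le_max_right _ _).trans (le_max_right _ _))⟩
  · rw [deriv_cutoff_of_gt h, deriv_deriv_cutoff_of_gt h, abs_zero]
    exact ⟨le_max_left _ _, le_max_left _ _⟩

theorem radialHelmholtz_congr (s : ℂ) {k l : ℝ → ℂ} {u : ℝ} (h : k =ᶠ[𝓝 u] l) :
    radialHelmholtz s k u = radialHelmholtz s l u := by
  rw [radialHelmholtz, radialHelmholtz, h.deriv_eq, h.deriv.deriv_eq, h.eq_of_nhds]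

theorem contDiffAt_cutoff_mul {n : ℕ∞} {k : ℝ → ℂ} {u : ℝ} (hk : ContDiffAt ℝ n k u) (R : ℝ) :
    ContDiffAt ℝ n (fun u => (cutoff (u / R) : ℂ) * k u) u :=
  ((Complex.ofRealCLM.contDiff.comp
    (contDiff_cutoff.comp (contDiff_id.div_const R))).contDiffAt).mul hk

theorem radialHelmholtz_cutoff_mul (s : ℂ) {k : ℝ → ℂ} {u : ℝ} (hk : ContDiffAt ℝ 2 k u)
    (R : ℝ) :
    radialHelmholtz s (fun u => (cutoff (u / R) : ℂ) * k u) u =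
      (cutoff (u / R) : ℂ) * radialHelmholtz s k u
      + ((2 * (u * (u + 1)) * (deriv cutoff (u / R) / R) : ℝ) : ℂ) * deriv k u
      + ((u * (u + 1) * (deriv (deriv cutoff) (u / R) / R / R)
        + (2 * u + 1) * (deriv cutoff (u / R) / R) : ℝ) : ℂ) * k u := by
  have hc : ∀ v : ℝ, HasDerivAt (fun u : ℝ => (cutoff (u / R) : ℂ))
      ((deriv cutoff (v / R) / R : ℝ) : ℂ) v := fun v => by
    have := ((hasDerivAt_cutoff (v / R)).comp v ((hasDerivAt_id v).div_const R)).ofReal_comp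
    simpa [Function.comp_def, div_eq_mul_inv] using this
  have hc' : ∀ v : ℝ, HasDerivAt (fun u : ℝ => ((deriv cutoff (u / R) / R : ℝ) : ℂ))
      ((deriv (deriv cutoff) (v / R) / R / R : ℝ) : ℂ) v := fun v => by
    have := (((hasDerivAt_deriv_cutoff (v / R)).comp v
      ((hasDerivAt_id v).div_const R)).div_const R).ofReal_comp
    simpa [Function.comp_def, div_eq_mul_inv] using this
  have hk1 : DifferentiableAt ℝ (deriv k) u :=
    ((hk.fderiv_right (m := 1) (by norm_num)).clm_apply
      (contDiffAt_const (c := (1 : ℝ)))).differentiableAt one_ne_zero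
  have e : deriv (fun u => (cutoff (u / R) : ℂ) * k u) =ᶠ[𝓝 u] fun v =>
      ((deriv cutoff (v / R) / R : ℝ) : ℂ) * k v + (cutoff (v / R) : ℂ) * deriv k v := by
    filter_upwards [hk.eventually (by simp)] with v hv
    exact ((hc v).mul (hv.differentiableAt two_ne_zero).hasDerivAt).deriv
  have hku := (hk.differentiableAt two_ne_zero).hasDerivAt
  have e2 : deriv (fun v => ((deriv cutoff (v / R) / R : ℝ) : ℂ) * k v
      + (cutoff (v / R) : ℂ) * deriv k v) u = _ :=
    (((hc' u).mul hku).add ((hc u).mul hk1.hasDerivAt)).deriv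
  rw [radialHelmholtz, e.deriv_eq, e.eq_of_nhds, e2, radialHelmholtz]
  push_cast
  ring

/-- The weights 1 + u and (1+u)² are those for which the coefficients 2u+1 and u(u+1) cost only the
constants 2 and 1. -/
theorem norm_radialHelmholtz_le (s : ℂ) {k : ℝ → ℂ} {A u : ℝ} (hu : 0 ≤ u)
    (h0 : ‖k u‖ ≤ A) (h1 : (1 + u) * ‖deriv k u‖ ≤ A)
    (h2 : (1 + u) ^ 2 * ‖deriv (deriv k) u‖ ≤ A) :
    ‖radialHelmholtz s k u‖ ≤ (3 + ‖s * (1 - s)‖) * A := by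
  rw [radialHelmholtz]
  refine (norm_add₃_le).trans ?_
  rw [norm_mul, norm_mul, norm_mul _ (k u), Complex.norm_real, Complex.norm_real,
    Real.norm_of_nonneg (by positivity), Real.norm_of_nonneg (by positivity)]
  have t1 : u * (u + 1) * ‖deriv (deriv k) u‖ ≤ A :=
    (mul_le_mul_of_nonneg_right (by nlinarith) (norm_nonneg _)).trans h2
  have t2 : (2 * u + 1) * ‖deriv k u‖ ≤ 2 * A := by
    have := norm_nonneg (deriv k u)
    nlinarith
  have t3 : ‖s * (1 - s)‖ * ‖k u‖ ≤ ‖s * (1 - s)‖ * A := by gcongr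
  linarith

/-- The point is uniformity in R. In the commutator terms the derivatives of the cutoff come with
factors u/R, at most 2 where those derivatives are nonzero. These terms contribute 4B and 11B = 6B +
5B. -/
theorem norm_radialHelmholtz_cutoff_mul_le (s : ℂ) {k : ℝ → ℂ} {A B u R : ℝ} (hu : 0 ≤ u)
    (hB0 : 0 ≤ B)
    (hB : ∀ t : ℝ, 0 ≤ t → |deriv cutoff t| ≤ B ∧ |deriv (deriv cutoff) t| ≤ B)
    (hR : 1 ≤ R) (hk : ContDiffAt ℝ 2 k u)
    (h0 : ‖k u‖ ≤ A) (h1 : (1 + u) * ‖deriv k u‖ ≤ A)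
    (h2 : (1 + u) ^ 2 * ‖deriv (deriv k) u‖ ≤ A) :
    ‖radialHelmholtz s (fun u => (cutoff (u / R) : ℂ) * k u) u‖ ≤
      (3 + ‖s * (1 - s)‖ + 15 * B) * A := by
  have hR0 : 0 < R := by linarith
  have hA : 0 ≤ A := (norm_nonneg _).trans h0
  have hb := hB (u / R) (by positivity)
  have m1 : u / R * |deriv cutoff (u / R)| ≤ 2 * B := by
    rcases le_or_gt (u / R) 2 with h | h
    · exact mul_le_mul h hb.1 (abs_nonneg _) (by norm_num)
    · rw [deriv_cutoff_of_gt h, abs_zero, mul_zero]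
      positivity
  have m2 : u / R * (u / R + 1) * |deriv (deriv cutoff) (u / R)| ≤ 6 * B := by
    rcases le_or_gt (u / R) 2 with h | h
    · have : u / R * (u / R + 1) ≤ 6 := by
        have : 0 ≤ u / R := by positivity
        nlinarith
      exact mul_le_mul this hb.2 (abs_nonneg _) (by norm_num)
    · rw [deriv_deriv_cutoff_of_gt h, abs_zero, mul_zero]
      positivity
  have hinv : 1 / R ≤ 1 := by rw [div_le_one hR0]; exact hR
  rw [radialHelmholtz_cutoff_mul s hk]
  refine (norm_add₃_le).trans ?_
  rw [norm_mul, norm_mul, norm_mul _ (k u), Complex.norm_real, Complex.norm_real,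
    Complex.norm_real, Real.norm_eq_abs, Real.norm_eq_abs, Real.norm_eq_abs]
  have t1 : |cutoff (u / R)| * ‖radialHelmholtz s k u‖ ≤ (3 + ‖s * (1 - s)‖) * A := by
    calc _ ≤ 1 * ((3 + ‖s * (1 - s)‖) * A) :=
          mul_le_mul (abs_cutoff_le _) (norm_radialHelmholtz_le s hu h0 h1 h2) (norm_nonneg _)
            zero_le_one
      _ = _ := one_mul _
  have t2 : |2 * (u * (u + 1)) * (deriv cutoff (u / R) / R)| * ‖deriv k u‖ ≤ 4 * B * A := by
    have e : |2 * (u * (u + 1)) * (deriv cutoff (u / R) / R)| =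
        2 * (u / R * |deriv cutoff (u / R)|) * (1 + u) := by
      rw [abs_mul, abs_div, abs_of_pos hR0, abs_of_nonneg (by positivity)]
      ring
    rw [e, mul_assoc]
    calc _ ≤ 2 * (2 * B) * A := by gcongr
      _ = _ := by ring
  have t3 : |u * (u + 1) * (deriv (deriv cutoff) (u / R) / R / R)
        + (2 * u + 1) * (deriv cutoff (u / R) / R)| * ‖k u‖ ≤ 11 * B * A := by
    have e1 : |u * (u + 1) * (deriv (deriv cutoff) (u / R) / R / R)| ≤ 6 * B := by
      rw [abs_mul, abs_div, abs_div, abs_of_pos hR0, abs_of_nonneg (by positivity)]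
      refine le_trans ?_ m2
      have : u * (u + 1) * (|deriv (deriv cutoff) (u / R)| / R / R) =
          u / R * (u / R + 1 / R) * |deriv (deriv cutoff) (u / R)| := by
        field_simp
      rw [this]
      gcongr
    have e2 : |(2 * u + 1) * (deriv cutoff (u / R) / R)| ≤ 5 * B := by
      rw [abs_mul, abs_div, abs_of_pos hR0, abs_of_nonneg (by positivity)]
      have : (2 * u + 1) * (|deriv cutoff (u / R)| / R) =
          2 * (u / R * |deriv cutoff (u / R)|) + 1 / R * |deriv cutoff (u / R)| := by
        field_simp
      rw [this]
      have : 1 / R * |deriv cutoff (u / R)| ≤ 1 * B :=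
        mul_le_mul hinv hb.1 (abs_nonneg _) zero_le_one
      linarith
    refine mul_le_mul ((abs_add_le _ _).trans ?_) h0 (norm_nonneg _) (by positivity)
    linarith
  linarith

variable {V : Type*} [NormedAddCommGroup V] [NormedSpace ℂ V]

/-- Green's identity for a smooth radial kernel with decay. -/
theorem integral_decay_smul_helmholtz {σ ρ C C' D : ℝ} (hσ : 0 ≤ σ) (hρ : 1 + σ < ρ) (s : ℂ)
    {k : ℝ → ℂ} (hk : ∀ u, 0 ≤ u → ContDiffAt ℝ 2 k u)
    (k0 : ∀ u, 0 ≤ u → ‖k u‖ ≤ D * (1 + u) ^ (-ρ))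
    (k1 : ∀ u, 0 ≤ u → (1 + u) * ‖deriv k u‖ ≤ D * (1 + u) ^ (-ρ))
    (k2 : ∀ u, 0 ≤ u → (1 + u) ^ 2 * ‖deriv (deriv k) u‖ ≤ D * (1 + u) ^ (-ρ))
    (z : ℍ) {h : ℍ → V} (hh : ContMDiff 𝓘(ℝ, ℂ) 𝓘(ℝ, V) 2 h)
    (hC : ∀ w, ‖h w‖ ≤ C * growth σ w) (hC' : ∀ w, ‖helmholtz s h w‖ ≤ C' * growth σ w) :
    ∫ w, k (pointPair z w) • helmholtz s h w =
      ∫ w, radialHelmholtz s k (pointPair z w) • h w := by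
  obtain ⟨B, hB0, hB⟩ := exists_deriv_cutoff_bound
  have hD : 0 ≤ D := by
    have := (norm_nonneg _).trans (k0 0 le_rfl)
    simpa using this
  -- The radius n + 1 is at least 1, as the uniform bound requires, and near each fixed u the cutoff
  -- is eventually identically 1; both sides then converge by dominated convergence.
  set kR : ℕ → ℝ → ℂ := fun n u => (cutoff (u / ((n : ℝ) + 1)) : ℂ) * k u
  have hkR : ∀ n u, 0 ≤ u → ContDiffAt ℝ 2 (kR n) u := fun n u hu =>
    contDiffAt_cutoff_mul (n := 2) (hk u hu) _
  have hev : ∀ u : ℝ, ∀ᶠ n : ℕ in atTop, kR n =ᶠ[𝓝 u] k := fun u => by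
    filter_upwards [eventually_gt_atTop ⌈u⌉₊] with n hn
    have h1 : u < (n : ℝ) + 1 := by
      have : u < n := (Nat.le_ceil u).trans_lt (by exact_mod_cast hn)
      linarith
    filter_upwards [gt_mem_nhds h1] with v hv
    have : cutoff (v / ((n : ℝ) + 1)) = 1 := by
      refine cutoff_of_le ?_
      rw [div_le_one (by positivity)]
      exact hv.le
    simp [kR, this]
  have key : ∀ n, ∫ w, kR n (pointPair z w) • helmholtz s h w =
      ∫ w, radialHelmholtz s (kR n) (pointPair z w) • h w := fun n =>
    integral_comp_pointPair_smul_helmholtz s (R := 2 * ((n : ℝ) + 1)) (hkR n) (fun u hu => by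
      have : cutoff (u / ((n : ℝ) + 1)) = 0 := by
        refine cutoff_of_ge ?_
        rw [le_div_iff₀ (by positivity)]
        exact hu
      simp [kR, this]) z hh
  have hdom := integrable_greenMajorant hσ hρ z
  have hcu := continuous_pointPair_left z
  have hbound : ∀ (D' C'' : ℝ) (a : ℂ) (b : V) (w : ℍ), 0 < pointPair z w → 0 ≤ D' →
      ‖a‖ ≤ D' * (1 + pointPair z w) ^ (-ρ) → ‖b‖ ≤ C'' * growth σ w →
      ‖a • b‖ ≤ D' * C'' * (greenMajorant ρ (pointPair z w) * growth σ w) := by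
    intro D' C'' a b w hw hD' ha hb
    have ha' : ‖a‖ ≤ D' * greenMajorant ρ (pointPair z w) :=
      ha.trans (mul_le_mul_of_nonneg_left (rpow_neg_le_greenMajorant ρ hw) hD')
    rw [norm_smul]
    calc _ ≤ (D' * greenMajorant ρ (pointPair z w)) * (C'' * growth σ w) :=
          mul_le_mul ha' hb (norm_nonneg _) ((norm_nonneg _).trans ha')
      _ = _ := by ring
  have lim1 : Tendsto (fun n => ∫ w, kR n (pointPair z w) • helmholtz s h w) atTop
      (𝓝 (∫ w, k (pointPair z w) • helmholtz s h w)) := by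
    refine tendsto_integral_of_dominated_convergence
      (fun w => D * C' * (greenMajorant ρ (pointPair z w) * growth σ w)) (fun n => ?_)
      (hdom.const_mul _) (fun n => ?_) (ae_of_all _ fun w => ?_)
    · exact ((contMDiff_comp_pointPair (hkR n) z).continuous.smul
        (continuous_helmholtz s hh)).aestronglyMeasurable
    · filter_upwards [ae_pointPair_pos z] with w hw
      refine hbound D C' _ _ w hw hD ?_ (hC' w)
      rw [norm_mul, Complex.norm_real, Real.norm_eq_abs]
      exact (mul_le_of_le_one_left (norm_nonneg _) (abs_cutoff_le _)).trans (k0 _ hw.le)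
    · refine tendsto_const_nhds.congr' ?_
      filter_upwards [hev (pointPair z w)] with n hn
      rw [hn.eq_of_nhds]
  have lim2 : Tendsto (fun n => ∫ w, radialHelmholtz s (kR n) (pointPair z w) • h w) atTop
      (𝓝 (∫ w, radialHelmholtz s k (pointPair z w) • h w)) := by
    refine tendsto_integral_of_dominated_convergence
      (fun w => (3 + ‖s * (1 - s)‖ + 15 * B) * D * C *
        (greenMajorant ρ (pointPair z w) * growth σ w)) (fun n => ?_)
      (hdom.const_mul _) (fun n => ?_) (ae_of_all _ fun w => ?_)
    · have hc := continuous_helmholtz s (contMDiff_comp_pointPair (hkR n) z)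
      have e : helmholtz s (fun w => kR n (pointPair z w)) =
          fun w => radialHelmholtz s (kR n) (pointPair z w) :=
        funext fun w => helmholtz_comp_pointPair s (hkR n) z w
      rw [e] at hc
      exact (hc.smul hh.continuous).aestronglyMeasurable
    · filter_upwards [ae_pointPair_pos z] with w hw
      refine hbound _ C _ _ w hw (by positivity) ?_ (hC w)
      have := norm_radialHelmholtz_cutoff_mul_le s (R := (n : ℝ) + 1) hw.le hB0 hB
        (by have := n.cast_nonneg (α := ℝ); linarith) (hk _ hw.le) (k0 _ hw.le) (k1 _ hw.le)
        (k2 _ hw.le)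
      rw [mul_assoc]
      exact this
    · refine tendsto_const_nhds.congr' ?_
      filter_upwards [hev (pointPair z w)] with n hn
      rw [radialHelmholtz_congr s hn]
  simp only [key] at lim1
  exact tendsto_nhds_unique lim1 lim2

end Decay

/-! ### The shifted Green function. -/

section Shift

variable {s : ℂ}

theorem deriv_shift_green (s : ℂ) (ε : ℝ) :
    deriv (fun u => green s (u + ε)) = fun u => deriv (green s) (u + ε) :=
  funext fun u => deriv_comp_add_const (green s) ε u

theorem deriv_deriv_shift_green (s : ℂ) (ε : ℝ) :
    deriv (deriv (fun u => green s (u + ε))) = fun u => deriv (deriv (green s)) (u + ε) := by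
  rw [deriv_shift_green]
  exact funext fun u => deriv_comp_add_const (deriv (green s)) ε u

/-- The radial operator applied to the shifted Green function `u ↦ G_s(u + ε)`. -/
def shiftKernel (s : ℂ) (ε u : ℝ) : ℂ :=
  -((ε * (2 * u + 1 + ε) : ℝ) : ℂ) * deriv (deriv (green s)) (u + ε)
    - ((2 * ε : ℝ) : ℂ) * deriv (green s) (u + ε)

/-- G_s solves the equation at u + ε, so only the differences of the coefficients at u and at u + ε
remain: ε(2u+1+ε) for the second derivative and 2ε for the first. -/
theorem radialHelmholtz_shift_green (hs : 1 < s.re) {ε u : ℝ} (h : 0 < u + ε) :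
    radialHelmholtz s (fun u => green s (u + ε)) u = shiftKernel s ε u := by
  have h0 := radialHelmholtz_green hs h
  rw [radialHelmholtz] at h0 ⊢
  rw [deriv_deriv_shift_green, deriv_shift_green, shiftKernel]
  push_cast at h0 ⊢
  linear_combination h0

theorem one_add_le_shift {ε u : ℝ} (hε : 0 < ε) (hu : 0 ≤ u) :
    (1 + u) * (u + ε)⁻¹ ≤ 1 + ε⁻¹ := by
  have h : 0 < u + ε := by linarith
  rw [← div_eq_mul_inv, div_le_iff₀ h]
  have : ε⁻¹ * ε = 1 := inv_mul_cancel₀ hε.ne'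
  have h2 : 0 ≤ ε⁻¹ * u := by positivity
  nlinarith

theorem rpow_shift_le {ρ ε u : ℝ} (hρ : 0 ≤ ρ) (hε : 0 < ε) (hu : 0 ≤ u) :
    (1 + (u + ε)) ^ (-ρ) ≤ (1 + u) ^ (-ρ) :=
  Real.rpow_le_rpow_of_nonpos (by linarith) (by linarith) (by linarith)

/-- For fixed ε, where D may depend on ε: the shift keeps the argument away from 0, and each factor
(u+ε)^{-1} is traded for (1+u)^{-1} at the cost of 1 + 1/ε. -/
theorem exists_shift_green_bound (hs : 1 < s.re) {ε : ℝ} (hε : 0 < ε) :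
    ∃ D : ℝ, ∀ u : ℝ, 0 ≤ u → ‖green s (u + ε)‖ ≤ D * (1 + u) ^ (-s.re) ∧
      (1 + u) * ‖deriv (green s) (u + ε)‖ ≤ D * (1 + u) ^ (-s.re) ∧
      (1 + u) ^ 2 * ‖deriv (deriv (green s)) (u + ε)‖ ≤ D * (1 + u) ^ (-s.re) := by
  obtain ⟨C1, hC1, h1⟩ := norm_deriv_green_le hs
  obtain ⟨C2, hC2, h2⟩ := norm_deriv_deriv_green_le hs
  set E := 1 + ε⁻¹
  have hE1 : 1 ≤ E := by simp only [E]; linarith [inv_pos.2 hε]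
  have hE0 : 0 ≤ E := by linarith
  refine ⟨max E (max (E * C1) (E ^ 2 * C2)), fun u hu => ?_⟩
  have hU : 0 < u + ε := by linarith
  have hsh := one_add_le_shift hε hu
  have hr := rpow_shift_le (ρ := s.re) (by linarith) hε hu
  have hp : 0 ≤ (1 + u) ^ (-s.re) := by positivity
  have hp' : 0 ≤ (1 + (u + ε)) ^ (-s.re) := by positivity
  refine ⟨?_, ?_, ?_⟩
  · have hg := norm_green_le hs hU
    have e : (u + ε) ^ (-(1 / 2) : ℝ) * (1 + (u + ε)) ^ (1 / 2 - s.re) ≤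
        E * (1 + (u + ε)) ^ (-s.re) := by
      have e1 : (1 + (u + ε)) ^ (1 / 2 - s.re) =
          (1 + (u + ε)) ^ (1 / 2 : ℝ) * (1 + (u + ε)) ^ (-s.re) := by
        rw [← Real.rpow_add (by linarith), sub_eq_add_neg]
      have e2 : (u + ε) ^ (-(1 / 2) : ℝ) * (1 + (u + ε)) ^ (1 / 2 : ℝ) ≤ E := by
        rw [Real.rpow_neg hU.le, ← Real.inv_rpow hU.le, ← Real.mul_rpow (by positivity)
          (by positivity)]
        have e3 : (u + ε)⁻¹ * (1 + (u + ε)) ≤ E := by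
          rw [mul_add, inv_mul_cancel₀ hU.ne', mul_one]
          have : (u + ε)⁻¹ ≤ ε⁻¹ := inv_anti₀ hε (by linarith)
          simp only [E]
          linarith
        calc _ ≤ E ^ (1 / 2 : ℝ) := Real.rpow_le_rpow (by positivity) e3 (by norm_num)
          _ ≤ E ^ (1 : ℝ) := Real.rpow_le_rpow_of_exponent_le hE1 (by norm_num)
          _ = E := Real.rpow_one E
      rw [e1, ← mul_assoc]
      gcongr
    calc _ ≤ E * (1 + (u + ε)) ^ (-s.re) := hg.trans e
      _ ≤ E * (1 + u) ^ (-s.re) := by gcongr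
      _ ≤ _ := by gcongr; exact le_max_left _ _
  · calc _ ≤ (1 + u) * (C1 * (u + ε)⁻¹ * (1 + (u + ε)) ^ (-s.re)) := by gcongr; exact h1 _ hU
      _ = ((1 + u) * (u + ε)⁻¹) * C1 * (1 + (u + ε)) ^ (-s.re) := by ring
      _ ≤ E * C1 * (1 + u) ^ (-s.re) := by gcongr
      _ ≤ _ := by gcongr; exact (le_max_left _ _).trans (le_max_right _ _)
  · calc _ ≤ (1 + u) ^ 2 * (C2 * ((u + ε) ^ 2)⁻¹ * (1 + (u + ε)) ^ (-s.re)) := by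
          gcongr; exact h2 _ hU
      _ = ((1 + u) * (u + ε)⁻¹) ^ 2 * C2 * (1 + (u + ε)) ^ (-s.re) := by
        rw [mul_pow, inv_pow]; ring
      _ ≤ E ^ 2 * C2 * (1 + u) ^ (-s.re) := by gcongr
      _ ≤ _ := by gcongr; exact (le_max_right _ _).trans (le_max_right _ _)

theorem contDiffAt_shift_green (hs : 1 < s.re) {ε : ℝ} (hε : 0 < ε) (u : ℝ) (hu : 0 ≤ u) :
    ContDiffAt ℝ 2 (fun u => green s (u + ε)) u :=
  ContDiffAt.comp (g := green s) (f := fun u : ℝ => u + ε) u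
    (contDiffAt_green (n := 2) hs (WithTop.coe_le_coe.2 le_top) (by linarith))
    (contDiff_id.add contDiff_const).contDiffAt

/-- Here C does not depend on ε. The bound ε (u+ε)^{-2} shows the kernel at its two scales: of size
1/ε for u up to order ε, and O(ε) away from u = 0. -/
theorem norm_shiftKernel_le (hs : 1 < s.re) :
    ∃ C : ℝ, 0 ≤ C ∧ ∀ ε u : ℝ, 0 < ε → ε ≤ 1 → 0 ≤ u →
      ‖shiftKernel s ε u‖ ≤ C * ε * (((u + ε) ^ 2)⁻¹ * (1 + u)) * (1 + u) ^ (-s.re) := by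
  obtain ⟨C1, hC1, h1⟩ := norm_deriv_green_le hs
  obtain ⟨C2, hC2, h2⟩ := norm_deriv_deriv_green_le hs
  refine ⟨2 * C2 + 2 * C1, by positivity, fun ε u hε hε1 hu => ?_⟩
  have hU : 0 < u + ε := by linarith
  have hr := rpow_shift_le (ρ := s.re) (by linarith) hε hu
  have hp' : 0 ≤ (1 + (u + ε)) ^ (-s.re) := by positivity
  have hp : 0 ≤ (1 + u) ^ (-s.re) := by positivity
  rw [shiftKernel]
  refine (norm_sub_le _ _).trans ?_
  rw [norm_mul, norm_mul, norm_neg, Complex.norm_real, Complex.norm_real,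
    Real.norm_of_nonneg (by positivity), Real.norm_of_nonneg (by positivity)]
  have t1 : ε * (2 * u + 1 + ε) * ‖deriv (deriv (green s)) (u + ε)‖ ≤
      2 * C2 * ε * (((u + ε) ^ 2)⁻¹ * (1 + u)) * (1 + u) ^ (-s.re) := by
    calc _ ≤ ε * (2 * (1 + u)) * (C2 * ((u + ε) ^ 2)⁻¹ * (1 + u) ^ (-s.re)) := by
          gcongr
          · linarith
          · exact (h2 _ hU).trans (by gcongr)
      _ = _ := by ring
  have t2 : 2 * ε * ‖deriv (green s) (u + ε)‖ ≤
      2 * C1 * ε * (((u + ε) ^ 2)⁻¹ * (1 + u)) * (1 + u) ^ (-s.re) := by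
    have e : (u + ε)⁻¹ ≤ ((u + ε) ^ 2)⁻¹ * (1 + u) := by
      rw [inv_mul_eq_div, le_div_iff₀ (by positivity)]
      have : (u + ε)⁻¹ * (u + ε) ^ 2 = u + ε := by field_simp
      rw [this]
      linarith
    calc _ ≤ 2 * ε * (C1 * (((u + ε) ^ 2)⁻¹ * (1 + u)) * (1 + u) ^ (-s.re)) := by
          gcongr
          exact (h1 _ hU).trans (by gcongr)
      _ = _ := by ring
  calc _ ≤ _ := add_le_add t1 t2
    _ = _ := by ring

theorem continuousOn_shiftKernel (hs : 1 < s.re) {ε : ℝ} (hε : 0 < ε) :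
    ContinuousOn (shiftKernel s ε) (Set.Ici 0) := by
  have hg : ∀ u ∈ Set.Ici (0 : ℝ), ContDiffAt ℝ 2 (green s) (u + ε) := fun u hu =>
    contDiffAt_green (n := 2) hs (WithTop.coe_le_coe.2 le_top) (by have : 0 ≤ u := hu; linarith)
  have hadd : Continuous fun u : ℝ => u + ε := by fun_prop
  intro u hu
  have d1 : ContDiffAt ℝ 1 (deriv (green s)) (u + ε) :=
    ((hg u hu).fderiv_right (m := 1) (by norm_num)).clm_apply (contDiffAt_const (c := (1 : ℝ)))
  have d2 : ContDiffAt ℝ 0 (deriv (deriv (green s))) (u + ε) :=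
    (d1.fderiv_right (m := 0) (by norm_num)).clm_apply (contDiffAt_const (c := (1 : ℝ)))
  have c1 : ContinuousAt (fun u => deriv (green s) (u + ε)) u :=
    ContinuousAt.comp (f := fun u : ℝ => u + ε) d1.continuousAt hadd.continuousAt
  have c2 : ContinuousAt (fun u => deriv (deriv (green s)) (u + ε)) u :=
    ContinuousAt.comp (f := fun u : ℝ => u + ε) d2.continuousAt hadd.continuousAt
  have c3 : Continuous fun u : ℝ => -((ε * (2 * u + 1 + ε) : ℝ) : ℂ) := by fun_prop
  exact ((c3.continuousAt.mul c2).sub (continuousAt_const.mul c1)).continuousWithinAt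

/-- As `δ → 0`, the rescaled kernel converges to `-(4π)⁻¹ (1 + c)⁻²`. -/
theorem tendsto_rescaled_shiftKernel (hs : 1 < s.re) {q : ℝ → ℝ} {c : ℝ} (hc : 0 ≤ c)
    (hq : Tendsto q (𝓝[>] 0) (𝓝 c)) (hq0 : ∀ᶠ δ in 𝓝[>] 0, 0 ≤ q δ) :
    Tendsto (fun δ : ℝ => ((δ ^ 2 : ℝ) : ℂ) * shiftKernel s (δ ^ 2) (δ ^ 2 * q δ)) (𝓝[>] 0)
      (𝓝 (-(1 / (4 * (Real.pi : ℂ))) * (((1 + c) ^ 2)⁻¹ : ℝ))) := by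
  have hδ : Tendsto (fun δ : ℝ => δ ^ 2) (𝓝[>] 0) (𝓝 0) := by
    have : Tendsto (fun δ : ℝ => δ ^ 2) (𝓝 0) (𝓝 (0 ^ 2)) := (continuous_pow 2).tendsto 0
    simpa using this.mono_left nhdsWithin_le_nhds
  -- The argument of G_s is δ²(1 + q), which tends to 0 from the right, so the limits of u G_s' and
  -- u² G_s'' apply. Only the second-derivative term survives.
  have hv : Tendsto (fun δ : ℝ => δ ^ 2 * q δ + δ ^ 2) (𝓝[>] 0) (𝓝[>] 0) := by
    refine tendsto_nhdsWithin_iff.2 ⟨?_, ?_⟩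
    · simpa using (hδ.mul hq).add hδ
    · filter_upwards [self_mem_nhdsWithin, hq0] with δ h1 h2
      have h1' : 0 < δ := h1
      exact Set.mem_Ioi.2 (by positivity)
  have l1 := (tendsto_sq_mul_deriv_deriv_green hs).comp hv
  have l2 := (tendsto_mul_deriv_green hs).comp hv
  have hinv : Tendsto (fun δ : ℝ => (1 + q δ)⁻¹) (𝓝[>] 0) (𝓝 (1 + c)⁻¹) :=
    (hq.const_add 1).inv₀ (by positivity)
  have a1 : Tendsto (fun δ : ℝ => ((2 * (δ ^ 2 * q δ) + 1 + δ ^ 2) * (1 + q δ)⁻¹ ^ 2 : ℝ))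
      (𝓝[>] 0) (𝓝 ((1 + c)⁻¹ ^ 2)) := by
    have := ((((hδ.mul hq).const_mul 2).add_const 1).add hδ).mul (hinv.pow 2)
    simpa using this
  have a2 : Tendsto (fun δ : ℝ => (2 * δ ^ 2 * (1 + q δ)⁻¹ : ℝ)) (𝓝[>] 0) (𝓝 0) := by
    have := (hδ.const_mul 2).mul hinv
    simpa using this
  have b1 := (Complex.continuous_ofReal.tendsto _).comp a1
  have b2 := (Complex.continuous_ofReal.tendsto _).comp a2
  have main := ((b1.mul l1).neg).sub (b2.mul l2)
  have e : -(((((1 + c)⁻¹ ^ 2 : ℝ)) : ℂ) * (1 / (4 * (Real.pi : ℂ)))) -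
      ((0 : ℝ) : ℂ) * -(1 / (4 * (Real.pi : ℂ))) =
      -(1 / (4 * (Real.pi : ℂ))) * (((1 + c) ^ 2)⁻¹ : ℝ) := by
    rw [inv_pow]
    push_cast
    ring
  rw [e] at main
  refine main.congr' ?_
  filter_upwards [self_mem_nhdsWithin, hq0] with δ h1 h2
  have h1' : (δ : ℂ) ≠ 0 := by exact_mod_cast (ne_of_gt h1)
  have h2' : (1 : ℂ) + (q δ : ℂ) ≠ 0 := by exact_mod_cast (by linarith : 1 + q δ ≠ 0)
  simp only [Function.comp_apply, shiftKernel]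
  push_cast
  have hf : (δ : ℂ) ^ 2 * q δ + δ ^ 2 = δ ^ 2 * (1 + q δ) := by ring
  rw [hf]
  field_simp

/-- Polar coordinates, with primitive -2(1 + r²/4)^{-1} of the radial integrand. The value cancels
the 1/(4π) in the rescaled kernel, so the limiting mass is -1. -/
theorem integral_one_add_sq_inv_sq :
    ∫ p : ℂ, ((1 + ‖p‖ ^ 2 / 4) ^ 2)⁻¹ = 4 * Real.pi := by
  have h := integral_fun_norm_addHaar (volume : Measure ℂ)
    (fun r : ℝ => ((1 + r ^ 2 / 4) ^ 2)⁻¹)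
  rw [h]
  have hd : ∀ r ∈ Set.Ici (0 : ℝ), HasDerivAt (fun r : ℝ => -2 * (1 + r ^ 2 / 4)⁻¹)
      (r * ((1 + r ^ 2 / 4) ^ 2)⁻¹) r := by
    intro r _
    have h1 : HasDerivAt (fun r : ℝ => 1 + r ^ 2 / 4) (2 * r / 4) r := by
      have := (((hasDerivAt_id r).pow 2).div_const 4).const_add 1
      simpa using this
    have := (h1.inv (by positivity)).const_mul (-2)
    convert! this using 1
    field_simp
    ring
  have hlim : Tendsto (fun r : ℝ => -2 * (1 + r ^ 2 / 4)⁻¹) atTop (𝓝 0) := by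
    have h1 : Tendsto (fun r : ℝ => 1 + r ^ 2 / 4) atTop atTop :=
      tendsto_atTop_add_const_left _ _
        ((tendsto_pow_atTop two_ne_zero).atTop_div_const (by norm_num))
    simpa using (tendsto_inv_atTop_zero.comp h1).const_mul (-2)
  have hi := integral_Ioi_of_hasDerivAt_of_nonneg' hd
    (fun r hr => by have : 0 < r := hr; positivity) hlim
  have hb : (volume : Measure ℂ).real (Metric.ball 0 1) = Real.pi := by
    rw [Measure.real, Complex.volume_ball]
    simp
  rw [hb, Complex.finrank_real_complex]
  have e : (fun y : ℝ => y ^ (2 - 1) • ((1 + y ^ 2 / 4) ^ 2)⁻¹) =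
      fun y : ℝ => y * ((1 + y ^ 2 / 4) ^ 2)⁻¹ := by
    ext y; simp
  rw [e, hi]
  simp
  ring

end Shift

/-! ### The shifted kernel as an approximate identity. -/

section ApproximateIdentity

variable {V : Type*} [NormedAddCommGroup V] [NormedSpace ℂ V] {s : ℂ} {σ C : ℝ}

/-- With ε = δ² and ζ = i + δp, the ratio u/ε tends to |p|²/4; this fixes the scale of the blow-up.
-/
theorem pointPairC_I_add (δ : ℝ) (p : ℂ) :
    pointPairC I (Complex.I + δ • p) = δ ^ 2 * (‖p‖ ^ 2 / (4 * (1 + δ * p.im))) := by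
  rw [pointPairC, ← Complex.normSq_eq_norm_sq, Complex.normSq_apply]
  simp only [Complex.add_re, Complex.add_im, Complex.I_re, Complex.I_im, Complex.real_smul,
    Complex.mul_re, Complex.mul_im, Complex.ofReal_re, Complex.ofReal_im, I_re, I_im]
  ring

theorem im_add_smul (δ : ℝ) (p : ℂ) : (Complex.I + δ • p).im = 1 + δ * p.im := by
  simp

/-- The part of the kernel integrand near `I`, in Euclidean coordinates. -/
def nearIntegrand (s : ℂ) (h : ℍ → V) (δ : ℝ) (ζ : ℂ) : V :=
  (Metric.ball Complex.I (1 / 2)).indicator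
    (fun ζ => (1 / ζ.im ^ 2) • (shiftKernel s (δ ^ 2) (pointPairC I ζ) • h (ofComplex ζ))) ζ

theorem im_mem_of_mem_ball {ζ : ℂ} (hζ : ζ ∈ Metric.ball Complex.I (1 / 2)) :
    1 / 2 < ζ.im ∧ ζ.im < 3 / 2 := by
  have h1 : |(ζ - Complex.I).im| < 1 / 2 :=
    (Complex.abs_im_le_norm _).trans_lt (by rwa [Metric.mem_ball, dist_eq_norm] at hζ)
  rw [Complex.sub_im, Complex.I_im, abs_lt] at h1
  constructor <;> linarith [h1.1, h1.2]

theorem setIntegral_near (h : ℍ → V) (δ : ℝ) :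
    ∫ w : ℍ in {w : ℍ | (w : ℂ) ∈ Metric.ball Complex.I (1 / 2)},
      shiftKernel s (δ ^ 2) (pointPair I w) • h w = ∫ ζ : ℂ, nearIntegrand s h δ ζ := by
  have hA : MeasurableSet {w : ℍ | (w : ℂ) ∈ Metric.ball Complex.I (1 / 2)} :=
    (Metric.isOpen_ball.preimage continuous_coe).measurableSet
  rw [← integral_indicator hA, integral_uhp]
  have e := setIntegral_eq_integral_of_forall_compl_eq_zero (μ := volume)
    (s := {ζ : ℂ | 0 < ζ.im}) (f := nearIntegrand s h δ) (fun ζ hζ => by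
      refine Set.indicator_of_notMem (fun hb => hζ ?_) _
      have := (im_mem_of_mem_ball hb).1
      exact Set.mem_ofPred_eq ▸ (by linarith : 0 < ζ.im))
  rw [← e]
  refine setIntegral_congr_fun isOpen_im_pos.measurableSet fun ζ hζ => ?_
  have hw : ((ofComplex ζ : ℍ) : ℂ) = ζ := by rw [ofComplex_apply_of_im_pos hζ]
  by_cases hb : ζ ∈ Metric.ball Complex.I (1 / 2)
  · have : (ofComplex ζ : ℍ) ∈ {w : ℍ | (w : ℂ) ∈ Metric.ball Complex.I (1 / 2)} := by
      rw [Set.mem_ofPred_eq, hw]; exact hb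
    simp only [nearIntegrand, Set.indicator_of_mem hb, Set.indicator_of_mem this,
      pointPair_ofComplex I hζ]
  · have : (ofComplex ζ : ℍ) ∉ {w : ℍ | (w : ℂ) ∈ Metric.ball Complex.I (1 / 2)} := by
      rw [Set.mem_ofPred_eq, hw]; exact hb
    simp only [nearIntegrand, Set.indicator_of_notMem hb, Set.indicator_of_notMem this, smul_zero]

theorem integral_near_rescale (h : ℍ → V) {δ : ℝ} (hδ : 0 < δ) :
    ∫ ζ : ℂ, nearIntegrand s h δ ζ =
      ∫ p : ℂ, δ ^ 2 • nearIntegrand s h δ (Complex.I + δ • p) := by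
  rw [integral_smul, Measure.integral_comp_smul volume
    (fun p : ℂ => nearIntegrand s h δ (Complex.I + p)) δ, Complex.finrank_real_complex,
    abs_of_pos (by positivity), smul_inv_smul₀ (by positivity),
    integral_add_left_eq_self (nearIntegrand s h δ) Complex.I]

/-- The dominating function is (1+|p|²)^{-2}, integrable on the plane. Its exponent is written -4/2
to fit `integrable_rpow_neg_one_add_norm_sq`. -/
theorem norm_near_le (hs : 1 < s.re) {h : ℍ → V} (hh : Continuous h) :
    ∃ K : ℝ, ∀ δ : ℝ, 0 < δ → δ ≤ 1 → ∀ p : ℂ,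
      ‖δ ^ 2 • nearIntegrand s h δ (Complex.I + δ • p)‖ ≤
        K * ((1 : ℝ) + ‖p‖ ^ 2) ^ (-(4 : ℝ) / 2) := by
  obtain ⟨C, hC0, hC⟩ := norm_shiftKernel_le hs
  have hcont : ContinuousOn (fun ζ : ℂ => h (ofComplex ζ))
      (Metric.closedBall Complex.I (1 / 2)) := by
    intro ζ hζ
    have hpos : 0 < ζ.im := by
      have h1 : |(ζ - Complex.I).im| ≤ 1 / 2 :=
        (Complex.abs_im_le_norm _).trans (by rwa [Metric.mem_closedBall, dist_eq_norm] at hζ)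
      rw [Complex.sub_im, Complex.I_im, abs_le] at h1
      linarith [h1.1]
    exact (hh.continuousAt.comp
      (contMDiffAt_ofComplex_real (n := 0) hpos).continuousAt).continuousWithinAt
  obtain ⟨M, hM⟩ := (isCompact_closedBall Complex.I (1 / 2)).exists_bound_of_continuousOn hcont
  have hM0 : 0 ≤ M := (norm_nonneg _).trans (hM Complex.I (Metric.mem_closedBall_self (by norm_num)))
  -- 144 = 4·36: heights above 1/2 give y^{-2} ≤ 4, and heights below 3/2 give 1 + q ≥ (1+|p|²)/6,
  -- hence the factor 36.
  refine ⟨144 * C * M, fun δ hδ hδ1 p => ?_⟩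
  have hrp : ((1 : ℝ) + ‖p‖ ^ 2) ^ (-(4 : ℝ) / 2) = ((1 + ‖p‖ ^ 2) ^ 2)⁻¹ := by
    rw [show -(4 : ℝ) / 2 = -((2 : ℕ) : ℝ) by norm_num, Real.rpow_neg (by positivity),
      Real.rpow_natCast]
  rw [hrp]
  by_cases hb : Complex.I + δ • p ∈ Metric.ball Complex.I (1 / 2)
  · obtain ⟨b1, b2⟩ := im_mem_of_mem_ball hb
    have hMp := hM _ (Metric.ball_subset_closedBall hb)
    rw [nearIntegrand, Set.indicator_of_mem hb, norm_smul, norm_smul, norm_smul]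
    rw [im_add_smul] at b1 b2 ⊢
    rw [pointPairC_I_add]
    set b := 1 + δ * p.im
    set q := ‖p‖ ^ 2 / (4 * b)
    have hb0 : 0 < b := by linarith
    have hq0 : 0 ≤ q := by positivity
    have hq : (1 + ‖p‖ ^ 2) / 6 ≤ 1 + q := by
      have : ‖p‖ ^ 2 / 6 ≤ q := by
        refine div_le_div_of_nonneg_left (by positivity) (by positivity) (by linarith)
      linarith
    have hk := hC (δ ^ 2) (δ ^ 2 * q) (by positivity) (by nlinarith) (by positivity)
    have e1 : (1 + δ ^ 2 * q) * (1 + δ ^ 2 * q) ^ (-s.re) ≤ 1 := by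
      have h0 : 0 ≤ δ ^ 2 * q := by positivity
      nth_rewrite 1 [← Real.rpow_one (1 + δ ^ 2 * q)]
      rw [← Real.rpow_add (by linarith)]
      exact Real.rpow_le_one_of_one_le_of_nonpos (by linarith) (by linarith)
    have hk2 : δ ^ 2 * ‖shiftKernel s (δ ^ 2) (δ ^ 2 * q)‖ ≤ 36 * C * ((1 + ‖p‖ ^ 2) ^ 2)⁻¹ := by
      have e2 : ((1 + q) ^ 2)⁻¹ ≤ 36 * ((1 + ‖p‖ ^ 2) ^ 2)⁻¹ := by
        have : ((1 + ‖p‖ ^ 2) / 6) ^ 2 ≤ (1 + q) ^ 2 := by gcongr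
        calc _ ≤ (((1 + ‖p‖ ^ 2) / 6) ^ 2)⁻¹ := inv_anti₀ (by positivity) this
          _ = _ := by field_simp; norm_num
      calc _ ≤ δ ^ 2 * (C * δ ^ 2 * (((δ ^ 2 * q + δ ^ 2) ^ 2)⁻¹ * (1 + δ ^ 2 * q)) *
            (1 + δ ^ 2 * q) ^ (-s.re)) := by gcongr
        _ = C * ((1 + q) ^ 2)⁻¹ * ((1 + δ ^ 2 * q) * (1 + δ ^ 2 * q) ^ (-s.re)) := by
          rw [show δ ^ 2 * q + δ ^ 2 = δ ^ 2 * (1 + q) by ring]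
          field_simp
        _ ≤ C * ((1 + q) ^ 2)⁻¹ * 1 := by gcongr
        _ ≤ C * (36 * ((1 + ‖p‖ ^ 2) ^ 2)⁻¹) * 1 := by gcongr
        _ = _ := by ring
    have hb4 : 1 / b ^ 2 ≤ 4 := by
      rw [div_le_iff₀ (by positivity)]
      nlinarith
    rw [Real.norm_of_nonneg (by positivity : 0 ≤ δ ^ 2),
      Real.norm_of_nonneg (by positivity : 0 ≤ 1 / b ^ 2)]
    calc _ = 1 / b ^ 2 * (δ ^ 2 * ‖shiftKernel s (δ ^ 2) (δ ^ 2 * q)‖) *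
          ‖h (ofComplex (Complex.I + δ • p))‖ := by ring
      _ ≤ 4 * (36 * C * ((1 + ‖p‖ ^ 2) ^ 2)⁻¹) * M := by gcongr
      _ = _ := by ring
  · rw [nearIntegrand, Set.indicator_of_notMem hb, smul_zero, norm_zero]
    positivity

theorem continuousOn_shiftKernel_pointPairC (hs : 1 < s.re) {δ : ℝ} (hδ : 0 < δ) :
    ContinuousOn (fun ζ => shiftKernel s (δ ^ 2) (pointPairC I ζ)) {ζ : ℂ | 0 < ζ.im} := by
  refine (continuousOn_shiftKernel hs (by positivity : 0 < δ ^ 2)).comp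
    (fun ζ hζ => (contDiffAt_pointPairC (n := 0) I hζ).continuousAt.continuousWithinAt)
    fun ζ hζ => ?_
  rw [← pointPair_ofComplex I hζ]
  exact pointPair_nonneg _ _

theorem aestronglyMeasurable_near (hs : 1 < s.re) {h : ℍ → V} (hh : Continuous h) {δ : ℝ}
    (hδ : 0 < δ) :
    AEStronglyMeasurable (fun p : ℂ => δ ^ 2 • nearIntegrand s h δ (Complex.I + δ • p)) volume := by
  refine AEStronglyMeasurable.const_smul ?_ _
  have hc : Continuous fun p : ℂ => Complex.I + δ • p := by fun_prop
  have hS : MeasurableSet ((fun p : ℂ => Complex.I + δ • p) ⁻¹' Metric.ball Complex.I (1 / 2)) :=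
    (Metric.isOpen_ball.preimage hc).measurableSet
  have e : (fun p : ℂ => nearIntegrand s h δ (Complex.I + δ • p)) =
      ((fun p : ℂ => Complex.I + δ • p) ⁻¹' Metric.ball Complex.I (1 / 2)).indicator
        ((fun ζ => (1 / ζ.im ^ 2) • (shiftKernel s (δ ^ 2) (pointPairC I ζ) • h (ofComplex ζ))) ∘
          fun p : ℂ => Complex.I + δ • p) := by
    ext p
    rfl
  rw [e, aestronglyMeasurable_indicator_iff hS]
  refine ContinuousOn.aestronglyMeasurable ?_ hS
  refine ContinuousOn.comp (t := Metric.ball Complex.I (1 / 2)) ?_ hc.continuousOn fun p hp => hp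
  have hsub : Metric.ball Complex.I (1 / 2) ⊆ {ζ : ℂ | 0 < ζ.im} := fun ζ hζ => by
    have := (im_mem_of_mem_ball hζ).1
    exact Set.mem_ofPred_eq ▸ (by linarith : 0 < ζ.im)
  refine ContinuousOn.mono ?_ hsub
  have c1 : ContinuousOn (fun ζ : ℂ => 1 / ζ.im ^ 2) {ζ : ℂ | 0 < ζ.im} :=
    continuousOn_const.div (Complex.continuous_im.pow 2).continuousOn
      fun ζ hζ => pow_ne_zero 2 (ne_of_gt hζ)
  have c3 : ContinuousOn (fun ζ : ℂ => h (ofComplex ζ)) {ζ : ℂ | 0 < ζ.im} := fun ζ hζ =>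
    (hh.continuousAt.comp
      (contMDiffAt_ofComplex_real (n := 0) hζ).continuousAt).continuousWithinAt
  exact c1.smul ((continuousOn_shiftKernel_pointPairC hs hδ).smul c3)

theorem tendsto_near (hs : 1 < s.re) {h : ℍ → V} (hh : Continuous h) (p : ℂ) :
    Tendsto (fun δ : ℝ => δ ^ 2 • nearIntegrand s h δ (Complex.I + δ • p)) (𝓝[>] 0)
      (𝓝 ((-(1 / (4 * (Real.pi : ℂ))) * (((1 + ‖p‖ ^ 2 / 4) ^ 2)⁻¹ : ℝ)) • h I)) := by
  have hl : Tendsto (fun δ : ℝ => Complex.I + δ • p) (𝓝[>] 0) (𝓝 Complex.I) := by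
    have : ContinuousAt (fun δ : ℝ => Complex.I + δ • p) 0 := by fun_prop
    have h2 := this.tendsto
    simp only [zero_smul, add_zero] at h2
    exact h2.mono_left nhdsWithin_le_nhds
  have hball : ∀ᶠ δ : ℝ in 𝓝[>] 0, Complex.I + δ • p ∈ Metric.ball Complex.I (1 / 2) :=
    hl.eventually (Metric.ball_mem_nhds _ (by norm_num))
  have hq : Tendsto (fun δ : ℝ => ‖p‖ ^ 2 / (4 * (1 + δ * p.im))) (𝓝[>] 0)
      (𝓝 (‖p‖ ^ 2 / 4)) := by
    have : ContinuousAt (fun δ : ℝ => ‖p‖ ^ 2 / (4 * (1 + δ * p.im))) 0 :=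
      continuousAt_const.div (by fun_prop) (by simp)
    have h2 := this.tendsto
    simp only [zero_mul, add_zero, mul_one] at h2
    exact h2.mono_left nhdsWithin_le_nhds
  have hq0 : ∀ᶠ δ : ℝ in 𝓝[>] 0, 0 ≤ ‖p‖ ^ 2 / (4 * (1 + δ * p.im)) := by
    filter_upwards [hball] with δ hδ
    have := (im_mem_of_mem_ball hδ).1
    rw [im_add_smul] at this
    have h0 : 0 < 1 + δ * p.im := by linarith
    positivity
  have l1 := tendsto_rescaled_shiftKernel hs (by positivity : 0 ≤ ‖p‖ ^ 2 / 4) hq hq0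
  have hI : (0 : ℝ) < Complex.I.im := by simp
  have l2 : Tendsto (fun δ : ℝ => h (ofComplex (Complex.I + δ • p))) (𝓝[>] 0) (𝓝 (h I)) := by
    have hc : ContinuousAt (fun ζ : ℂ => h (ofComplex ζ)) Complex.I :=
      hh.continuousAt.comp (contMDiffAt_ofComplex_real (n := 0) hI).continuousAt
    have h3 : h (ofComplex Complex.I) = h I := congrArg h (ofComplex_apply I)
    have h2 := hc.tendsto.comp hl
    rwa [h3] at h2
  have l3 : Tendsto (fun δ : ℝ => 1 / (Complex.I + δ • p).im ^ 2) (𝓝[>] 0) (𝓝 1) := by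
    have hc : ContinuousAt (fun ζ : ℂ => 1 / ζ.im ^ 2) Complex.I :=
      continuousAt_const.div (Complex.continuous_im.pow 2).continuousAt (by simp)
    have h2 := hc.tendsto.comp hl
    simp only [Complex.I_im, one_pow, div_one] at h2
    exact h2
  have main := l3.smul (l1.smul l2)
  rw [one_smul] at main
  refine main.congr' ?_
  filter_upwards [hball] with δ hδ
  rw [nearIntegrand, Set.indicator_of_mem hδ, pointPairC_I_add, mul_smul, smul_comm (δ ^ 2),
    Complex.coe_smul]

theorem tendsto_integral_near [CompleteSpace V] (hs : 1 < s.re) {h : ℍ → V} (hh : Continuous h) :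
    Tendsto (fun δ : ℝ => ∫ ζ : ℂ, nearIntegrand s h δ ζ) (𝓝[>] 0) (𝓝 (-h I)) := by
  obtain ⟨K, hK⟩ := norm_near_le hs hh
  have hint : ∫ p : ℂ, (-(1 / (4 * (Real.pi : ℂ))) * (((1 + ‖p‖ ^ 2 / 4) ^ 2)⁻¹ : ℝ)) • h I =
      -h I := by
    have e0 : ∫ a : ℂ, ((((1 + ‖a‖ ^ 2 / 4) ^ 2)⁻¹ : ℝ) : ℂ) =
        ((∫ a : ℂ, ((1 + ‖a‖ ^ 2 / 4) ^ 2)⁻¹ : ℝ) : ℂ) := integral_ofReal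
    rw [integral_smul_const, integral_const_mul, e0, integral_one_add_sq_inv_sq]
    have : (Real.pi : ℂ) ≠ 0 := by exact_mod_cast Real.pi_ne_zero
    have e : -(1 / (4 * (Real.pi : ℂ))) * ((4 * Real.pi : ℝ) : ℂ) = -1 := by
      push_cast
      field_simp
    exact (congrArg (fun c : ℂ => c • h I) e).trans (neg_one_smul ℂ (h I))
  rw [← hint]
  have hlim : Tendsto
      (fun δ : ℝ => ∫ p : ℂ, δ ^ 2 • nearIntegrand s h δ (Complex.I + δ • p)) (𝓝[>] 0)
      (𝓝 (∫ p : ℂ, (-(1 / (4 * (Real.pi : ℂ))) * (((1 + ‖p‖ ^ 2 / 4) ^ 2)⁻¹ : ℝ)) • h I)) := by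
    refine tendsto_integral_filter_of_dominated_convergence
      (fun p : ℂ => K * ((1 : ℝ) + ‖p‖ ^ 2) ^ (-(4 : ℝ) / 2)) ?_ ?_ ?_
      (ae_of_all _ fun p => tendsto_near hs hh p)
    · filter_upwards [self_mem_nhdsWithin] with δ hδ
      exact aestronglyMeasurable_near hs hh hδ
    · filter_upwards [Ioc_mem_nhdsGT (zero_lt_one (α := ℝ))] with δ hδ
      exact ae_of_all _ fun p => hK δ hδ.1 hδ.2 p
    · exact (integrable_rpow_neg_one_add_norm_sq (by simp; norm_num)).const_mul K
  refine hlim.congr' ?_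
  filter_upwards [self_mem_nhdsWithin] with δ hδ
  exact (integral_near_rescale h hδ).symm

/-- With t = |w - i| ≥ 1/2 the height is at most 1 + t, and t²/(4(1+t)) increases from its value
1/24 at t = 1/2. -/
theorem one_div_le_pointPair_of_notMem_ball {w : ℍ}
    (hw : (w : ℂ) ∉ Metric.ball Complex.I (1 / 2)) : 1 / 24 ≤ pointPair I w := by
  rw [Metric.mem_ball, dist_eq_norm, not_lt] at hw
  have hb := w.im_pos
  have h1 : w.im - 1 ≤ ‖(w : ℂ) - Complex.I‖ := by
    have := (le_abs_self _).trans (Complex.abs_im_le_norm ((w : ℂ) - Complex.I))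
    simpa using this
  rw [pointPair, coe_I, I_im, norm_sub_rev, mul_one, div_le_div_iff₀ (by norm_num) (by positivity)]
  nlinarith

theorem tendsto_integral_far (hσ : 0 ≤ σ) (hs : 1 + σ < s.re) {h : ℍ → V}
    (hC : ∀ w, ‖h w‖ ≤ C * growth σ w) :
    Tendsto (fun δ : ℝ => ∫ w : ℍ in {w : ℍ | (w : ℂ) ∈ Metric.ball Complex.I (1 / 2)}ᶜ,
      shiftKernel s (δ ^ 2) (pointPair I w) • h w) (𝓝[>] 0) (𝓝 0) := by
  obtain ⟨D, hD0, hD⟩ := norm_shiftKernel_le (s := s) (by linarith)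
  have hA : MeasurableSet {w : ℍ | (w : ℂ) ∈ Metric.ball Complex.I (1 / 2)} :=
    (Metric.isOpen_ball.preimage continuous_coe).measurableSet
  set J := ∫ w : ℍ in {w : ℍ | (w : ℂ) ∈ Metric.ball Complex.I (1 / 2)}ᶜ,
    600 * D * C * (greenMajorant s.re (pointPair I w) * growth σ w)
  have hlim : Tendsto (fun δ : ℝ => δ ^ 2 * J) (𝓝[>] 0) (𝓝 0) := by
    have : Tendsto (fun δ : ℝ => δ ^ 2 * J) (𝓝 0) (𝓝 (0 ^ 2 * J)) :=
      ((continuous_pow 2).mul continuous_const).tendsto 0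
    simp only [ne_eq, OfNat.ofNat_ne_zero, not_false_eq_true, zero_pow, zero_mul] at this
    exact this.mono_left nhdsWithin_le_nhds
  refine squeeze_zero_norm' ?_ hlim
  filter_upwards [Ioc_mem_nhdsGT (zero_lt_one (α := ℝ))] with δ hδ
  have hδ0 : 0 < δ := hδ.1
  rw [← integral_const_mul]
  refine norm_integral_le_of_norm_le
    (((integrable_greenMajorant_I hσ hs).const_mul _).const_mul _).integrableOn ?_
  filter_upwards [ae_restrict_mem hA.compl] with w hw
  have hu := one_div_le_pointPair_of_notMem_ball hw
  set u := pointPair I w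
  have hu0 : 0 < u := by linarith
  have hk := hD (δ ^ 2) u (by positivity) (by nlinarith [hδ.2]) hu0.le
  -- u^{-2}(1+u) decreases in u and equals 576 + 24 = 600 at u = 1/24.
  have e1 : ((u + δ ^ 2) ^ 2)⁻¹ * (1 + u) ≤ 600 := by
    have : ((u + δ ^ 2) ^ 2)⁻¹ ≤ (u ^ 2)⁻¹ := by
      refine inv_anti₀ (by positivity) ?_
      gcongr
      linarith [sq_nonneg δ]
    calc _ ≤ (u ^ 2)⁻¹ * (1 + u) := by gcongr
      _ ≤ 600 := by
        rw [inv_mul_le_iff₀ (by positivity)]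
        nlinarith
  have hk2 : ‖shiftKernel s (δ ^ 2) u‖ ≤ D * δ ^ 2 * 600 * greenMajorant s.re u := by
    calc _ ≤ _ := hk
      _ ≤ D * δ ^ 2 * 600 * (1 + u) ^ (-s.re) := by gcongr
      _ ≤ _ := by gcongr; exact rpow_neg_le_greenMajorant _ hu0
  rw [norm_smul]
  calc _ ≤ (D * δ ^ 2 * 600 * greenMajorant s.re u) * (C * growth σ w) :=
        mul_le_mul hk2 (hC w) (norm_nonneg _) ((norm_nonneg _).trans hk2)
    _ = _ := by ring

theorem continuous_shiftKernel_pointPair (hs : 1 < s.re) {ε : ℝ} (hε : 0 < ε) (z : ℍ) :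
    Continuous fun w => shiftKernel s ε (pointPair z w) :=
  (continuousOn_shiftKernel hs hε).comp_continuous (continuous_pointPair_left z)
    fun w => pointPair_nonneg z w

theorem integrable_shiftKernel (hσ : 0 ≤ σ) (hs : 1 + σ < s.re) {h : ℍ → V} (hh : Continuous h)
    (hC : ∀ w, ‖h w‖ ≤ C * growth σ w) {ε : ℝ} (hε : 0 < ε) :
    Integrable fun w => shiftKernel s ε (pointPair I w) • h w := by
  have hs1 : 1 < s.re := by linarith
  obtain ⟨D, hD⟩ := exists_shift_green_bound hs1 hε
  refine Integrable.mono' ((integrable_greenMajorant_I hσ hs).const_mul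
    ((3 + ‖s * (1 - s)‖) * D * C)) ?_ ?_
  · exact ((continuous_shiftKernel_pointPair hs1 hε I).smul hh).aestronglyMeasurable
  · filter_upwards [ae_pointPair_pos I] with w hw
    obtain ⟨d0, d1, d2⟩ := hD _ hw.le
    have hD0 : 0 ≤ D := by
      have := (norm_nonneg _).trans (hD 0 le_rfl).1
      simpa using this
    have hk : ‖shiftKernel s ε (pointPair I w)‖ ≤
        (3 + ‖s * (1 - s)‖) * D * greenMajorant s.re (pointPair I w) := by
      rw [← radialHelmholtz_shift_green hs1 (by linarith)]
      have := norm_radialHelmholtz_le s (k := fun u => green s (u + ε)) hw.le d0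
        (by rw [deriv_shift_green]; exact d1) (by rw [deriv_deriv_shift_green]; exact d2)
      refine this.trans ?_
      rw [mul_assoc]
      gcongr
      exact rpow_neg_le_greenMajorant _ hw
    rw [norm_smul]
    calc _ ≤ ((3 + ‖s * (1 - s)‖) * D * greenMajorant s.re (pointPair I w)) * (C * growth σ w) :=
          mul_le_mul hk (hC w) (norm_nonneg _) ((norm_nonneg _).trans hk)
      _ = _ := by ring

theorem tendsto_integral_shiftKernel [CompleteSpace V] (hσ : 0 ≤ σ) (hs : 1 + σ < s.re)
    {h : ℍ → V} (hh : Continuous h) (hC : ∀ w, ‖h w‖ ≤ C * growth σ w) :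
    Tendsto (fun δ : ℝ => ∫ w : ℍ, shiftKernel s (δ ^ 2) (pointPair I w) • h w) (𝓝[>] 0)
      (𝓝 (-h I)) := by
  have hA : MeasurableSet {w : ℍ | (w : ℂ) ∈ Metric.ball Complex.I (1 / 2)} :=
    (Metric.isOpen_ball.preimage continuous_coe).measurableSet
  have h1 := (tendsto_integral_near (s := s) (by linarith) hh).add
    (tendsto_integral_far hσ hs hC)
  rw [add_zero] at h1
  refine h1.congr' ?_
  filter_upwards [self_mem_nhdsWithin] with δ hδ
  have hδ0 : 0 < δ := hδ
  rw [← setIntegral_near, integral_add_compl hA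
    (integrable_shiftKernel hσ hs hh hC (by positivity : 0 < δ ^ 2))]

/-- The majorant decreases in u, so its value at u dominates all the shifted kernels. -/
theorem tendsto_integral_shift_green (hσ : 0 ≤ σ) (hs : 1 + σ < s.re) (z : ℍ) {h : ℍ → V}
    (hh : Continuous h) (hC : ∀ w, ‖h w‖ ≤ C * growth σ w) :
    Tendsto (fun δ : ℝ => ∫ w : ℍ, green s (pointPair z w + δ ^ 2) • h w) (𝓝[>] 0)
      (𝓝 (∫ w : ℍ, green s (pointPair z w) • h w)) := by
  refine tendsto_integral_filter_of_dominated_convergence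
    (fun w => C * (greenMajorant s.re (pointPair z w) * growth σ w)) ?_ ?_
    ((integrable_greenMajorant hσ hs z).const_mul C) ?_
  · refine Eventually.of_forall fun δ => ?_
    exact ((measurable_green s).comp
      ((continuous_pointPair_left z).add continuous_const).measurable).aestronglyMeasurable.smul
      hh.aestronglyMeasurable
  · filter_upwards [self_mem_nhdsWithin] with δ hδ
    have hδ0 : 0 < δ := hδ
    filter_upwards [ae_pointPair_pos z] with w hw
    have hU : 0 < pointPair z w + δ ^ 2 := by positivity
    have hk : ‖green s (pointPair z w + δ ^ 2)‖ ≤ greenMajorant s.re (pointPair z w) := by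
      refine (norm_green_le (by linarith) hU).trans ?_
      have e1 : (pointPair z w + δ ^ 2) ^ (-(1 / 2) : ℝ) ≤ pointPair z w ^ (-(1 / 2) : ℝ) :=
        Real.rpow_le_rpow_of_nonpos hw (by linarith [sq_nonneg δ]) (by norm_num)
      have e2 : (1 + (pointPair z w + δ ^ 2)) ^ (1 / 2 - s.re) ≤
          (1 + pointPair z w) ^ (1 / 2 - s.re) :=
        Real.rpow_le_rpow_of_nonpos (by linarith) (by linarith [sq_nonneg δ]) (by linarith)
      exact mul_le_mul e1 e2 (by positivity) (by positivity)
    rw [norm_smul]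
    calc _ ≤ greenMajorant s.re (pointPair z w) * (C * growth σ w) :=
          mul_le_mul hk (hC w) (norm_nonneg _) ((norm_nonneg _).trans hk)
      _ = _ := by ring
  · filter_upwards [ae_pointPair_pos z] with w hw
    refine Tendsto.smul_const ?_ _
    have hc : ContinuousAt (green s) (pointPair z w) :=
      (contDiffAt_green (n := 0) (by linarith) (WithTop.coe_le_coe.2 le_top) hw).continuousAt
    have hl : Tendsto (fun δ : ℝ => pointPair z w + δ ^ 2) (𝓝[>] 0) (𝓝 (pointPair z w)) := by
      have : Continuous fun δ : ℝ => pointPair z w + δ ^ 2 := by fun_prop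
      have h2 := this.tendsto 0
      simp only [ne_eq, OfNat.ofNat_ne_zero, not_false_eq_true, zero_pow, add_zero] at h2
      exact h2.mono_left nhdsWithin_le_nhds
    exact hc.tendsto.comp hl

/-- The Green function inverts `Δ + s (1 - s)` on functions of moderate growth. -/
theorem integral_green_smul_helmholtz [CompleteSpace V] {C' : ℝ} (hσ : 0 ≤ σ)
    (hs : 1 + σ < s.re) (z : ℍ) {h : ℍ → V} (hh : ContMDiff 𝓘(ℝ, ℂ) 𝓘(ℝ, V) 2 h)
    (hC : ∀ w, ‖h w‖ ≤ C * growth σ w) (hC' : ∀ w, ‖helmholtz s h w‖ ≤ C' * growth σ w) :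
    ∫ w, green s (pointPair z w) • helmholtz s h w = -h z := by
  have hs1 : 1 < s.re := by linarith
  have l1 := tendsto_integral_shift_green hσ hs z (continuous_helmholtz s hh) hC'
  -- The approximate identity was set up at `I`; it is applied to the translate of h, whose growth
  -- constant becomes C times the weight at z.
  have hg : Continuous fun w => h (z.toSL2R • w) := hh.continuous.comp (continuous_const_smul _)
  have hgC : ∀ w, ‖h (z.toSL2R • w)‖ ≤ (C * growth σ z) * growth σ w := fun w => by
    have hC0 : 0 ≤ C := by
      have := (norm_nonneg _).trans (hC I)
      exact nonneg_of_mul_nonneg_left this (growth_pos σ I)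
    calc _ ≤ C * growth σ (z.toSL2R • w) := hC _
      _ ≤ C * (growth σ z * growth σ w) := by gcongr; exact growth_toSL2R_smul_le σ z w
      _ = _ := by ring
  have l2 := tendsto_integral_shiftKernel hσ hs hg hgC
  rw [toSL2R_smul_I] at l2
  refine tendsto_nhds_unique l1 (l2.congr' ?_)
  filter_upwards [self_mem_nhdsWithin] with δ hδ
  have hε : 0 < δ ^ 2 := by
    have : 0 < δ := hδ
    positivity
  obtain ⟨D, hD⟩ := exists_shift_green_bound hs1 hε
  have e := integral_decay_smul_helmholtz hσ hs s (k := fun u => green s (u + δ ^ 2))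
    (contDiffAt_shift_green hs1 hε) (fun u hu => (hD u hu).1)
    (fun u hu => by rw [deriv_shift_green]; exact (hD u hu).2.1)
    (fun u hu => by rw [deriv_deriv_shift_green]; exact (hD u hu).2.2) z hh hC hC'
  rw [e]
  have e2 : ∀ w, radialHelmholtz s (fun u => green s (u + δ ^ 2)) (pointPair z w) =
      shiftKernel s (δ ^ 2) (pointPair z w) := fun w =>
    radialHelmholtz_shift_green hs1 (by have := pointPair_nonneg z w; linarith)
  simp only [e2]
  have e3 := integral_toSL2R_smul z
    (fun w : ℍ => shiftKernel s (δ ^ 2) (pointPair z w) • h w)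
  rw [← e3]
  simp only [pointPair_toSL2R]

end ApproximateIdentity

/-! ### Smooth dependence of integrals on a parameter. -/

section ParametricIntegral

/-- The integral is a convolution with a parameter-dependent, smooth, compactly supported function,
evaluated at 0, so smoothness follows from that of such convolutions. The factor a need only be
integrable: all regularity is put on M, whose support in w lies in one compact set for all p. -/
theorem contDiffOn_integral_uhp {W E F : Type*} [NormedAddCommGroup W] [NormedSpace ℝ W]
    [NormedAddCommGroup E] [NormedSpace ℝ E] [NormedAddCommGroup F] [NormedSpace ℝ F]
    {n : ℕ∞} (L : W →L[ℝ] E →L[ℝ] F) {a : ℍ → W} (ha : Integrable a) {M : ℂ → ℍ → E} {S : Set ℂ}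
    (hS : IsOpen S) {K : Set ℍ} (hK : IsCompact K) (hM0 : ∀ p ∈ S, ∀ w ∉ K, M p w = 0)
    (hM : ∀ p ∈ S, ∀ ζ : ℂ, 0 < ζ.im →
      ContDiffAt ℝ n (fun q : ℂ × ℂ => M q.1 (ofComplex q.2)) (p, ζ)) :
    ContDiffOn ℝ n (fun p => ∫ w : ℍ, L (a w) (M p w)) S := by
  classical
  set U : Set ℂ := {ζ : ℂ | 0 < ζ.im} with hU
  set b : ℂ → W := U.indicator fun ζ => (1 / ζ.im ^ 2) • a (ofComplex ζ)
  have hb : Integrable b := ((integrable_uhp a).1 ha).integrable_indicator isOpen_im_pos.measurableSet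
  set K' : Set ℂ := ((↑) : ℍ → ℂ) '' K with hK'
  have hKc : IsCompact K' := hK.image continuous_coe
  -- The sign change makes the convolution at 0 equal to the integral of b(ζ) against M(p, ζ).
  set g : ℂ → ℂ → E := fun p τ => if 0 < (-τ).im then M p (ofComplex (-τ)) else 0
  have hg0 : ∀ p τ, p ∈ S → -τ ∉ K' → g p τ = 0 := by
    intro p τ hp hτ
    simp only [g]
    split_ifs with h
    · refine hM0 p hp _ fun hmem => hτ ⟨_, hmem, ?_⟩
      rw [ofComplex_apply_of_im_pos h]
    · rfl
  have hgs : ContDiffOn ℝ n (Function.uncurry g) (S ×ˢ Set.univ) := by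
    rintro ⟨p, τ⟩ ⟨hp, -⟩
    refine ContDiffAt.contDiffWithinAt ?_
    by_cases h : 0 < (-τ).im
    · have e : Function.uncurry g =ᶠ[𝓝 (p, τ)]
          (fun q : ℂ × ℂ => M q.1 (ofComplex q.2)) ∘ fun q : ℂ × ℂ => (q.1, -q.2) := by
        have hc : Continuous fun q : ℂ × ℂ => (-q.2).im := by fun_prop
        filter_upwards [(isOpen_lt continuous_const hc).mem_nhds h] with q hq
        exact if_pos hq
      refine ContDiffAt.congr_of_eventuallyEq ?_ e
      exact ContDiffAt.comp (p, τ) (hM p hp (-τ) h)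
        (contDiffAt_fst.prodMk contDiffAt_snd.neg)
    · have hn : -τ ∉ K' := by
        rintro ⟨w, -, hw⟩
        exact h (hw ▸ w.im_pos)
      have e : Function.uncurry g =ᶠ[𝓝 (p, τ)] fun _ => 0 := by
        have hc : Continuous fun q : ℂ × ℂ => -q.2 := by fun_prop
        filter_upwards [(hS.preimage continuous_fst).mem_nhds hp,
          (hKc.isClosed.isOpen_compl.preimage hc).mem_nhds hn] with q hq1 hq2
        exact hg0 q.1 q.2 hq1 hq2
      exact contDiffAt_const.congr_of_eventuallyEq e
  have main := contDiffOn_convolution_right_with_param_comp (μ := volume) L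
    (v := fun _ : ℂ => (0 : ℂ)) contDiffOn_const hS (hKc.neg) (g := g)
    (fun p τ hp hτ => hg0 p τ hp (by simpa using hτ)) hb.locallyIntegrable hgs
  refine main.congr fun p hp => ?_
  rw [integral_uhp, ← integral_indicator isOpen_im_pos.measurableSet, convolution]
  refine integral_congr_ae (ae_of_all _ fun ζ => ?_)
  by_cases h : ζ ∈ U
  · have h' : 0 < ζ.im := h
    simp only [Set.indicator_of_mem (show ζ ∈ {ζ : ℂ | 0 < ζ.im} from h), b, Set.indicator_of_mem h,
      g, zero_sub, neg_neg, if_pos h', map_smul, smul_apply]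
  · simp only [Set.indicator_of_notMem (show ζ ∉ {ζ : ℂ | 0 < ζ.im} from h), b,
      Set.indicator_of_notMem h, map_zero, zero_apply]

end ParametricIntegral

/-! ### Near and far parts of the Green function. -/

section Parametrix

variable {s : ℂ}

/-- The part of the Green function away from the diagonal. -/
def greenFar (s : ℂ) (u : ℝ) : ℂ := ((1 - cutoff u : ℝ) : ℂ) * green s u

/-- The part of the Green function near the diagonal. -/
def greenNear (s : ℂ) (u : ℝ) : ℂ := (cutoff u : ℂ) * green s u

theorem greenFar_of_le {u : ℝ} (hu : u ≤ 1) : greenFar s u = 0 := by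
  rw [greenFar, cutoff_of_le hu]
  simp

theorem greenNear_of_ge {u : ℝ} (hu : 2 ≤ u) : greenNear s u = 0 := by
  rw [greenNear, cutoff_of_ge hu]
  simp

theorem greenNear_add_greenFar (s : ℂ) (u : ℝ) : greenNear s u + greenFar s u = green s u := by
  rw [greenNear, greenFar]
  push_cast
  ring

/-- It vanishes for u ≤ 1, so the singularity at 0 plays no role. -/
theorem contDiff_greenFar (hs : 1 < s.re) : ContDiff ℝ ∞ (greenFar s) := by
  rw [contDiff_iff_contDiffAt]
  intro u
  rcases lt_or_ge u 1 with hu | hu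
  · have e : greenFar s =ᶠ[𝓝 u] fun _ => 0 := by
      filter_upwards [gt_mem_nhds hu] with x hx using greenFar_of_le hx.le
    exact contDiffAt_const.congr_of_eventuallyEq e
  · have h1 : ContDiff ℝ ∞ fun u : ℝ => ((1 - cutoff u : ℝ) : ℂ) :=
      Complex.ofRealCLM.contDiff.comp (contDiff_const.sub (contDiff_cutoff (n := ⊤)))
    exact h1.contDiffAt.mul (contDiffAt_green hs le_rfl (by linarith))

theorem norm_greenFar_le (hs : 1 < s.re) (u : ℝ) : ‖greenFar s u‖ ≤ 2 := by
  rcases le_total u 1 with hu | hu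
  · rw [greenFar_of_le hu, norm_zero]
    norm_num
  · rw [greenFar, norm_mul, Complex.norm_real]
    have h1 : ‖1 - cutoff u‖ ≤ 2 := by
      have := abs_cutoff_le u
      rw [abs_le] at this
      rw [Real.norm_eq_abs, abs_le]
      constructor <;> linarith
    have h2 : ‖green s u‖ ≤ 1 := by
      refine (norm_green_le hs (by linarith)).trans ?_
      refine mul_le_one₀ (Real.rpow_le_one_of_one_le_of_nonpos hu (by norm_num)) (by positivity)
        (Real.rpow_le_one_of_one_le_of_nonpos (by linarith) (by linarith))
    calc _ ≤ (2 : ℝ) * 1 := mul_le_mul h1 h2 (norm_nonneg _) (by norm_num)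
      _ = 2 := by norm_num

/-- The defect of `greenFar` as a solution of the radial equation. -/
def transitionKernel (s : ℂ) (u : ℝ) : ℂ := -radialHelmholtz s (greenFar s) u

theorem contDiff_transitionKernel (hs : 1 < s.re) : ContDiff ℝ ∞ (transitionKernel s) := by
  have h0 := contDiff_greenFar hs
  have h1 : ContDiff ℝ ∞ (deriv (greenFar s)) := (contDiff_infty_iff_deriv.1 h0).2
  have h2 : ContDiff ℝ ∞ (deriv (deriv (greenFar s))) := (contDiff_infty_iff_deriv.1 h1).2
  have p1 : ContDiff ℝ ∞ fun u : ℝ => ((u * (u + 1) : ℝ) : ℂ) :=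
    Complex.ofRealCLM.contDiff.comp (contDiff_id.mul (contDiff_id.add contDiff_const))
  have p2 : ContDiff ℝ ∞ fun u : ℝ => ((2 * u + 1 : ℝ) : ℂ) :=
    Complex.ofRealCLM.contDiff.comp ((contDiff_const.mul contDiff_id).add contDiff_const)
  exact (((p1.mul h2).add (p2.mul h1)).add (contDiff_const.mul h0)).neg

theorem transitionKernel_of_lt {u : ℝ} (hu : u < 1) : transitionKernel s u = 0 := by
  have e : greenFar s =ᶠ[𝓝 u] fun _ => 0 := by
    filter_upwards [gt_mem_nhds hu] with x hx using greenFar_of_le hx.le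
  rw [transitionKernel, radialHelmholtz_congr s e]
  simp [radialHelmholtz]

/-- Beyond the cutoff the far part is the Green function itself, a solution. Together with
`transitionKernel_of_lt` this confines the kernel to [1, 2]. -/
theorem transitionKernel_of_gt (hs : 1 < s.re) {u : ℝ} (hu : 2 < u) : transitionKernel s u = 0 := by
  have e : greenFar s =ᶠ[𝓝 u] green s := by
    filter_upwards [lt_mem_nhds hu] with x hx
    rw [greenFar, cutoff_of_ge (le_of_lt hx)]
    simp
  rw [transitionKernel, radialHelmholtz_congr s e, radialHelmholtz_green hs (by linarith), neg_zero]

theorem exists_transitionKernel_bound (hs : 1 < s.re) : ∃ C, ∀ u, ‖transitionKernel s u‖ ≤ C := by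
  refine (contDiff_transitionKernel hs).continuous.bounded_above_of_compact_support ?_
  refine HasCompactSupport.intro (isCompact_Icc (a := (1 : ℝ)) (b := 2)) fun u hu => ?_
  rw [Set.mem_Icc, not_and_or, not_le, not_le] at hu
  rcases hu with hu | hu
  · exact transitionKernel_of_lt hu
  · exact transitionKernel_of_gt hs hu

/-- The inversion formula for the bounded function w ↦ F(u(z,w)) with F the far part, with growth
exponent σ = 0; the operator maps it to minus the transition kernel. -/
theorem integral_green_mul_transitionKernel (hs : 1 < s.re) (z w' : ℍ) :
    ∫ w, green s (pointPair w' w) * transitionKernel s (pointPair z w) =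
      greenFar s (pointPair z w') := by
  obtain ⟨C, hC⟩ := exists_transitionKernel_bound hs
  have hfar : ∀ u, 0 ≤ u → ContDiffAt ℝ 2 (greenFar s) u := fun u _ =>
    ((contDiff_greenFar hs).of_le (WithTop.coe_le_coe.2 le_top)).contDiffAt
  have hC0 : 0 ≤ C := (norm_nonneg _).trans (hC 0)
  have key := integral_green_smul_helmholtz (s := s) (σ := 0) le_rfl (by linarith) w'
    (h := fun w => greenFar s (pointPair z w)) (C := 2) (C' := C)
    (contMDiff_comp_pointPair hfar z)
    (fun w => (norm_greenFar_le hs _).trans (by linarith [one_le_growth le_rfl w]))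
    (fun w => by
      rw [helmholtz_comp_pointPair s hfar, ← norm_neg]
      exact (hC _).trans (le_mul_of_one_le_right hC0 (one_le_growth le_rfl w)))
  simp only [helmholtz_comp_pointPair s hfar, smul_eq_mul] at key
  simp only [transitionKernel, mul_neg, integral_neg, key, neg_neg]

end Parametrix

/-! ### Growth of the resolvent, and its transpose. -/

section Fubini

variable {V : Type*} [NormedAddCommGroup V] [NormedSpace ℂ V] {s : ℂ} {σ C : ℝ}

theorem integral_norm_green_smul_le (hσ : 0 ≤ σ) (hs : 1 + σ < s.re) {f : ℍ → V}
    (hf : Continuous f) (hC : ∀ w, ‖f w‖ ≤ C * growth σ w) (z : ℍ) :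
    ∫ w, ‖green s (pointPair z w) • f w‖ ≤
      C * (∫ w : ℍ, greenMajorant s.re (pointPair I w) * growth σ w) * growth σ z := by
  have hC0 : 0 ≤ C := by
    have := (norm_nonneg _).trans (hC I)
    exact nonneg_of_mul_nonneg_left this (growth_pos _ _)
  calc _ ≤ ∫ w, C * (greenMajorant s.re (pointPair z w) * growth σ w) := by
        refine integral_mono_ae (integrable_green_smul hσ hs z hf hC).norm
          ((integrable_greenMajorant hσ hs z).const_mul C) ?_
        filter_upwards [ae_pointPair_pos z] with w hw
        simp only [norm_smul]
        calc _ ≤ greenMajorant s.re (pointPair z w) * (C * growth σ w) :=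
              mul_le_mul (norm_green_le (by linarith) hw) (hC w) (norm_nonneg _)
                (greenMajorant_nonneg _ hw.le)
          _ = _ := by ring
    _ = C * ∫ w, greenMajorant s.re (pointPair z w) * growth σ w := integral_const_mul _ _
    _ ≤ C * ((∫ w : ℍ, greenMajorant s.re (pointPair I w) * growth σ w) * growth σ z) :=
        mul_le_mul_of_nonneg_left (integral_greenMajorant_le hσ hs z) hC0
    _ = _ := by ring

/-- The resolvent preserves the growth class, which makes R_s f admissible under the transition
kernel. -/
theorem norm_resolvent_le (hσ : 0 ≤ σ) (hs : 1 + σ < s.re) {f : ℍ → V}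
    (hf : Continuous f) (hC : ∀ w, ‖f w‖ ≤ C * growth σ w) (z : ℍ) :
    ‖resolvent s f z‖ ≤
      C * (∫ w : ℍ, greenMajorant s.re (pointPair I w) * growth σ w) * growth σ z := by
  rw [resolvent, norm_neg]
  exact (norm_integral_le_integral_norm _).trans (integral_norm_green_smul_le hσ hs hf hC z)

theorem stronglyMeasurable_green_smul (s : ℂ) {f : ℍ → V} (hf : Continuous f) :
    StronglyMeasurable (fun q : ℍ × ℍ => green s (pointPair q.1 q.2) • f q.2) :=
  ((measurable_green s).comp continuous_pointPair.measurable).stronglyMeasurable.smul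
    (hf.comp continuous_snd).stronglyMeasurable

theorem stronglyMeasurable_resolvent (s : ℂ) {f : ℍ → V} (hf : Continuous f) :
    StronglyMeasurable (resolvent s f) :=
  (stronglyMeasurable_green_smul s hf).integral_prod_right'.neg

/-- Fubini: φ has compact support, and the inner integral of norms is bounded by a multiple of the
growth weight. The symmetry of u then moves the Green function onto φ. -/
theorem integral_smul_resolvent [CompleteSpace V] (hσ : 0 ≤ σ) (hs : 1 + σ < s.re) {f : ℍ → V}
    (hf : Continuous f) (hC : ∀ w, ‖f w‖ ≤ C * growth σ w) {φ : ℍ → ℂ} (hφ : Continuous φ)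
    (hφc : HasCompactSupport φ) :
    ∫ z, φ z • resolvent s f z = -∫ w, (∫ z, green s (pointPair w z) * φ z) • f w := by
  have hmeas : StronglyMeasurable
      (fun q : ℍ × ℍ => φ q.1 • green s (pointPair q.1 q.2) • f q.2) :=
    (hφ.comp continuous_fst).stronglyMeasurable.smul (stronglyMeasurable_green_smul s hf)
  have hint : Integrable (fun q : ℍ × ℍ => φ q.1 • green s (pointPair q.1 q.2) • f q.2)
      (volume.prod volume) := by
    rw [integrable_prod_iff hmeas.aestronglyMeasurable]
    refine ⟨ae_of_all _ fun z => (integrable_green_smul hσ hs z hf hC).smul (φ z), ?_⟩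
    have hdom : Integrable (fun z : ℍ => ‖φ z‖ *
        (C * (∫ w : ℍ, greenMajorant s.re (pointPair I w) * growth σ w) * growth σ z)) := by
      refine Continuous.integrable_of_hasCompactSupport
        (hφ.norm.mul (continuous_const.mul (continuous_growth σ))) ?_
      exact hφc.norm.mul_right
    refine hdom.mono' hmeas.norm.integral_prod_right'.aestronglyMeasurable
      (ae_of_all _ fun z => ?_)
    rw [Real.norm_of_nonneg (integral_nonneg fun _ => norm_nonneg _)]
    simp only [norm_smul (φ z), integral_const_mul]
    exact mul_le_mul_of_nonneg_left (integral_norm_green_smul_le hσ hs hf hC z) (norm_nonneg _)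
  have hswap := integral_integral_swap
    (f := fun z w => φ z • green s (pointPair z w) • f w) hint
  simp only [integral_smul] at hswap
  simp only [resolvent, smul_neg, integral_neg, neg_inj]
  rw [hswap]
  refine integral_congr_ae (ae_of_all _ fun w => ?_)
  simp only [smul_smul]
  rw [integral_smul_const]
  congr 1
  refine integral_congr_ae (ae_of_all _ fun z => ?_)
  simp only
  rw [pointPair_comm w z, mul_comm]

end Fubini

/-! ### Smoothness of the resolvent. -/

section Smoothness

variable {V : Type*} [NormedAddCommGroup V] [NormedSpace ℂ V] {s : ℂ} {σ C : ℝ}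

/-- `1 + 2 u` is submultiplicative up to the factor two. -/
theorem one_add_pointPair_le (z₀ z w : ℍ) :
    1 + 2 * pointPair z₀ w ≤ 2 * (1 + 2 * pointPair z₀ z) * (1 + 2 * pointPair z w) := by
  have e : ∀ a b : ℍ, 1 + 2 * pointPair a b = Real.cosh (dist a b) := fun a b => by
    rw [pointPair_eq_cosh]
    ring
  rw [e, e, e]
  have h : Real.cosh (dist z₀ w) ≤ Real.cosh (dist z₀ z + dist z w) := by
    rw [Real.cosh_le_cosh, abs_of_nonneg dist_nonneg, abs_of_nonneg (by positivity)]
    exact dist_triangle _ _ _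
  refine h.trans ?_
  rw [Real.cosh_add]
  have h1 := Real.sinh_lt_cosh (dist z₀ z)
  have h2 := Real.sinh_lt_cosh (dist z w)
  have h3 : 0 ≤ Real.sinh (dist z w) := Real.sinh_nonneg_iff.2 dist_nonneg
  have h4 := Real.cosh_pos (dist z₀ z)
  nlinarith

theorem contDiffAt_pointPair_prod {n : WithTop ℕ∞} {p ζ : ℂ} (hp : 0 < p.im) (hζ : 0 < ζ.im) :
    ContDiffAt ℝ n (fun q : ℂ × ℂ => pointPair (ofComplex q.1) (ofComplex q.2)) (p, ζ) := by
  have h1 : ContDiff ℝ n Complex.re := Complex.reCLM.contDiff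
  have h2 : ContDiff ℝ n Complex.im := Complex.imCLM.contDiff
  have e : (fun q : ℂ × ℂ => pointPair (ofComplex q.1) (ofComplex q.2)) =ᶠ[𝓝 (p, ζ)]
      fun q => ((q.2.re - q.1.re) ^ 2 + (q.2.im - q.1.im) ^ 2) / (4 * q.1.im * q.2.im) := by
    filter_upwards [(isOpen_im_pos.preimage continuous_fst).mem_nhds hp,
      (isOpen_im_pos.preimage continuous_snd).mem_nhds hζ] with q hq1 hq2
    rw [pointPair_eq, ofComplex_apply_of_im_pos hq1, ofComplex_apply_of_im_pos hq2]
    rfl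
  refine ContDiffAt.congr_of_eventuallyEq ?_ e
  have r1 := h1.comp (contDiff_fst (𝕜 := ℝ) (E := ℂ) (F := ℂ))
  have r2 := h1.comp (contDiff_snd (𝕜 := ℝ) (E := ℂ) (F := ℂ))
  have i1 := h2.comp (contDiff_fst (𝕜 := ℝ) (E := ℂ) (F := ℂ))
  have i2 := h2.comp (contDiff_snd (𝕜 := ℝ) (E := ℂ) (F := ℂ))
  refine ContDiffAt.div ?_ ?_ (by positivity)
  · exact (((r2.sub r1).pow 2).add ((i2.sub i1).pow 2)).contDiffAt
  · exact ((contDiff_const.mul i1).mul i2).contDiffAt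

/-- The regularizing half of the parametrix: v is only measurable, and the whole z-dependence sits
in a smooth kernel. -/
theorem contMDiff_integral_transitionKernel_smul (hs : 1 < s.re) {v : ℍ → V}
    (hv : StronglyMeasurable v) (hC : ∀ w, ‖v w‖ ≤ C * growth σ w) :
    ContMDiff 𝓘(ℝ, ℂ) 𝓘(ℝ, V) ∞
      (fun z => ∫ w, transitionKernel s (pointPair z w) • v w) := by
  rw [contMDiff_real_iff]
  intro ζ₀ hζ₀
  set z₀ : ℍ := ofComplex ζ₀ with hz₀
  -- If u(z₀,p) < 1 and u(p,w) ≤ 2, quasi-submultiplicativity gives 1 + 2u(z₀,w) < 2·3·5 = 30, so w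
  -- lies in K.
  set K : Set ℍ := {w | pointPair z₀ w ≤ 15}
  have hK : IsCompact K := isCompact_pointPair_le z₀ 15
  have hKm : MeasurableSet K := hK.isClosed.measurableSet
  have hint : Integrable (K.indicator v) := by
    rw [integrable_indicator_iff hKm]
    refine Integrable.mono' (g := fun w => C * growth σ w) ?_
      hv.aestronglyMeasurable.restrict (ae_of_all _ hC)
    exact ((continuous_const.mul (continuous_growth σ)).continuousOn).integrableOn_compact hK
  set S : Set ℂ := {ζ : ℂ | 0 < ζ.im ∧ pointPairC z₀ ζ < 1}
  have hS : IsOpen S := by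
    rw [isOpen_iff_mem_nhds]
    rintro ζ ⟨h1, h2⟩
    have hc : ContinuousAt (pointPairC z₀) ζ := (contDiffAt_pointPairC (n := 0) z₀ h1).continuousAt
    filter_upwards [isOpen_im_pos.mem_nhds h1, hc.eventually (gt_mem_nhds h2)] with x a b
    exact ⟨a, b⟩
  have hζS : ζ₀ ∈ S := by
    refine ⟨hζ₀, ?_⟩
    rw [← pointPair_ofComplex z₀ hζ₀, ← hz₀]
    simp [pointPair]
  have hM0 : ∀ p ∈ S, ∀ w ∉ K, transitionKernel s (pointPair (ofComplex p) w) = 0 := by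
    rintro p ⟨hp, hp1⟩ w hw
    rw [← pointPair_ofComplex z₀ hp] at hp1
    refine transitionKernel_of_gt hs ?_
    have h15 : 15 < pointPair z₀ w := not_le.1 hw
    have := one_add_pointPair_le z₀ (ofComplex p) w
    have h0 := pointPair_nonneg (ofComplex p) w
    have h0' := pointPair_nonneg z₀ (ofComplex p)
    nlinarith
  have key := contDiffOn_integral_uhp (n := ⊤) (ContinuousLinearMap.lsmul ℝ ℂ (E := V)).flip hint
    hS hK (M := fun p w => transitionKernel s (pointPair (ofComplex p) w)) hM0
    (fun p hp ζ hζ => ContDiffAt.comp (g := transitionKernel s) (p, ζ)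
      (contDiff_transitionKernel hs).contDiffAt (contDiffAt_pointPair_prod hp.1 hζ))
  refine (key.contDiffAt (hS.mem_nhds hζS)).congr_of_eventuallyEq ?_
  filter_upwards [hS.mem_nhds hζS] with p hp
  refine integral_congr_ae (ae_of_all _ fun w => ?_)
  simp only [ContinuousLinearMap.flip_apply, ContinuousLinearMap.lsmul_apply]
  by_cases hw : w ∈ K
  · rw [Set.indicator_of_mem hw]
  · rw [hM0 p hp w hw, zero_smul, zero_smul]

theorem integrable_greenNear (hs : 1 < s.re) (z : ℍ) :
    Integrable (fun w => greenNear s (pointPair z w)) := by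
  have h := integrable_kernel_smul (σ := 0) (ρ := s.re) (C := 1) (D := 1) le_rfl (by linarith) z
    (k := greenNear s) ?_ ?_ (h := fun _ => (1 : ℂ)) continuous_const (fun w => ?_)
  · simpa using h
  · exact (Complex.continuous_ofReal.comp (contDiff_cutoff (n := 0)).continuous).measurable.mul
      (measurable_green s)
  · intro u hu
    rw [one_mul, greenNear, norm_mul, Complex.norm_real]
    exact (mul_le_of_le_one_left (norm_nonneg _) (abs_cutoff_le u)).trans (norm_green_le hs hu)
  · rw [norm_one, one_mul]
    exact one_le_growth le_rfl w

/-- The kernel is singular, so it must not be differentiated. The substitution w ↦ x + y w fixes it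
at `I` and puts the dependence on z = x + iy into f, which is smooth. -/
theorem contMDiff_integral_greenNear_smul (hs : 1 < s.re) {f : ℍ → V}
    (hf : ContMDiff 𝓘(ℝ, ℂ) 𝓘(ℝ, V) ∞ f) :
    ContMDiff 𝓘(ℝ, ℂ) 𝓘(ℝ, V) ∞ (fun z => ∫ w, greenNear s (pointPair z w) • f w) := by
  have hf' := contMDiff_real_iff.1 hf
  rw [contMDiff_real_iff]
  intro ζ₀ hζ₀
  set K : Set ℍ := {w | pointPair I w ≤ 4}
  -- The near kernel lives on u ≤ 2, where the extra cutoff in u/2 equals 1; that cutoff vanishes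
  -- for u ≥ 4 and supplies the compact support in w.
  set M : ℂ → ℍ → V := fun p w => ((cutoff (pointPair I w / 2) : ℝ) : ℂ) •
    f (ofComplex (p.re + p.im * (w : ℂ)))
  have hM0 : ∀ p ∈ {ζ : ℂ | 0 < ζ.im}, ∀ w ∉ K, M p w = 0 := by
    intro p _ w hw
    have h4 : 4 < pointPair I w := not_le.1 hw
    simp only [M]
    rw [cutoff_of_ge (by linarith), Complex.ofReal_zero, zero_smul]
  have hM : ∀ p ∈ {ζ : ℂ | 0 < ζ.im}, ∀ ζ : ℂ, 0 < ζ.im →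
      ContDiffAt ℝ ∞ (fun q : ℂ × ℂ => M q.1 (ofComplex q.2)) (p, ζ) := by
    intro p hp ζ hζ
    have hp' : 0 < p.im := hp
    have h1 : ContDiff ℝ ∞ Complex.re := Complex.reCLM.contDiff
    have h2 : ContDiff ℝ ∞ Complex.im := Complex.imCLM.contDiff
    have h3 : ContDiff ℝ ∞ ((↑) : ℝ → ℂ) := Complex.ofRealCLM.contDiff
    set N : ℂ × ℂ → V := fun q => ((cutoff (pointPairC I q.2 / 2) : ℝ) : ℂ) •
      f (ofComplex ((q.1.re : ℂ) + (q.1.im : ℂ) * q.2))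
    have e : (fun q : ℂ × ℂ => M q.1 (ofComplex q.2)) =ᶠ[𝓝 (p, ζ)] N := by
      filter_upwards [(isOpen_im_pos.preimage continuous_snd).mem_nhds hζ] with q hq
      simp only [M, N]
      rw [pointPair_ofComplex I hq, ofComplex_apply_of_im_pos hq]
    refine ContDiffAt.congr_of_eventuallyEq ?_ e
    refine ContDiffAt.smul ?_ ?_
    · have hc : ContDiffAt ℝ ∞ (fun q : ℂ × ℂ => pointPairC I q.2) (p, ζ) :=
        ContDiffAt.comp (g := pointPairC I) (p, ζ) (contDiffAt_pointPairC I hζ) contDiffAt_snd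
      exact (h3.comp (contDiff_cutoff (n := ⊤))).contDiffAt.comp (p, ζ) (hc.div_const 2)
    · refine ContDiffAt.comp (g := fun ζ : ℂ => f (ofComplex ζ)) (p, ζ)
        (f := fun q : ℂ × ℂ => (q.1.re : ℂ) + (q.1.im : ℂ) * q.2) (hf' _ ?_) ?_
      · simp only [Complex.add_im, Complex.ofReal_im, Complex.im_ofReal_mul, zero_add]
        positivity
      · exact ((h3.comp (h1.comp contDiff_fst)).add
          ((h3.comp (h2.comp contDiff_fst)).mul contDiff_snd)).contDiffAt
  have key := contDiffOn_integral_uhp (n := ⊤) (ContinuousLinearMap.lsmul ℝ ℂ (E := V))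
    (integrable_greenNear hs I) isOpen_im_pos (isCompact_pointPair_le I 4) hM0 hM
  refine (key.contDiffAt (isOpen_im_pos.mem_nhds hζ₀)).congr_of_eventuallyEq ?_
  filter_upwards [isOpen_im_pos.mem_nhds hζ₀] with p hp
  rw [← integral_toSL2R_smul (ofComplex p)]
  refine integral_congr_ae (ae_of_all _ fun w => ?_)
  simp only [ContinuousLinearMap.lsmul_apply, M, pointPair_toSL2R]
  rcases le_total (pointPair I w) 2 with h | h
  · rw [cutoff_of_le (by linarith), Complex.ofReal_one, one_smul]
    congr 2
    have e1 := coe_toSL2R_smul (ofComplex p) w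
    rw [← ofComplex_apply ((ofComplex p).toSL2R • w), e1, ofComplex_apply_of_im_pos hp]
    rfl
  · rw [greenNear_of_ge h, zero_smul, zero_smul]

theorem integrable_greenNear_smul (hσ : 0 ≤ σ) (hs : 1 + σ < s.re) {f : ℍ → V}
    (hf : Continuous f) (hC : ∀ w, ‖f w‖ ≤ C * growth σ w) (z : ℍ) :
    Integrable (fun w => greenNear s (pointPair z w) • f w) := by
  refine integrable_kernel_smul (D := 1) hσ hs z ?_ ?_ hf hC
  · exact (Complex.continuous_ofReal.comp (contDiff_cutoff (n := 0)).continuous).measurable.mul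
      (measurable_green s)
  · intro u hu
    rw [one_mul, greenNear, norm_mul, Complex.norm_real]
    exact (mul_le_of_le_one_left (norm_nonneg _) (abs_cutoff_le u)).trans
      (norm_green_le (by linarith) hu)

theorem integral_green_smul_eq_add (hσ : 0 ≤ σ) (hs : 1 + σ < s.re) {f : ℍ → V}
    (hf : Continuous f) (hC : ∀ w, ‖f w‖ ≤ C * growth σ w) (z : ℍ) :
    ∫ w, green s (pointPair z w) • f w =
      (∫ w, greenNear s (pointPair z w) • f w) + ∫ w, greenFar s (pointPair z w) • f w := by
  have hnear := integrable_greenNear_smul hσ hs hf hC z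
  have e : ∀ w, greenFar s (pointPair z w) • f w =
      green s (pointPair z w) • f w - greenNear s (pointPair z w) • f w := fun w => by
    rw [← sub_smul, ← greenNear_add_greenFar, add_sub_cancel_left]
  simp only [e]
  rw [integral_sub (integrable_green_smul hσ hs z hf hC) hnear, add_sub_cancel]

theorem hasCompactSupport_transitionKernel (hs : 1 < s.re) (z : ℍ) :
    HasCompactSupport fun w => transitionKernel s (pointPair z w) := by
  refine HasCompactSupport.intro (isCompact_pointPair_le z 2) fun w hw => ?_
  exact transitionKernel_of_gt hs (not_le.1 hw)

/-- The transition kernel applied to R_s f is minus the far part applied to f, by Fubini and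
`integral_green_mul_transitionKernel`; the near part makes up the difference. -/
theorem resolvent_eq_parametrix [CompleteSpace V] (hσ : 0 ≤ σ) (hs : 1 + σ < s.re) {f : ℍ → V}
    (hf : Continuous f) (hC : ∀ w, ‖f w‖ ≤ C * growth σ w) (z : ℍ) :
    resolvent s f z = (∫ w, transitionKernel s (pointPair z w) • resolvent s f w) -
      ∫ w, greenNear s (pointPair z w) • f w := by
  have hs1 : 1 < s.re := by linarith
  have hcs := hasCompactSupport_transitionKernel hs1 z
  have hcont : Continuous fun w => transitionKernel s (pointPair z w) :=
    (contDiff_transitionKernel hs1).continuous.comp (continuous_pointPair_left z)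
  have h : ∫ w, transitionKernel s (pointPair z w) • resolvent s f w =
      -∫ w, greenFar s (pointPair z w) • f w := by
    rw [integral_smul_resolvent hσ hs hf hC hcont hcs]
    simp only [integral_green_mul_transitionKernel hs1]
  rw [h]
  have h2 := integral_green_smul_eq_add hσ hs hf hC z
  have h3 : resolvent s f z = -∫ w, green s (pointPair z w) • f w := rfl
  rw [h3, h2, neg_add_rev, sub_eq_add_neg]

theorem contMDiff_resolvent [CompleteSpace V] (hσ : 0 ≤ σ) (hs : 1 + σ < s.re) {f : ℍ → V}
    (hf : ContMDiff 𝓘(ℝ, ℂ) 𝓘(ℝ, V) ∞ f) (hC : ∀ w, ‖f w‖ ≤ C * growth σ w) :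
    ContMDiff 𝓘(ℝ, ℂ) 𝓘(ℝ, V) ∞ (resolvent s f) := by
  have hs1 : 1 < s.re := by linarith
  have e : resolvent s f = fun z => (∫ w, transitionKernel s (pointPair z w) • resolvent s f w) -
      ∫ w, greenNear s (pointPair z w) • f w :=
    funext fun z => resolvent_eq_parametrix hσ hs hf.continuous hC z
  rw [e]
  exact (contMDiff_integral_transitionKernel_smul hs1 (stronglyMeasurable_resolvent s hf.continuous)
    (norm_resolvent_le hσ hs hf.continuous hC)).sub (contMDiff_integral_greenNear_smul hs1 hf)

end Smoothness

/-! ### From the weak equation to the pointwise one. -/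

section WeakEquation

/-- Lets two continuous functions that agree almost everywhere be identified. -/
instance isOpenPosMeasure_uhp : (volume : Measure ℍ).IsOpenPosMeasure where
  open_pos := by
    rintro U hU ⟨z, hz⟩
    rw [volume_eq_lintegral]
    have hm : Measurable fun z : ℂ => (((1 / ‖z.im‖₊) ^ 2 : NNReal) : ENNReal) := by fun_prop
    refine (((setLIntegral_pos_iff hm).2 ?_)).ne'
    have hUo : IsOpen (((↑) : ℍ → ℂ) '' U) := isOpenEmbedding_coe.isOpenMap U hU
    refine (hUo.measure_pos volume ⟨z, z, hz, rfl⟩).trans_le (measure_mono ?_)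
    rintro _ ⟨w, hw, rfl⟩
    refine ⟨?_, w, hw, rfl⟩
    have := w.im_pos.ne'
    simpa using this

variable {V : Type*} [NormedAddCommGroup V] [NormedSpace ℂ V] {s : ℂ} {σ C : ℝ}

theorem hasCompactSupport_helmholtz (s : ℂ) {φ : ℍ → V} (hφ : HasCompactSupport φ) :
    HasCompactSupport (helmholtz s φ) := by
  refine HasCompactSupport.intro hφ fun w hw => ?_
  rw [helmholtz, hypLaplacian_eq_zero hw, image_eq_zero_of_notMem_tsupport hw, smul_zero, add_zero]

/-- L passes to φ by Green's identity, then R_s by Fubini, and R_s L φ = φ by the inversion formula,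
since φ and L φ are bounded. -/
theorem integral_smul_helmholtz_resolvent [CompleteSpace V] (hσ : 0 ≤ σ) (hs : 1 + σ < s.re)
    {f : ℍ → V} (hf : ContMDiff 𝓘(ℝ, ℂ) 𝓘(ℝ, V) ∞ f) (hC : ∀ w, ‖f w‖ ≤ C * growth σ w)
    {φ : ℍ → ℂ} (hφ : ContMDiff 𝓘(ℝ, ℂ) 𝓘(ℝ, ℂ) 2 φ) (hφc : HasCompactSupport φ) :
    ∫ w, φ w • helmholtz s (resolvent s f) w = ∫ w, φ w • f w := by
  have hc := hasCompactSupport_helmholtz s hφc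
  have hcont := continuous_helmholtz s hφ
  obtain ⟨A, hA⟩ := hφ.continuous.bounded_above_of_compact_support hφc
  obtain ⟨B, hB⟩ := hcont.bounded_above_of_compact_support hc
  have hA0 : 0 ≤ A := (norm_nonneg _).trans (hA I)
  have hB0 : 0 ≤ B := (norm_nonneg _).trans (hB I)
  rw [integral_smul_helmholtz s hφ hφc
    ((contMDiff_resolvent hσ hs hf hC).of_le (WithTop.coe_le_coe.2 le_top)),
    integral_smul_resolvent hσ hs hf.continuous hC hcont hc, ← integral_neg]
  refine integral_congr_ae (ae_of_all _ fun w => ?_)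
  have h := integral_green_smul_helmholtz hσ hs w hφ
    (fun w => (hA w).trans (le_mul_of_one_le_right hA0 (one_le_growth hσ w)))
    (fun w => (hB w).trans (le_mul_of_one_le_right hB0 (one_le_growth hσ w)))
  simp only [smul_eq_mul] at h
  simp only [h, _root_.neg_smul, neg_neg]

theorem helmholtz_resolvent [CompleteSpace V] (hσ : 0 ≤ σ) (hs : 1 + σ < s.re)
    {f : ℍ → V} (hf : ContMDiff 𝓘(ℝ, ℂ) 𝓘(ℝ, V) ∞ f) (hC : ∀ w, ‖f w‖ ≤ C * growth σ w) :
    helmholtz s (resolvent s f) = f := by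
  have hcont : Continuous (helmholtz s (resolvent s f)) := continuous_helmholtz s
    ((contMDiff_resolvent hσ hs hf hC).of_le (WithTop.coe_le_coe.2 le_top))
  refine (Continuous.ae_eq_iff_eq (μ := volume) hcont hf.continuous).1 ?_
  refine ae_eq_of_integral_contMDiff_smul_eq 𝓘(ℝ, ℂ) hcont.locallyIntegrable
    hf.continuous.locallyIntegrable fun g hg hgc => ?_
  have hφ : ContMDiff 𝓘(ℝ, ℂ) 𝓘(ℝ, ℂ) 2 (fun w => (g w : ℂ)) :=
    (Complex.ofRealCLM.contDiff (n := 2)).contMDiff.comp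
      (hg.of_le (WithTop.coe_le_coe.2 le_top))
  have hφc : HasCompactSupport fun w => (g w : ℂ) := hgc.comp_left Complex.ofReal_zero
  have h := integral_smul_helmholtz_resolvent hσ hs hf hC hφ hφc
  simpa only [Complex.coe_smul] using h

end WeakEquation

/-! ### The Laplacian through left-invariant vector fields. -/

section LieDerivatives

open LieAlgebra.SpecialLinear

/-- The upper triangular nilpotent element of `𝔰𝔩₂(ℝ)`. -/
def slE : sl (Fin 2) ℝ :=
  ⟨!![0, 1; 0, 0], show Matrix.trace !![(0 : ℝ), 1; 0, 0] = 0 by simp [Matrix.trace_fin_two]⟩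

/-- The diagonal element of `𝔰𝔩₂(ℝ)` generating the geodesic flow with unit speed. -/
def slH : sl (Fin 2) ℝ :=
  ⟨!![1 / 2, 0; 0, -(1 / 2)],
    show Matrix.trace !![(1 / 2 : ℝ), 0; 0, -(1 / 2)] = 0 by simp [Matrix.trace_fin_two]⟩

/-- The matrix has square zero, so the exponential series stops after the linear term. -/
theorem coe_expSL_smul_slE (t : ℝ) :
    (expSL (t • slE) : Matrix (Fin 2) (Fin 2) ℝ) = !![1, t; 0, 1] := by
  change NormedSpace.exp (t • !![(0 : ℝ), 1; 0, 0]) = _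
  have h2 : (t • !![(0 : ℝ), 1; 0, 0]) ^ 2 = 0 := by
    rw [pow_two]
    ext i j
    fin_cases i <;> fin_cases j <;> simp [Matrix.mul_apply]
  rw [NormedSpace.exp_eq_tsum ℝ]
  simp only
  rw [tsum_eq_sum (s := Finset.range 2)]
  · ext i j
    fin_cases i <;> fin_cases j <;> simp [Finset.sum_range_succ]
  · intro n hn
    have : 2 ≤ n := by
      have : ¬n < 2 := by simpa using hn
      lia
    rw [pow_eq_zero_of_le this h2, smul_zero]

theorem coe_expSL_smul_slH (t : ℝ) :
    (expSL (t • slH) : Matrix (Fin 2) (Fin 2) ℝ) =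
      !![Real.exp (t / 2), 0; 0, Real.exp (-(t / 2))] := by
  change NormedSpace.exp (t • !![(1 / 2 : ℝ), 0; 0, -(1 / 2)]) = _
  have h : t • !![(1 / 2 : ℝ), 0; 0, -(1 / 2)] = Matrix.diagonal ![t / 2, -(t / 2)] := by
    ext i j
    fin_cases i <;> fin_cases j <;> simp [Matrix.diagonal] <;> ring
  rw [h, Matrix.exp_diagonal]
  ext i j
  fin_cases i <;> fin_cases j <;> simp [Matrix.diagonal, Pi.coe_exp, Real.exp_eq_exp_ℝ]

theorem coe_expSL_smul_slE_smul_I (t : ℝ) :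
    ((expSL (t • slE) • I : ℍ) : ℂ) = Complex.I + t := by
  rw [coe_specialLinearGroup_apply]
  simp [coe_expSL_smul_slE]

theorem coe_expSL_smul_slH_smul_I (t : ℝ) :
    ((expSL (t • slH) • I : ℍ) : ℂ) = (Real.exp t : ℝ) * Complex.I := by
  have e : Real.exp t = Real.exp (t / 2) * Real.exp (t / 2) := by
    rw [← Real.exp_add]
    ring_nf
  have h0 : (Real.exp (t / 2) : ℂ) ≠ 0 := by exact_mod_cast (Real.exp_pos _).ne'
  rw [coe_specialLinearGroup_apply, e, ]
  simp only [coe_expSL_smul_slH, Real.exp_neg]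
  simp [-Complex.ofReal_exp]
  field_simp

theorem expSL_add_smul (X : sl (Fin 2) ℝ) (r t : ℝ) :
    expSL ((r + t) • X) = expSL (r • X) * expSL (t • X) := by
  apply Subtype.ext
  change NormedSpace.exp ((r + t) • (X : Matrix (Fin 2) (Fin 2) ℝ)) =
    NormedSpace.exp (r • (X : Matrix (Fin 2) (Fin 2) ℝ)) *
      NormedSpace.exp (t • (X : Matrix (Fin 2) (Fin 2) ℝ))
  rw [← Matrix.exp_add_of_commute _ _
    (((Commute.refl (X : Matrix (Fin 2) (Fin 2) ℝ)).smul_left r).smul_right t), add_smul]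

/-- Along a one-parameter subgroup, moving the base point is a translation in t, so iterating the
derivative gives an ordinary second derivative. -/
theorem lieDeriv_lieDeriv_self {W : Type*} [NormedAddCommGroup W] [NormedSpace ℝ W]
    (X : sl (Fin 2) ℝ) (F : SL(2, ℝ) → W) (g : SL(2, ℝ)) :
    lieDeriv X (lieDeriv X F) g = deriv (deriv fun t : ℝ => F (g * expSL (t • X))) 0 := by
  have e : (fun r : ℝ => lieDeriv X F (g * expSL (r • X))) =
      deriv fun t : ℝ => F (g * expSL (t • X)) := by
    funext r
    have h := deriv_comp_const_add (f := fun t : ℝ => F (g * expSL (t • X))) r 0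
    rw [add_zero] at h
    rw [← h, lieDeriv]
    simp only [expSL_add_smul, mul_assoc]
  rw [lieDeriv, e]

/-- The flow of E moves z horizontally with speed y; that of H moves it vertically with height y
e^t. -/
theorem lift_toSL2R_mul_expSL_slE {V : Type*} (f : ℍ → V) (z : ℍ) (t : ℝ) :
    lift f (z.toSL2R * expSL (t • slE)) = f (ofComplex ((z : ℂ) + (z.im * t : ℝ))) := by
  rw [lift, mul_smul, ← ofComplex_apply (z.toSL2R • expSL (t • slE) • I), coe_toSL2R_smul,
    coe_expSL_smul_slE_smul_I]
  congr 2
  conv_rhs => rw [← Complex.re_add_im (z : ℂ)]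
  push_cast
  simp only [coe_re, coe_im]
  ring

theorem lift_toSL2R_mul_expSL_slH {V : Type*} (f : ℍ → V) (z : ℍ) (t : ℝ) :
    lift f (z.toSL2R * expSL (t • slH)) =
      f (ofComplex ((z : ℂ) + (z.im * Real.exp t - z.im : ℝ) * Complex.I)) := by
  rw [lift, mul_smul, ← ofComplex_apply (z.toSL2R • expSL (t • slH) • I), coe_toSL2R_smul,
    coe_expSL_smul_slH_smul_I]
  congr 2
  conv_rhs => rw [← Complex.re_add_im (z : ℂ)]
  push_cast
  simp only [coe_re, coe_im]
  ring

variable {V : Type*} [NormedAddCommGroup V] [NormedSpace ℂ V] {s : ℂ} {σ C : ℝ}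

/-- The hyperbolic Laplacian in terms of left-invariant vector fields. -/
theorem hypLaplacian_eq_lieDeriv {f : ℍ → V} (hf : ContMDiff 𝓘(ℝ, ℂ) 𝓘(ℝ, V) 2 f) (z : ℍ) :
    hypLaplacian f z = lieDeriv slE (lieDeriv slE (lift f)) z.toSL2R +
      (lieDeriv slH (lieDeriv slH (lift f)) z.toSL2R - lieDeriv slH (lift f) z.toSL2R) := by
  set h : ℂ → V := fun ζ => f (ofComplex ζ)
  have hh : ContDiffAt ℝ 2 h z := contMDiff_real_iff.1 hf z z.im_pos
  have hE : lieDeriv slE (lieDeriv slE (lift f)) z.toSL2R =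
      (z.im ^ 2) • deriv (deriv fun t : ℝ => h ((z : ℂ) + t)) 0 := by
    rw [lieDeriv_lieDeriv_self]
    simp only [lift_toSL2R_mul_expSL_slE]
    have h1 : (deriv fun t : ℝ => h ((z : ℂ) + (z.im * t : ℝ))) =
        fun t => z.im • deriv (fun t : ℝ => h ((z : ℂ) + t)) (z.im * t) :=
      funext fun t => deriv_comp_mul_left z.im (fun t : ℝ => h ((z : ℂ) + t)) t
    change deriv (deriv fun t : ℝ => h ((z : ℂ) + (z.im * t : ℝ))) 0 = _
    rw [h1, deriv_fun_const_smul_field,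
      deriv_comp_mul_left z.im (deriv fun t : ℝ => h ((z : ℂ) + t)) 0, mul_zero, smul_smul, pow_two]
  set ψ : ℝ → V := fun t => h ((z : ℂ) + t * Complex.I)
  have hψ : ContDiffAt ℝ 2 ψ 0 := by
    refine ContDiffAt.comp (g := h) (0 : ℝ) (f := fun t : ℝ => (z : ℂ) + t * Complex.I) ?_ ?_
    · simpa using hh
    · exact (contDiff_const.add (Complex.ofRealCLM.contDiff.mul contDiff_const)).contDiffAt
  set q : ℝ → ℝ := fun t => z.im * Real.exp t - z.im
  have hq0 : q 0 = 0 := by simp [q]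
  have hq : ∀ t, HasDerivAt q (z.im * Real.exp t) t := fun t =>
    ((Real.hasDerivAt_exp t).const_mul z.im).sub_const z.im
  have hH : lieDeriv slH (lift f) z.toSL2R = z.im • deriv ψ 0 := by
    rw [lieDeriv]
    simp only [lift_toSL2R_mul_expSL_slH]
    change deriv (fun t => ψ (q t)) 0 = _
    have hd : HasDerivAt ψ (deriv ψ 0) (q 0) := by
      rw [hq0]
      exact (hψ.differentiableAt two_ne_zero).hasDerivAt
    have := (hd.scomp 0 (hq 0)).deriv
    rw [Real.exp_zero, mul_one] at this
    exact this
  -- Because the height moves as y e^t, H² produces a first-order term y ∂_y besides y² ∂_y²;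
  -- subtracting H removes it.
  have hHH : lieDeriv slH (lieDeriv slH (lift f)) z.toSL2R =
      z.im • deriv ψ 0 + (z.im ^ 2) • deriv (deriv ψ) 0 := by
    rw [lieDeriv_lieDeriv_self]
    simp only [lift_toSL2R_mul_expSL_slH]
    change deriv (deriv fun t => ψ (q t)) 0 = _
    have := deriv_deriv_comp (k := ψ) (q := q) (q₁ := fun t => z.im * Real.exp t)
      (Eventually.of_forall hq)
      ((Real.hasDerivAt_exp 0).const_mul z.im) (by rw [hq0]; exact hψ)
    simpa only [hq0, Real.exp_zero, mul_one] using this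
  rw [hE, hH, hHH, hypLaplacian, laplacian_eq_deriv hh, smul_add, add_sub_cancel_left]

theorem GrowthBound.exists_norm_le {W : Type*} [NormedAddCommGroup W] {F : SL(2, ℝ) → W}
    (hF : GrowthBound σ F) : ∃ C, ∀ z : ℍ, ‖F z.toSL2R‖ ≤ C * growth σ z := by
  obtain ⟨C, hC⟩ := hF
  refine ⟨C, fun z => ?_⟩
  have := hC z.toSL2R
  rwa [toSL2R_smul_I] at this

/-- Only E², H² and H are needed, evaluated on the section z ↦ `z.toSL2R` of the orbit map. -/
theorem exists_norm_helmholtz_le {f : ℍ → V} (hf : ContMDiff 𝓘(ℝ, ℂ) 𝓘(ℝ, V) 2 f)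
    (h0 : ∀ w, ‖f w‖ ≤ C * growth σ w)
    (h1 : ∀ X : sl (Fin 2) ℝ, GrowthBound σ (lieDeriv X (lift f)))
    (h2 : ∀ X Y : sl (Fin 2) ℝ, GrowthBound σ (lieDeriv X (lieDeriv Y (lift f)))) (s : ℂ) :
    ∃ C', ∀ w, ‖helmholtz s f w‖ ≤ C' * growth σ w := by
  obtain ⟨A, hA⟩ := (h2 slE slE).exists_norm_le
  obtain ⟨B, hB⟩ := (h2 slH slH).exists_norm_le
  obtain ⟨D, hD⟩ := (h1 slH).exists_norm_le
  refine ⟨A + (B + D) + ‖s * (1 - s)‖ * C, fun w => ?_⟩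
  rw [helmholtz, hypLaplacian_eq_lieDeriv hf]
  calc _ ≤ A * growth σ w + (B * growth σ w + D * growth σ w) +
        ‖s * (1 - s)‖ * (C * growth σ w) := by
        refine (norm_add_le _ _).trans (add_le_add ((norm_add_le _ _).trans
          (add_le_add (hA w) ((norm_sub_le _ _).trans (add_le_add (hB w) (hD w))))) ?_)
        rw [norm_smul]
        exact mul_le_mul_of_nonneg_left (h0 w) (norm_nonneg _)
    _ = _ := by ring

end LieDerivatives

end HypResolvent

end

/-! ### The resolvent theorem. -/

theorem theorem5p2 {V : Type*} [NormedAddCommGroup V] [InnerProductSpace ℂ V]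
    [FiniteDimensional ℂ V] (f : ℍ → V) (hf : ContMDiff 𝓘(ℝ, ℂ) 𝓘(ℝ, V) ∞ f)
    (σ : ℝ) (hσ : 0 < σ)
    (h0 : HypResolvent.GrowthBound σ (HypResolvent.lift f))
    (h1 : ∀ X : LieAlgebra.SpecialLinear.sl (Fin 2) ℝ,
      HypResolvent.GrowthBound σ (HypResolvent.lieDeriv X (HypResolvent.lift f)))
    (h2 : ∀ X Y : LieAlgebra.SpecialLinear.sl (Fin 2) ℝ,
      HypResolvent.GrowthBound σ
        (HypResolvent.lieDeriv X (HypResolvent.lieDeriv Y (HypResolvent.lift f))))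
    (s : ℂ) (hs : 1 + σ < s.re) :
    (∀ z : ℍ, MeasureTheory.Integrable
        (fun w : ℍ => HypResolvent.green s (HypResolvent.pointPair z w) • f w)) ∧
    (∀ z : ℍ, MeasureTheory.Integrable
        (fun w : ℍ => HypResolvent.green s (HypResolvent.pointPair z w) •
          HypResolvent.helmholtz s f w)) ∧
    ContMDiff 𝓘(ℝ, ℂ) 𝓘(ℝ, V) ∞ (HypResolvent.resolvent s f) ∧
    HypResolvent.helmholtz s (HypResolvent.resolvent s f) = f ∧
    HypResolvent.resolvent s (HypResolvent.helmholtz s f) = f := by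
  have : CompleteSpace V := FiniteDimensional.complete ℂ V
  obtain ⟨C, hC⟩ := h0.exists_norm_le
  simp only [HypResolvent.lift, UpperHalfPlane.toSL2R_smul_I] at hC
  have hf2 : ContMDiff 𝓘(ℝ, ℂ) 𝓘(ℝ, V) 2 f := hf.of_le (WithTop.coe_le_coe.2 le_top)
  obtain ⟨C', hC'⟩ := HypResolvent.exists_norm_helmholtz_le hf2 hC h1 h2 s
  refine ⟨fun z => HypResolvent.integrable_green_smul hσ.le hs z hf.continuous hC,
    fun z => HypResolvent.integrable_green_smul hσ.le hs z
      (HypResolvent.continuous_helmholtz s hf2) hC',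
    HypResolvent.contMDiff_resolvent hσ.le hs hf hC,
    HypResolvent.helmholtz_resolvent hσ.le hs hf hC, funext fun z => ?_⟩
  rw [HypResolvent.resolvent,
    HypResolvent.integral_green_smul_helmholtz hσ.le hs z hf2 hC hC', neg_neg]
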